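/- Let $M$ be a complete connected $C^\infty$ Riemannian manifold (without boundary, compact or not) with Riemannian distance $d$, open balls $B(x,r)$, Riemannian measure $\mu$, gradient $\nabla$, and let $1\le q<\infty$. Write $\|\cdot\|_p$ for the norm of $L_p(M,\mu)$. Assume - $(D)$: there is a constant $C$ with $\mu(B(x,2r))\le C\,\mu(B(x,r))$ for all $x\in M$, $r>0$; - $(P_q)$: there is a constant $C$ such that for every $f\in C_0^\infty(M)$ and every ball $B$ of radius $r>0$, with $f_B=\frac1{\mu(B)}\int_B f\,d\mu$, $$\Bigl(\tfrac1{\mu(B)}\int_B|f-f_B|^q\,d\mu\Bigr)^{1/q}\le C\,r\,\Bigl(\tfrac1{\mu(B)}\int_B|\nabla f|^q\,d\mu\Bigr)^{1/q}.$$ Let $W^1_q$ be the completion of $\{\varphi\in C^\infty(M):\varphi,|\nabla\varphi|\in L_q\}$ for the norm $\|\varphi\|_q+\|\,|\nabla\varphi|\,\|_q$, realized as a subspace of $L_q$, and let $W^1_\infty$ be the space of bounded Lipschitz functions on $M$. For $1\le p\le\infty$ let $\dot E^1_p$ be the space of distributions whose distributional gradient satisfies $|\nabla f|\in L_p$, and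 $\dot W^1_p=\dot E^1_p/\mathbb R$. Functions are real-valued, equalities of functions hold $\mu$-almost everywhere, and $\bar f$ is the class of $f$ modulo constants. For $t>0$ and $f\in W^1_q+W^1_\infty$ put $$K'(f,t)=\inf_{\substack{f=h+g\\ h\in W^1_q,\ g\in W^1_\infty}}\bigl(\|\,|\nabla h|\,\|_q+t\,\|\,|\nabla g|\,\|_\infty\bigr),\qquad K(\bar f,t,\dot W^1_q,\dot W^1_\infty)=\inf_{\substack{f=h+g\\ h\in\dot E^1_q,\ g\in\dot E^1_\infty}}\bigl(\|\,|\nabla h|\,\|_q+t\,\|\,|\nabla g|\,\|_\infty\bigr).$$ For a measurable function $u$ on $M$ let $u^*(t)=\inf\{\lambda\ge0:\mu(\{|u|>\lambda\})\le t\}$, $u^*(\infty)=\inf\{\lambda\ge0:\mu(\{|u|>\lambda\})<\infty\}$, $u^{**}(t)=\frac1t\int_0^t u^*(s)\,ds$, and $|u|^{q**}=(|u|^q)^{**}$. Then there are constants $C_1,C_2>0$ such that for every $f\in W^1_q+W^1_\infty$ with $f^*(\infty)=0$ and $|\nabla f|^*(\infty)=0$ and every $t>0$, $$C_1\,t^{1/q}\bigl(|\nabla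 f|^{q**}(t)\bigr)^{1/q}\le K'(f,t^{1/q})\le C_2\,t^{1/q}\bigl(|\nabla f|^{q**}(t)\bigr)^{1/q}.$$ Consequently, there are constants $C_1,C_2>0$ such that for all such $f$ and all $t>0$, $$C_1\,K(\bar f,t^{1/q},\dot W^1_q,\dot W^1_\infty)\le K'(f,t^{1/q})\le C_2\,K(\bar f,t^{1/q},\dot W^1_q,\dot W^1_\infty).$$ -/

import Mathlib

open MeasureTheory Set Filter Topology Bundle
open scoped Manifold ContDiff ENNReal NNReal

namespace RiemSobolev

noncomputable section

/-! ### Decreasing rearrangements -/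

section Rearrangement

variable {M : Type*} [MeasurableSpace M]

/-- Decreasing rearrangement `u^*(t) = inf {l ≥ 0 : μ {|u| > l} ≤ t}`, with values in `[0, ∞]`. -/
def rearr (μ : Measure M) (u : M → ℝ) (t : ℝ) : ℝ≥0∞ :=
  sInf {l : ℝ≥0∞ | μ {x | l < ‖u x‖ₑ} ≤ ENNReal.ofReal t}

/-- `u^*(∞) = inf {l ≥ 0 : μ {|u| > l} < ∞}`. -/
def rearrInfty (μ : Measure M) (u : M → ℝ) : ℝ≥0∞ :=
  sInf {l : ℝ≥0∞ | μ {x | l < ‖u x‖ₑ} < ⊤}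

/-- `u^{**}(t) = (1/t) ∫_0^t u^*(s) ds`. -/
def rearrAvg (μ : Measure M) (u : M → ℝ) (t : ℝ) : ℝ≥0∞ :=
  (ENNReal.ofReal t)⁻¹ * ∫⁻ s in Ioc 0 t, rearr μ u s

/-- `(|u|^{q**})^{1/q}(t)`, where `|u|^{q**}` is the function `(|u|^q)^{**}`. -/
def rearrAvgPow (μ : Measure M) (q : ℝ) (u : M → ℝ) (t : ℝ) : ℝ≥0∞ :=
  (rearrAvg μ (fun x => |u x| ^ q) t) ^ (1 / q)

end Rearrangement

section Manifold

variable {n : ℕ} {M : Type*} [MetricSpace M] [ChartedSpace (EuclideanSpace ℝ (Fin n)) M]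

/-- The coordinate vector `∂_i` of the chart at `x₀`, at the point with coordinates `y`. -/
def coordVec (x₀ : M) (y : EuclideanSpace ℝ (Fin n)) (i : Fin n) :
    TangentSpace (𝓡 n) ((chartAt (EuclideanSpace ℝ (Fin n)) x₀).symm y) :=
  mfderiv (𝓡 n) (𝓡 n) (chartAt (EuclideanSpace ℝ (Fin n)) x₀).symm y
    (EuclideanSpace.single i (1 : ℝ) : EuclideanSpace ℝ (Fin n))

variable [RiemannianBundle (fun x : M => TangentSpace (𝓡 n) x)]

/-- The density `√(det (g_ij))` of the metric in the chart at `x₀`. -/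
def chartDensity (x₀ : M) (y : EuclideanSpace ℝ (Fin n)) : ℝ≥0∞ :=
  ENNReal.ofReal (Real.sqrt (Matrix.det (Matrix.of fun i j : Fin n =>
    inner ℝ (coordVec x₀ y i) (coordVec x₀ y j))))

/-- The measure `√(det (g_ij)) dy` of the chart at `x₀`, carried to the domain of that chart
(and zero outside of it). -/
def chartVolume [MeasurableSpace M] (x₀ : M) : Measure M :=
  Measure.map (chartAt (EuclideanSpace ℝ (Fin n)) x₀).symm
    ((volume.restrict (chartAt (EuclideanSpace ℝ (Fin n)) x₀).target).withDensity
      (chartDensity x₀))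

variable (n M) in
/-- The Riemannian measure: the least measure that dominates `√(det (g_ij)) dy` on the domain of
each chart. As these local measures agree on overlaps, its restriction to the domain of a chart is
exactly `√(det (g_ij)) dy`. -/
def riemVol [MeasurableSpace M] : Measure M :=
  ⨆ x₀ : M, chartVolume (n := n) x₀

/-- `X` is the distributional gradient of the locally integrable function `f`: in each chart, for
each `i`, the function `⟨X, ∂_i⟩` is locally integrable and is the distributional derivative
`∂_i f`. -/
def IsWeakGrad (f : M → ℝ) (X : ∀ x : M, TangentSpace (𝓡 n) x) : Prop :=
  ∀ x₀ : M,
    let e := chartAt (EuclideanSpace ℝ (Fin n)) x₀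
    LocallyIntegrableOn (fun y => f (e.symm y)) e.target volume ∧
    ∀ i : Fin n,
      LocallyIntegrableOn (fun y => (inner ℝ (X (e.symm y)) (coordVec x₀ y i) : ℝ))
        e.target volume ∧
      ∀ ψ : EuclideanSpace ℝ (Fin n) → ℝ, ContDiff ℝ ∞ ψ → HasCompactSupport ψ →
        tsupport ψ ⊆ e.target →
        ∫ y, f (e.symm y) * fderiv ℝ ψ y (EuclideanSpace.single i (1 : ℝ)) =
          -∫ y, (inner ℝ (X (e.symm y)) (coordVec x₀ y i) : ℝ) * ψ y

variable (n) in
/-- `f` is locally integrable and its distributional gradient is a locally integrable vector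
field. -/
def HasWeakGrad (f : M → ℝ) : Prop :=
  ∃ X : ∀ x : M, TangentSpace (𝓡 n) x, IsWeakGrad f X

open Classical in
/-- The distributional gradient `∇f` (unique up to a null set), zero if there is none. -/
def weakGrad (f : M → ℝ) (x : M) : TangentSpace (𝓡 n) x :=
  if h : HasWeakGrad n f then h.choose x else 0

variable (n) in
/-- The length `|∇f|` of the distributional gradient. -/
def gradLen (f : M → ℝ) (x : M) : ℝ := ‖(weakGrad f x : TangentSpace (𝓡 n) x)‖

/-- The gradient of a differentiable function: the vector that represents its differential. -/
def grad (f : M → ℝ) (x : M) : TangentSpace (𝓡 n) x :=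
  haveI : FiniteDimensional ℝ (TangentSpace (𝓡 n) x) :=
    inferInstanceAs (FiniteDimensional ℝ (EuclideanSpace ℝ (Fin n)))
  haveI : CompleteSpace (TangentSpace (𝓡 n) x) := FiniteDimensional.complete ℝ _
  (InnerProductSpace.toDual ℝ (TangentSpace (𝓡 n) x)).symm (mfderiv (𝓡 n) 𝓘(ℝ, ℝ) f x)

variable [MeasurableSpace M]

variable (n M) in
/-- The doubling property `(D)`. -/
def Doubling : Prop :=
  ∃ C : ℝ≥0, ∀ (x : M) (r : ℝ), 0 < r →
    riemVol n M (Metric.ball x (2 * r)) ≤ C * riemVol n M (Metric.ball x r)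

variable (n M) in
/-- The Poincaré inequality `(P_q)`. -/
def Poincare (q : ℝ) : Prop :=
  ∃ C : ℝ≥0, ∀ f : M → ℝ, ContMDiff (𝓡 n) 𝓘(ℝ, ℝ) ∞ f → HasCompactSupport f →
    ∀ (x : M) (r : ℝ), 0 < r →
      (⨍⁻ y in Metric.ball x r,
          ‖f y - ⨍ z in Metric.ball x r, f z ∂(riemVol n M)‖ₑ ^ q ∂(riemVol n M)) ^ (1 / q) ≤
        C * ENNReal.ofReal r *
          (⨍⁻ y in Metric.ball x r,
            ‖(grad f y : TangentSpace (𝓡 n) y)‖ₑ ^ q ∂(riemVol n M)) ^ (1 / q)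

variable (n) in
/-- The space `E^1_q` of smooth functions `φ` with `φ` and `|∇φ|` in `L_q`. -/
def MemE (q : ℝ) (φ : M → ℝ) : Prop :=
  ContMDiff (𝓡 n) 𝓘(ℝ, ℝ) ∞ φ ∧
  MemLp φ (ENNReal.ofReal q) (riemVol n M) ∧
  MemLp (fun x => ‖(grad φ x : TangentSpace (𝓡 n) x)‖) (ENNReal.ofReal q) (riemVol n M)

variable (n) in
/-- The Sobolev space `W^1_q`, `1 ≤ q < ∞`: the completion of `E^1_q` for the norm
`‖φ‖_q + ‖|∇φ|‖_q`, realized in `L_q` as the set of the limits in this norm. -/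
def MemW (q : ℝ) (f : M → ℝ) : Prop :=
  MemLp f (ENNReal.ofReal q) (riemVol n M) ∧ HasWeakGrad n f ∧
  ∃ φ : ℕ → M → ℝ, (∀ k, MemE n q (φ k)) ∧
    Tendsto (fun k =>
      eLpNorm (fun x => φ k x - f x) (ENNReal.ofReal q) (riemVol n M) +
      eLpNorm (fun x => ‖(grad (φ k) x - weakGrad f x : TangentSpace (𝓡 n) x)‖)
        (ENNReal.ofReal q) (riemVol n M)) atTop (𝓝 0)

/-- The space `W^1_∞` of bounded Lipschitz functions. -/
def MemWInfty {M : Type*} [MetricSpace M] (g : M → ℝ) : Prop :=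
  (∃ C : ℝ, ∀ x, |g x| ≤ C) ∧ ∃ L : ℝ≥0, LipschitzWith L g

variable (n) in
/-- The sum `W^1_q + W^1_∞`. -/
def MemWSum (q : ℝ) (f : M → ℝ) : Prop :=
  ∃ h g : M → ℝ, MemW n q h ∧ MemWInfty g ∧ f =ᵐ[riemVol n M] fun x => h x + g x

variable (n) in
/-- The space of the `f` whose distributional gradient satisfies `|∇f| ∈ L_p`, `1 ≤ p ≤ ∞`
(a distribution with locally integrable gradient is a locally integrable function). -/
def MemEDot (p : ℝ≥0∞) (f : M → ℝ) : Prop :=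
  HasWeakGrad n f ∧ MemLp (gradLen n f) p (riemVol n M)

variable (n) in
/-- `K'(f,t)`: the infimum of `‖|∇h|‖_q + t ‖|∇g|‖_∞` over `f = h + g` with `h ∈ W^1_q` and
`g ∈ W^1_∞`. -/
def KPrime (q : ℝ) (f : M → ℝ) (t : ℝ) : ℝ≥0∞ :=
  sInf {r | ∃ h g : M → ℝ, MemW n q h ∧ MemWInfty g ∧
    (f =ᵐ[riemVol n M] fun x => h x + g x) ∧
    r = eLpNorm (gradLen n h) (ENNReal.ofReal q) (riemVol n M) +
      ENNReal.ofReal t * eLpNorm (gradLen n g) ∞ (riemVol n M)}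

variable (n) in
/-- The `K`-functional of the class of `f` modulo constants for the two homogeneous Sobolev spaces
of exponents `q` and `∞`; the additive constant can be put into `h` or `g`, so that it is the
infimum of `‖|∇h|‖_q + t ‖|∇g|‖_∞` over `f = h + g` with `|∇h| ∈ L_q` and `|∇g| ∈ L_∞`. -/
def KHom (q : ℝ) (f : M → ℝ) (t : ℝ) : ℝ≥0∞ :=
  sInf {r | ∃ h g : M → ℝ, MemEDot n (ENNReal.ofReal q) h ∧ MemEDot n ∞ g ∧
    (f =ᵐ[riemVol n M] fun x => h x + g x) ∧
    r = eLpNorm (gradLen n h) (ENNReal.ofReal q) (riemVol n M) +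
      ENNReal.ofReal t * eLpNorm (gradLen n g) ∞ (riemVol n M)}

end Manifold

end

end RiemSobolev

/-! Lower bound. If `f = h + g`, then `|∇f| ≤ |∇h| + ‖∇g‖_∞` almost everywhere, so by convexity
`|∇f|^q ≤ 2^(q-1) (|∇h|^q + ‖∇g‖_∞^q)`. Integrating rearrangements over `(0, t]` and taking `q`-th
roots bounds `t^(1/q) (|∇f|^{q**}(t))^(1/q)` by a multiple of the cost of the decomposition
(`rearrAvgPow_le_of_decomposition`). This uses only `|∇h| ∈ L_q` and `|∇g| ∈ L_∞`, so it bounds the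
homogeneous functional from below as well; since that functional is at most `K'`, the comparison of
the two functionals follows from the two-sided estimate.

Upper bound. Put `T = |∇f|^{q**}(t)`, and let `Ω` be the set where the maximal function of `|∇f|^q`
exceeds a fixed multiple of `T`. The weak type inequality, applied to the part of `|∇f|^q` above its
rearrangement at `t`, gives `μ(Ω) ≤ t`. Off `Ω` the Poincaré inequality bounds the mean oscillation
of `f` on every ball by a multiple of `T^(1/q)` times the radius, and telescoping averages over
shrinking balls shows that `f` is Lipschitz there, up to a null set
(`exists_lipschitz_of_oscillation_le`). Extend this restriction to `M`, truncated at a level that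
`|f|` exceeds on a set of measure at most `t`. The result `g` is bounded, has Lipschitz constant of
order `T^(1/q)`, and equals `f` off a set `B` with `μ(B) ≤ 2t`
(`exists_lipschitz_eq_off_small_set`). Then `h = f - g` vanishes off `B`, hence so does its
gradient, and on `B` one has `|∇h| ≤ |∇f| + L` and `∫_B |∇f|^q ≤ 3tT`. The Lipschitz extension
replaces a Calderón-Zygmund decomposition over balls.

Sobolev theory. The argument needs that the gradient of a Lipschitz function is bounded by its
Lipschitz constant, that a weak gradient vanishes almost everywhere on the zero set of its function,
and that functions with `f, |∇f| ∈ L_q` lie in the completion `W^1_q` (`memW_of_memLp`). The last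
rests on properness of `M`, a consequence of completeness and doubling, together with cutoffs,
partitions of unity and mollification in charts. The same approximation carries the Poincaré
inequality from test functions to `f`. -/

namespace RiemSobolev

noncomputable section

set_option linter.unusedSectionVars false
set_option linter.style.haveILetI false


/-! ### Coordinate frames and the Gram matrix of the metric -/

section Frame

variable {n : ℕ} {M : Type*} [MetricSpace M] [ChartedSpace (EuclideanSpace ℝ (Fin n)) M]

local notation "𝔼" => EuclideanSpace ℝ (Fin n)

/-- The coordinate frame as a linear map. -/
def frame (x₀ : M) (y : 𝔼) : 𝔼 →L[ℝ] TangentSpace (𝓡 n) ((chartAt 𝔼 x₀).symm y) :=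
  mfderiv (𝓡 n) (𝓡 n) (chartAt 𝔼 x₀).symm y

lemma frame_single (x₀ : M) (y : 𝔼) (i : Fin n) :
    frame x₀ y (EuclideanSpace.single i (1:ℝ)) = coordVec x₀ y i := rfl

variable [IsManifold (𝓡 n) ∞ M]

lemma frame_mdiff (x₀ : M) {y : 𝔼} (hy : y ∈ (chartAt 𝔼 x₀).target) :
   MDifferentiableAt (𝓡 n) (𝓡 n) (chartAt 𝔼 x₀).symm y := by
  exact ((contMDiffOn_chart_symm (I := 𝓡 n) (n := ∞) (x := x₀)).contMDiffAt
    ((chartAt 𝔼 x₀).open_target.mem_nhds hy)).mdifferentiableAt (by simp)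

lemma chart_mdiff (x₀ : M) {x : M} (hy : x ∈ (chartAt 𝔼 x₀).source) :
   MDifferentiableAt (𝓡 n) (𝓡 n) (chartAt 𝔼 x₀) x := by
  exact ((contMDiffOn_chart (I := 𝓡 n) (n := ∞) (x := x₀)).contMDiffAt
    ((chartAt 𝔼 x₀).open_source.mem_nhds hy)).mdifferentiableAt (by simp)

lemma mfderiv_chart_frame (x₀ : M) {y : 𝔼} (hy : y ∈ (chartAt 𝔼 x₀).target) (v : 𝔼) :
   (mfderiv (𝓡 n) (𝓡 n) (chartAt 𝔼 x₀) ((chartAt 𝔼 x₀).symm y) (frame x₀ y v) : 𝔼) = v := by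
  have h := mfderiv_comp y (chart_mdiff x₀ ((chartAt 𝔼 x₀).map_target hy)) (frame_mdiff x₀ hy)
  have h2 : ((chartAt 𝔼 x₀) ∘ (chartAt 𝔼 x₀).symm) =ᶠ[𝓝 y] id := by
    filter_upwards [(chartAt 𝔼 x₀).open_target.mem_nhds hy] with z hz
    simp [(chartAt 𝔼 x₀).right_inv hz]
  rw [h2.mfderiv_eq, mfderiv_id] at h
  exact (DFunLike.congr_fun h v).symm

lemma frame_injective (x₀ : M) {y : 𝔼} (hy : y ∈ (chartAt 𝔼 x₀).target) :
    Function.Injective (frame x₀ y) := by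
  intro v w h
  rw [← mfderiv_chart_frame x₀ hy v, h, mfderiv_chart_frame x₀ hy w]

lemma frame_surjective (x₀ : M) {y : 𝔼} (hy : y ∈ (chartAt 𝔼 x₀).target) :
    Function.Surjective (frame x₀ y) := by
  exact (LinearMap.injective_iff_surjective (V := 𝔼)
    (f := ((frame x₀ y : 𝔼 →L[ℝ] TangentSpace (𝓡 n) ((chartAt 𝔼 x₀).symm y)) :
      𝔼 →ₗ[ℝ] TangentSpace (𝓡 n) ((chartAt 𝔼 x₀).symm y)))).1 (frame_injective x₀ hy)

variable [RiemannianBundle (fun x : M => TangentSpace (𝓡 n) x)]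
    [IsContMDiffRiemannianBundle (𝓡 n) ∞ (EuclideanSpace ℝ (Fin n))
      (fun x : M => TangentSpace (𝓡 n) x)]

/-- The frame on a fixed vector is the tangent map of the inverse chart along a constant section.
Continuity in the total space suffices: it makes the entries of the Gram matrix continuous. -/
lemma contMDiffOn_frame (x₀ : M) (v : 𝔼) : ContMDiffOn (𝓡 n) ((𝓡 n).prod (𝓡 n)) 0
    (fun y => (⟨(chartAt 𝔼 x₀).symm y, frame x₀ y v⟩ :
      TotalSpace 𝔼 (fun x : M => TangentSpace (𝓡 n) x)))
    (chartAt 𝔼 x₀).target := by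
  have h1 := (contMDiffOn_chart_symm (I := 𝓡 n) (n := 1) (x := x₀)).contMDiffOn_tangentMapWithin
    (m := 0) (by simp)
    (chartAt 𝔼 x₀).open_target.uniqueMDiffOn
  have h2 : ContMDiff (𝓡 n) ((𝓡 n).prod (𝓡 n)) 0
      (fun y : 𝔼 => (⟨y, v⟩ : TangentBundle (𝓡 n) 𝔼)) := by
    intro y
    apply contMDiffAt_vectorSpace_iff_contDiffAt.2
    exact contDiffAt_const
  have h3 := h1.comp (h2.contMDiffOn (s := (chartAt 𝔼 x₀).target)) (fun y hy => hy)
  refine h3.congr (fun y hy => ?_)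
  simp only [tangentMapWithin, Function.comp, frame]
  rw [mfderivWithin_of_isOpen (chartAt 𝔼 x₀).open_target hy]
  rfl

lemma continuousOn_inner_frame (x₀ : M) (v w : 𝔼) :
   ContinuousOn (fun y => (inner ℝ (frame x₀ y v) (frame x₀ y w) : ℝ)) (chartAt 𝔼 x₀).target := by
  have : IsContMDiffRiemannianBundle (𝓡 n) 0 𝔼 (fun x : M => TangentSpace (𝓡 n) x) :=
    IsContMDiffRiemannianBundle.of_le (n := ∞) (by simp)
  have := (contMDiffOn_frame x₀ v).inner_bundle (contMDiffOn_frame x₀ w)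
  exact this.continuousOn

lemma inner_grad (f : M → ℝ) (x : M) (v : TangentSpace (𝓡 n) x) :
    (inner ℝ (grad f x) v : ℝ) = mfderiv (𝓡 n) 𝓘(ℝ, ℝ) f x v := by
  have : FiniteDimensional ℝ (TangentSpace (𝓡 n) x) :=
    inferInstanceAs (FiniteDimensional ℝ (EuclideanSpace ℝ (Fin n)))
  have : CompleteSpace (TangentSpace (𝓡 n) x) := FiniteDimensional.complete ℝ _
  simp only [grad]
  exact InnerProductSpace.toDual_symm_apply

/-- Differentiability is required of the chart representative only, since Rademacher's theorem
supplies it in charts. It returns to the manifold by composition with the chart. -/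
lemma inner_grad_frame (f : M → ℝ) (x₀ : M) {y : 𝔼} (hy : y ∈ (chartAt 𝔼 x₀).target)
   (hf : DifferentiableAt ℝ (fun y => f ((chartAt 𝔼 x₀).symm y)) y) (v : 𝔼) :
   (inner ℝ (grad f ((chartAt 𝔼 x₀).symm y)) (frame x₀ y v) : ℝ) =
      fderiv ℝ (fun y => f ((chartAt 𝔼 x₀).symm y)) y v := by
  have hm : MDifferentiableAt (𝓡 n) 𝓘(ℝ, ℝ) f ((chartAt 𝔼 x₀).symm y) := by
    have h1 : MDifferentiableAt (𝓡 n) 𝓘(ℝ, ℝ) ((fun y => f ((chartAt 𝔼 x₀).symm y)) ∘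
        (chartAt 𝔼 x₀)) ((chartAt 𝔼 x₀).symm y) := by
      apply MDifferentiableAt.comp (I' := 𝓡 n)
      · rw [(chartAt 𝔼 x₀).right_inv hy]; exact hf.mdifferentiableAt
      · exact chart_mdiff x₀ ((chartAt 𝔼 x₀).map_target hy)
    apply h1.congr_of_eventuallyEq
    filter_upwards [(chartAt 𝔼 x₀).open_source.mem_nhds ((chartAt 𝔼 x₀).map_target hy)] with z hz
    simp [(chartAt 𝔼 x₀).left_inv hz]
  rw [inner_grad, ← mfderiv_eq_fderiv]
  have := mfderiv_comp y hm (frame_mdiff x₀ hy)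
  exact (DFunLike.congr_fun this v).symm

lemma frame_eq_sum (x₀ : M) (y v : 𝔼) : frame x₀ y v = ∑ i, v i • coordVec x₀ y i := by
  have h : v = ∑ i, v i • (EuclideanSpace.single i (1 : ℝ) : 𝔼) := by
    ext j
    simp [Finset.sum_apply, Pi.single_apply]
  conv_lhs => rw [h]
  rw [map_sum]
  simp_rw [map_smul, frame_single]

lemma linearIndependent_coordVec (x₀ : M) {y : 𝔼} (hy : y ∈ (chartAt 𝔼 x₀).target) :
    LinearIndependent ℝ (coordVec x₀ y) := by
  rw [Fintype.linearIndependent_iff]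
  intro g hg i
  have h0 : frame x₀ y (WithLp.toLp 2 g) = 0 := by
    rw [frame_eq_sum]; exact hg
  have h1 : (WithLp.toLp 2 g : 𝔼) = 0 := frame_injective x₀ hy (by rw [h0, map_zero])
  simpa using congrArg (fun v : 𝔼 => v i) h1

/-- The Gram matrix of the coordinate frame. -/
def gramMat (x₀ : M) (y : 𝔼) : Matrix (Fin n) (Fin n) ℝ :=
  Matrix.of fun i j : Fin n => inner ℝ (coordVec x₀ y i) (coordVec x₀ y j)

lemma gramMat_det_pos (x₀ : M) {y : 𝔼} (hy : y ∈ (chartAt 𝔼 x₀).target) :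
    0 < (gramMat x₀ y).det := by
  have h : (Matrix.gram ℝ (coordVec x₀ y)).PosDef :=
    Matrix.posDef_gram_of_linearIndependent (linearIndependent_coordVec x₀ hy)
  have h2 : gramMat x₀ y = Matrix.gram ℝ (coordVec x₀ y) := rfl
  rw [h2]
  exact h.det_pos

lemma continuousOn_gramMat (x₀ : M) :
    ContinuousOn (gramMat x₀) (chartAt 𝔼 x₀).target := by
  refine continuousOn_pi.2 fun i => continuousOn_pi.2 fun j => ?_
  exact continuousOn_inner_frame x₀ _ _

lemma continuousOn_gramMat_det (x₀ : M) :
    ContinuousOn (fun y => (gramMat x₀ y).det) (chartAt 𝔼 x₀).target :=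
  (Continuous.matrix_det continuous_id).comp_continuousOn (continuousOn_gramMat x₀)

lemma chartDensity_eq (x₀ : M) (y : 𝔼) :
    chartDensity x₀ y = ENNReal.ofReal (Real.sqrt (gramMat x₀ y).det) := rfl

lemma continuousOn_chartDensity (x₀ : M) :
    ContinuousOn (chartDensity x₀) (chartAt 𝔼 x₀).target :=
  ENNReal.continuous_ofReal.comp_continuousOn
    (Real.continuous_sqrt.comp_continuousOn (continuousOn_gramMat_det x₀))

lemma chartDensity_pos (x₀ : M) {y : 𝔼} (hy : y ∈ (chartAt 𝔼 x₀).target) :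
    0 < chartDensity x₀ y := by
  rw [chartDensity_eq]
  exact ENNReal.ofReal_pos.2 (Real.sqrt_pos.2 (gramMat_det_pos x₀ hy))

lemma inner_frame_frame (x₀ : M) (y v w : 𝔼) :
    (inner ℝ (frame x₀ y v) (frame x₀ y w) : ℝ) = v ⬝ᵥ (gramMat x₀ y).mulVec w := by
  rw [frame_eq_sum, frame_eq_sum, sum_inner]
  simp only [inner_sum, real_inner_smul_left, real_inner_smul_right, dotProduct, Matrix.mulVec,
    gramMat, Matrix.of_apply, Finset.mul_sum]
  refine Finset.sum_congr rfl fun i _ => Finset.sum_congr rfl fun j _ => by ring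

/-- The components of a tangent vector determine its length through the inverse Gram matrix. -/
lemma norm_sq_eq_coord (x₀ : M) {y : 𝔼} (hy : y ∈ (chartAt 𝔼 x₀).target)
    (X : TangentSpace (𝓡 n) ((chartAt 𝔼 x₀).symm y)) :
    ‖X‖ ^ 2 = (fun i => (inner ℝ X (coordVec x₀ y i) : ℝ)) ⬝ᵥ
      (gramMat x₀ y)⁻¹.mulVec (fun i => (inner ℝ X (coordVec x₀ y i) : ℝ)) := by
  obtain ⟨w, rfl⟩ := frame_surjective x₀ hy X
  have hc : (fun i => (inner ℝ (frame x₀ y w) (coordVec x₀ y i) : ℝ))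
      = (gramMat x₀ y).mulVec w := by
    ext i
    rw [real_inner_comm, ← frame_single, inner_frame_frame]
    simp
  rw [hc, Matrix.mulVec_mulVec, Matrix.nonsing_inv_mul _ (gramMat_det_pos x₀ hy).ne'.isUnit,
    Matrix.one_mulVec, ← real_inner_self_eq_norm_sq, inner_frame_frame, dotProduct_comm]

lemma continuousOn_norm_frame (x₀ : M) :
    ContinuousOn (fun p : 𝔼 × 𝔼 => ‖frame x₀ p.1 p.2‖) ((chartAt 𝔼 x₀).target ×ˢ univ) := by
  have h : (fun p : 𝔼 × 𝔼 => ‖frame x₀ p.1 p.2‖) = fun p : 𝔼 × 𝔼 =>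
      Real.sqrt (∑ i, ∑ j, p.2 i * p.2 j * gramMat x₀ p.1 i j) := by
    ext p
    rw [norm_eq_sqrt_real_inner, inner_frame_frame]
    simp only [dotProduct, Matrix.mulVec, Finset.mul_sum]
    congr 1
    refine Finset.sum_congr rfl fun i _ => Finset.sum_congr rfl fun j _ => by ring
  rw [h]
  refine Real.continuous_sqrt.comp_continuousOn ?_
  refine continuousOn_finsetSum _ fun i _ => continuousOn_finsetSum _ fun j _ => ?_
  refine ContinuousOn.mul (Continuous.continuousOn (by fun_prop)) ?_
  exact (continuousOn_inner_frame x₀ _ _).comp continuousOn_fst fun p hp => hp.1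

/-- On compact sets the coordinate frame is uniformly comparable to the Euclidean one. -/
lemma exists_frame_bounds (x₀ : M) {K : Set 𝔼} (hK : IsCompact K)
    (hKt : K ⊆ (chartAt 𝔼 x₀).target) :
    ∃ C : ℝ, 0 < C ∧ ∀ y ∈ K, ∀ v : 𝔼, ‖frame x₀ y v‖ ≤ C * ‖v‖ ∧ ‖v‖ ≤ C * ‖frame x₀ y v‖ := by
  have hcpt : IsCompact (K ×ˢ Metric.sphere (0 : 𝔼) 1) := hK.prod (isCompact_sphere _ _)
  have hcont : ContinuousOn (fun p : 𝔼 × 𝔼 => ‖frame x₀ p.1 p.2‖)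
      (K ×ˢ Metric.sphere (0 : 𝔼) 1) :=
    (continuousOn_norm_frame x₀).mono (prod_mono hKt (subset_univ _))
  obtain ⟨C₁, hC₁⟩ := (hcpt.image_of_continuousOn hcont).bddAbove
  -- The lower bound is a minimum over `K` times the unit sphere, positive because the frame is
  -- injective. The product may be empty, for instance when `n = 0`, and then any constant serves.
  obtain ⟨c, hc, hc'⟩ : ∃ c > 0, ∀ p ∈ K ×ˢ Metric.sphere (0 : 𝔼) 1, c ≤ ‖frame x₀ p.1 p.2‖ := by
    rcases (K ×ˢ Metric.sphere (0 : 𝔼) 1).eq_empty_or_nonempty with h | h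
    · exact ⟨1, one_pos, by simp [h]⟩
    · obtain ⟨p, hp, hmin⟩ := hcpt.exists_isMinOn h hcont
      refine ⟨‖frame x₀ p.1 p.2‖, ?_, fun q hq => hmin hq⟩
      refine norm_pos_iff.2 fun h0 => ?_
      have : p.2 = 0 := frame_injective x₀ (hKt hp.1) (by rw [h0, map_zero])
      have h1 := hp.2
      rw [this] at h1
      simp at h1
  refine ⟨max 1 (max C₁ c⁻¹), by positivity, fun y hy v => ?_⟩
  rcases eq_or_ne v 0 with rfl | hv
  · simp
  have hv' : 0 < ‖v‖ := norm_pos_iff.2 hv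
  have hm : (y, ‖v‖⁻¹ • v) ∈ K ×ˢ Metric.sphere (0 : 𝔼) 1 := by
    refine ⟨hy, ?_⟩
    simp [norm_smul, hv'.ne']
  have e1 : ‖frame x₀ y (‖v‖⁻¹ • v)‖ = ‖v‖⁻¹ * ‖frame x₀ y v‖ := by
    rw [map_smul, norm_smul, norm_inv, norm_norm]
  have h1 : ‖v‖⁻¹ * ‖frame x₀ y v‖ ≤ C₁ := e1 ▸ hC₁ ⟨_, hm, rfl⟩
  have h2 : c ≤ ‖v‖⁻¹ * ‖frame x₀ y v‖ := e1 ▸ hc' _ hm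
  rw [inv_mul_le_iff₀ hv'] at h1
  rw [le_inv_mul_iff₀ hv'] at h2
  constructor
  · calc _ ≤ ‖v‖ * C₁ := h1
      _ = C₁ * ‖v‖ := mul_comm _ _
      _ ≤ _ := by gcongr; exact (le_max_left _ _).trans (le_max_right _ _)
  · calc ‖v‖ = c⁻¹ * (‖v‖ * c) := by field_simp
      _ ≤ c⁻¹ * ‖frame x₀ y v‖ := by gcongr
      _ ≤ _ := by gcongr; exact (le_max_right _ _).trans (le_max_right _ _)

/-- On compact sets the length of a tangent vector is comparable to the size of its components. -/
lemma exists_norm_coord_bounds (x₀ : M) {K : Set 𝔼} (hK : IsCompact K)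
    (hKt : K ⊆ (chartAt 𝔼 x₀).target) :
    ∃ C : ℝ, 0 < C ∧ ∀ y ∈ K, ∀ X : TangentSpace (𝓡 n) ((chartAt 𝔼 x₀).symm y),
      (∀ i, |(inner ℝ X (coordVec x₀ y i) : ℝ)| ≤ C * ‖X‖) ∧
      ‖X‖ ≤ C * ∑ i, |(inner ℝ X (coordVec x₀ y i) : ℝ)| := by
  obtain ⟨C, hC, h⟩ := exists_frame_bounds x₀ hK hKt
  refine ⟨C, hC, fun y hy X => ⟨fun i => ?_, ?_⟩⟩
  · refine (abs_real_inner_le_norm _ _).trans ?_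
    rw [mul_comm]
    gcongr
    have := (h y hy (EuclideanSpace.single i 1)).1
    rw [frame_single] at this
    simpa using this
  · rcases eq_or_ne X 0 with rfl | hX
    · simp
    have hX' : 0 < ‖X‖ := norm_pos_iff.2 hX
    obtain ⟨w, hw⟩ := frame_surjective x₀ (hKt hy) X
    -- Pair `X` with itself and expand only one copy in the frame: the coefficients are at most
    -- `C‖X‖`, and one factor `‖X‖` cancels.
    have h1 : ‖X‖ * ‖X‖ ≤ ‖X‖ * (C * ∑ i, |(inner ℝ X (coordVec x₀ y i) : ℝ)|) := by
      calc ‖X‖ * ‖X‖ = inner ℝ X (frame x₀ y w) := by rw [hw, real_inner_self_eq_norm_mul_norm]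
        _ = ∑ i, w i * (inner ℝ X (coordVec x₀ y i) : ℝ) := by
          rw [frame_eq_sum, inner_sum]
          simp_rw [real_inner_smul_right]
        _ ≤ ∑ i, (C * ‖X‖) * |(inner ℝ X (coordVec x₀ y i) : ℝ)| := by
          refine Finset.sum_le_sum fun i _ => ?_
          refine (le_abs_self _).trans ?_
          rw [abs_mul]
          gcongr
          refine (PiLp.norm_apply_le w i).trans ?_
          rw [← hw]
          exact (h y hy w).2
        _ = _ := by rw [← Finset.mul_sum]; ring
    exact le_of_mul_le_mul_left h1 hX'

/-- Measurability of the components of a vector field gives measurability of its length. -/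
lemma aemeasurable_norm_of_coord (x₀ : M) {s : Set 𝔼} (hs : MeasurableSet s)
    (hst : s ⊆ (chartAt 𝔼 x₀).target) (X : ∀ x : M, TangentSpace (𝓡 n) x)
    (h : ∀ i, AEMeasurable (fun y => (inner ℝ (X ((chartAt 𝔼 x₀).symm y)) (coordVec x₀ y i) : ℝ))
      (volume.restrict s)) :
    AEMeasurable (fun y => ‖X ((chartAt 𝔼 x₀).symm y)‖) (volume.restrict s) := by
  -- The length is a polynomial in the components and the entries of the inverse Gram matrix, under
  -- a square root; these entries are continuous by the adjugate formula.
  have hG : ∀ i j, AEMeasurable (fun y => (gramMat x₀ y)⁻¹ i j) (volume.restrict s) := by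
    intro i j
    refine ContinuousOn.aemeasurable ?_ hs
    have hc : ContinuousOn (fun y => (gramMat x₀ y)⁻¹) s := by
      simp_rw [Matrix.inv_def, Ring.inverse_eq_inv']
      refine ContinuousOn.smul (ContinuousOn.inv₀ ((continuousOn_gramMat_det x₀).mono hst)
        fun y hy => (gramMat_det_pos x₀ (hst hy)).ne') ?_
      exact (Continuous.matrix_adjugate continuous_id).comp_continuousOn
        ((continuousOn_gramMat x₀).mono hst)
    exact continuousOn_pi.1 (continuousOn_pi.1 hc i) j
  have : AEMeasurable (fun y => Real.sqrt (∑ i, (inner ℝ (X ((chartAt 𝔼 x₀).symm y))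
      (coordVec x₀ y i) : ℝ) * ∑ j, (gramMat x₀ y)⁻¹ i j *
        (inner ℝ (X ((chartAt 𝔼 x₀).symm y)) (coordVec x₀ y j) : ℝ))) (volume.restrict s) := by
    refine Real.continuous_sqrt.measurable.comp_aemeasurable ?_
    refine Finset.aemeasurable_fun_sum _ fun i _ => (h i).mul ?_
    exact Finset.aemeasurable_fun_sum _ fun j _ => (hG i j).mul (h j)
  refine this.congr ?_
  filter_upwards [ae_restrict_mem hs] with y hy
  rw [← Real.sqrt_sq (norm_nonneg (X _)), norm_sq_eq_coord x₀ (hst hy)]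
  rfl

end Frame


/-- Charts and their inverses take arbitrary values outside their domains, so preimages are
measurable only after intersection with the domain. -/
lemma _root_.ContinuousOn.measurableSet_inter_preimage {α β : Type*} [TopologicalSpace α]
    [MeasurableSpace α] [OpensMeasurableSpace α] [TopologicalSpace β] [MeasurableSpace β]
    [BorelSpace β] {f : α → β} {s : Set α} (hf : ContinuousOn f s) (hs : MeasurableSet s)
    {A : Set β} (hA : MeasurableSet A) : MeasurableSet (s ∩ f ⁻¹' A) := by
  have h := hs.subtype_image ((continuousOn_iff_continuous_domRestrict.1 hf).measurable hA)
  convert h using 1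
  ext x
  simp [and_comm]

/-! ### The Riemannian measure read in charts -/

section Volume

variable {n : ℕ} {M : Type*} [MetricSpace M] [ChartedSpace (EuclideanSpace ℝ (Fin n)) M]
  [IsManifold (𝓡 n) ∞ M]
  [RiemannianBundle (fun x : M => TangentSpace (𝓡 n) x)]

local notation "𝔼" => EuclideanSpace ℝ (Fin n)

/-- Base points written through two charts agree only propositionally; an equality in the total
space avoids transport between fibres. -/
lemma inner_eq_of_totalSpace_eq {p r : M} {a b : TangentSpace (𝓡 n) p} {c d : TangentSpace (𝓡 n) r}
    (h₁ : (⟨p, a⟩ : TangentBundle (𝓡 n) M) = ⟨r, c⟩) (h₂ : (⟨p, b⟩ : TangentBundle (𝓡 n) M) = ⟨r, d⟩) :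
    (inner ℝ a b : ℝ) = inner ℝ c d := by
  cases h₁
  cases h₂
  rfl

/-- The transition map between two charts. -/
def transition (x₀ x₁ : M) (y : 𝔼) : 𝔼 := chartAt 𝔼 x₁ ((chartAt 𝔼 x₀).symm y)

lemma transition_differentiableAt (x₀ x₁ : M) {y : 𝔼} (hy : y ∈ (chartAt 𝔼 x₀).target)
    (hy' : (chartAt 𝔼 x₀).symm y ∈ (chartAt 𝔼 x₁).source) :
    DifferentiableAt ℝ (transition x₀ x₁) y :=
  ((chart_mdiff x₁ hy').comp y (frame_mdiff x₀ hy)).differentiableAt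

lemma frame_transition (x₀ x₁ : M) {y : 𝔼} (hy : y ∈ (chartAt 𝔼 x₀).target)
    (hy' : (chartAt 𝔼 x₀).symm y ∈ (chartAt 𝔼 x₁).source) (v : 𝔼) :
    (⟨(chartAt 𝔼 x₀).symm y, frame x₀ y v⟩ : TangentBundle (𝓡 n) M) =
      ⟨(chartAt 𝔼 x₁).symm (transition x₀ x₁ y),
        frame x₁ (transition x₀ x₁ y) (fderiv ℝ (transition x₀ x₁) y v)⟩ := by
  have hd := transition_differentiableAt x₀ x₁ hy hy'
  have ht : transition x₀ x₁ y ∈ (chartAt 𝔼 x₁).target := (chartAt 𝔼 x₁).map_source hy'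
  have h1 : (chartAt 𝔼 x₀).symm =ᶠ[𝓝 y] (chartAt 𝔼 x₁).symm ∘ transition x₀ x₁ := by
    have hm : (chartAt 𝔼 x₀).symm ⁻¹' (chartAt 𝔼 x₁).source ∈ 𝓝 y :=
      ((chartAt 𝔼 x₀).continuousAt_symm hy).preimage_mem_nhds
        ((chartAt 𝔼 x₁).open_source.mem_nhds hy')
    filter_upwards [hm] with z hz
    simp [transition, (chartAt 𝔼 x₁).left_inv hz]
  have h2 := tangentMap_comp_at (I := 𝓡 n) (I' := 𝓡 n) (I'' := 𝓡 n)
    (f := transition x₀ x₁) (g := (chartAt 𝔼 x₁).symm)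
    (⟨y, v⟩ : TangentBundle (𝓡 n) 𝔼) (frame_mdiff x₁ ht) hd.mdifferentiableAt
  have h3 : tangentMap (𝓡 n) (𝓡 n) (chartAt 𝔼 x₀).symm (⟨y, v⟩ : TangentBundle (𝓡 n) 𝔼) =
      tangentMap (𝓡 n) (𝓡 n) ((chartAt 𝔼 x₁).symm ∘ transition x₀ x₁)
        (⟨y, v⟩ : TangentBundle (𝓡 n) 𝔼) := by
    simp only [tangentMap]
    rw [h1.mfderiv_eq]
    congr 1
    exact h1.self_of_nhds
  have h4 := h3.trans h2
  simp only [tangentMap, mfderiv_eq_fderiv] at h4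
  exact h4

variable [IsContMDiffRiemannianBundle (𝓡 n) ∞ (EuclideanSpace ℝ (Fin n))
      (fun x : M => TangentSpace (𝓡 n) x)]

/-- With `J` the Jacobian matrix of the transition map, the Gram matrices satisfy `G₀ = Jᵀ G₁ J`;
take determinants. -/
lemma gramMat_transition (x₀ x₁ : M) {y : 𝔼} (hy : y ∈ (chartAt 𝔼 x₀).target)
    (hy' : (chartAt 𝔼 x₀).symm y ∈ (chartAt 𝔼 x₁).source) :
    (gramMat x₀ y).det = (fderiv ℝ (transition x₀ x₁) y).det ^ 2 *
      (gramMat x₁ (transition x₀ x₁ y)).det := by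
  set J := fderiv ℝ (transition x₀ x₁) y
  set b := (EuclideanSpace.basisFun (Fin n) ℝ).toBasis
  set A : Matrix (Fin n) (Fin n) ℝ := LinearMap.toMatrix b b (J : 𝔼 →ₗ[ℝ] 𝔼)
  have hA : ∀ k i, A k i = J (EuclideanSpace.single i 1) k := by
    intro k i
    simp [A, b, LinearMap.toMatrix_apply]
  have hG : gramMat x₀ y = A.transpose * gramMat x₁ (transition x₀ x₁ y) * A := by
    ext i j
    have : gramMat x₀ y i j = inner ℝ (frame x₀ y (EuclideanSpace.single i 1))
      (frame x₀ y (EuclideanSpace.single j 1)) := rfl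
    rw [this, inner_eq_of_totalSpace_eq (frame_transition x₀ x₁ hy hy' _)
      (frame_transition x₀ x₁ hy hy' _), inner_frame_frame, Matrix.mul_assoc, Matrix.mul_apply]
    simp only [dotProduct, Matrix.transpose_apply, Matrix.mulVec, Matrix.mul_apply, hA]
    rfl
  have hdet : A.det = J.det := by
    rw [LinearMap.det_toMatrix]
  rw [hG, Matrix.det_mul, Matrix.det_mul, Matrix.det_transpose, hdet]
  ring

lemma chartDensity_transition (x₀ x₁ : M) {y : 𝔼} (hy : y ∈ (chartAt 𝔼 x₀).target)
    (hy' : (chartAt 𝔼 x₀).symm y ∈ (chartAt 𝔼 x₁).source) :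
    chartDensity x₀ y = ENNReal.ofReal |(fderiv ℝ (transition x₀ x₁) y).det| *
      chartDensity x₁ (transition x₀ x₁ y) := by
  rw [chartDensity_eq, chartDensity_eq, gramMat_transition x₀ x₁ hy hy',
    Real.sqrt_mul (sq_nonneg _), Real.sqrt_sq_eq_abs, ENNReal.ofReal_mul (abs_nonneg _)]

variable [MeasurableSpace M] [BorelSpace M]

lemma aemeasurable_chart_symm (x₀ : M) :
    AEMeasurable (chartAt 𝔼 x₀).symm (volume.restrict (chartAt 𝔼 x₀).target) :=
  (chartAt 𝔼 x₀).continuousOn_symm.aemeasurable (chartAt 𝔼 x₀).open_target.measurableSet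

lemma aemeasurable_chartDensity (x₀ : M) :
    AEMeasurable (chartDensity x₀) (volume.restrict (chartAt 𝔼 x₀).target) :=
  (continuousOn_chartDensity x₀).aemeasurable (chartAt 𝔼 x₀).open_target.measurableSet

lemma aemeasurable_chart_symm_density (x₀ : M) :
    AEMeasurable (chartAt 𝔼 x₀).symm
      ((volume.restrict (chartAt 𝔼 x₀).target).withDensity (chartDensity x₀)) :=
  (aemeasurable_chart_symm x₀).mono_ac (withDensity_absolutelyContinuous _ _)

lemma measurableSet_target_inter_preimage (x₀ : M) {A : Set M} (hA : MeasurableSet A) :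
    MeasurableSet ((chartAt 𝔼 x₀).target ∩ (chartAt 𝔼 x₀).symm ⁻¹' A) :=
  ContinuousOn.measurableSet_inter_preimage (chartAt 𝔼 x₀).continuousOn_symm
    (chartAt 𝔼 x₀).open_target.measurableSet hA

lemma measurableSet_source_inter_preimage (x₀ : M) {A : Set 𝔼} (hA : MeasurableSet A) :
    MeasurableSet ((chartAt 𝔼 x₀).source ∩ chartAt 𝔼 x₀ ⁻¹' A) :=
  ContinuousOn.measurableSet_inter_preimage (chartAt 𝔼 x₀).continuousOn
    (chartAt 𝔼 x₀).open_source.measurableSet hA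

lemma chartVolume_apply (x₀ : M) {A : Set M} (hA : MeasurableSet A) :
    chartVolume (n := n) x₀ A =
      ∫⁻ y in (chartAt 𝔼 x₀).target ∩ (chartAt 𝔼 x₀).symm ⁻¹' A, chartDensity x₀ y := by
  rw [chartVolume, Measure.map_apply_of_aemeasurable (aemeasurable_chart_symm_density x₀) hA,
    withDensity_apply', Measure.restrict_restrict' (chartAt 𝔼 x₀).open_target.measurableSet,
    inter_comm]

/-- The Jacobian in the change of variables along the transition map is exactly the factor by which
the two densities differ. -/
lemma chartVolume_apply_inter (x₀ x₁ : M) {A : Set M} (hA : MeasurableSet A)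
    (h₀ : A ⊆ (chartAt 𝔼 x₀).source) (h₁ : A ⊆ (chartAt 𝔼 x₁).source) :
    chartVolume (n := n) x₀ A = chartVolume (n := n) x₁ A := by
  rw [chartVolume_apply x₀ hA, chartVolume_apply x₁ hA]
  set S := (chartAt 𝔼 x₀).target ∩ (chartAt 𝔼 x₀).symm ⁻¹' A with hS
  have him : (chartAt 𝔼 x₁).target ∩ (chartAt 𝔼 x₁).symm ⁻¹' A = transition x₀ x₁ '' S := by
    ext z
    constructor
    · rintro ⟨hz, hzA⟩
      refine ⟨chartAt 𝔼 x₀ ((chartAt 𝔼 x₁).symm z), ⟨(chartAt 𝔼 x₀).map_source (h₀ hzA), ?_⟩, ?_⟩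
      · simpa [(chartAt 𝔼 x₀).left_inv (h₀ hzA)] using hzA
      · simp [transition, (chartAt 𝔼 x₀).left_inv (h₀ hzA), (chartAt 𝔼 x₁).right_inv hz]
    · rintro ⟨y, ⟨hy, hyA⟩, rfl⟩
      refine ⟨(chartAt 𝔼 x₁).map_source (h₁ hyA), ?_⟩
      simpa [transition, (chartAt 𝔼 x₁).left_inv (h₁ hyA)] using hyA
  have hinj : InjOn (transition x₀ x₁) S := by
    rintro y ⟨hy, hyA⟩ z ⟨hz, hzA⟩ h
    exact (chartAt 𝔼 x₀).symm.injOn hy hz ((chartAt 𝔼 x₁).injOn (h₁ hyA) (h₁ hzA) h)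
  have hSm : MeasurableSet S := measurableSet_target_inter_preimage x₀ hA
  rw [him, lintegral_image_eq_lintegral_abs_det_fderiv_mul volume hSm
    (fun y hy => ((transition_differentiableAt x₀ x₁ hy.1 (h₁ hy.2)).hasFDerivAt.hasFDerivWithinAt))
    hinj]
  exact setLIntegral_congr_fun hSm fun y hy => chartDensity_transition x₀ x₁ hy.1 (h₁ hy.2)

lemma chartVolume_compl_source (x₀ : M) (A : Set M) (hA : MeasurableSet A) :
    chartVolume (n := n) x₀ (A ∩ (chartAt 𝔼 x₀).sourceᶜ) = 0 := by
  rw [chartVolume_apply x₀ (hA.inter (chartAt 𝔼 x₀).open_source.measurableSet.compl)]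
  have : (chartAt 𝔼 x₀).target ∩ (chartAt 𝔼 x₀).symm ⁻¹' (A ∩ (chartAt 𝔼 x₀).sourceᶜ) = ∅ := by
    ext y
    simp only [mem_inter_iff, mem_preimage, mem_compl_iff, mem_empty_iff_false, iff_false, not_and,
      not_not]
    exact fun hy _ => (chartAt 𝔼 x₀).map_target hy
  rw [this]
  simp

/-- The Riemannian measure is the local measure on each chart domain. -/
lemma riemVol_apply_of_subset (x₀ : M) {A : Set M} (hA : MeasurableSet A)
    (h₀ : A ⊆ (chartAt 𝔼 x₀).source) :
    riemVol n M A = chartVolume (n := n) x₀ A := by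
  refine le_antisymm ?_ (Measure.le_iff'.1 (le_iSup (fun x : M => chartVolume (n := n) x) x₀) A)
  set S := (chartAt 𝔼 x₀).source
  have hSm : MeasurableSet S := (chartAt 𝔼 x₀).open_source.measurableSet
  -- A supremum is bounded by any measure that dominates all its members. The competitor is the
  -- local measure of this chart together with the full measure off the chart domain, which does not
  -- see `A`.
  have hle : riemVol n M ≤ chartVolume (n := n) x₀ + (riemVol n M).restrict Sᶜ := by
    refine iSup_le fun x => Measure.le_iff.2 fun B hB => ?_
    rw [← measure_inter_add_sdiff B hSm, Measure.add_apply]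
    refine add_le_add ?_ ?_
    · rw [← measure_inter_add_sdiff (B ∩ S) (chartAt 𝔼 x).open_source.measurableSet, sdiff_eq,
        chartVolume_compl_source x _ (hB.inter hSm), add_zero]
      rw [chartVolume_apply_inter x x₀ ((hB.inter hSm).inter
        (chartAt 𝔼 x).open_source.measurableSet) inter_subset_right
        (inter_subset_left.trans inter_subset_right)]
      exact measure_mono (inter_subset_left.trans inter_subset_left)
    · rw [Measure.restrict_apply hB, ← sdiff_eq]
      exact Measure.le_iff'.1 (le_iSup (fun x : M => chartVolume (n := n) x) x) _
  refine (Measure.le_iff'.1 hle A).trans ?_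
  rw [Measure.add_apply, Measure.restrict_apply hA]
  have : A ∩ Sᶜ = ∅ := by
    rw [← sdiff_eq]; exact sdiff_eq_empty.2 h₀
  simp [this]

lemma riemVol_restrict_source (x₀ : M) :
    (riemVol n M).restrict (chartAt 𝔼 x₀).source = chartVolume (n := n) x₀ := by
  ext A hA
  have hSm : MeasurableSet (chartAt 𝔼 x₀).source := (chartAt 𝔼 x₀).open_source.measurableSet
  rw [Measure.restrict_apply hA, riemVol_apply_of_subset x₀ (hA.inter hSm) inter_subset_right]
  rw [← measure_inter_add_sdiff A hSm, sdiff_eq, chartVolume_compl_source x₀ A hA, add_zero]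

/-- Almost everywhere statements on a chart domain, read in the chart. -/
lemma ae_restrict_source_iff (x₀ : M) {P : M → Prop} :
    (∀ᵐ p ∂(riemVol n M).restrict (chartAt 𝔼 x₀).source, P p) ↔
      ∀ᵐ y ∂(volume.restrict (chartAt 𝔼 x₀).target), P ((chartAt 𝔼 x₀).symm y) := by
  rw [riemVol_restrict_source]
  -- The density is positive on the target, so Lebesgue measure and the weighted measure have the
  -- same null sets there.
  have hac : volume.restrict (chartAt 𝔼 x₀).target ≪
      (volume.restrict (chartAt 𝔼 x₀).target).withDensity (chartDensity x₀) := by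
    refine withDensity_absolutelyContinuous' (aemeasurable_chartDensity x₀) ?_
    filter_upwards [ae_restrict_mem (chartAt 𝔼 x₀).open_target.measurableSet] with y hy
    exact (chartDensity_pos x₀ hy).ne'
  constructor
  · intro h
    exact hac.ae_le (ae_of_ae_map (aemeasurable_chart_symm_density x₀) h)
  · intro h
    have h0 : volume.restrict (chartAt 𝔼 x₀).target {y | ¬ P ((chartAt 𝔼 x₀).symm y)} = 0 := h
    obtain ⟨N, hN, hNm, hN0⟩ := exists_measurable_superset_of_null h0
    have hB := measurableSet_source_inter_preimage x₀ hNm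
    have hBn : chartVolume (n := n) x₀ ((chartAt 𝔼 x₀).source ∩ chartAt 𝔼 x₀ ⁻¹' N) = 0 := by
      rw [chartVolume_apply x₀ hB]
      refine setLIntegral_measure_zero _ _ ?_
      rw [Measure.restrict_apply hNm] at hN0
      refine measure_mono_null ?_ hN0
      rintro y ⟨hy, -, hyN⟩
      rw [mem_preimage, (chartAt 𝔼 x₀).right_inv hy] at hyN
      exact ⟨hyN, hy⟩
    have hc := chartVolume_compl_source (n := n) x₀ univ MeasurableSet.univ
    refine measure_mono_null ?_ (measure_union_null hBn hc)
    intro p hp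
    by_cases hps : p ∈ (chartAt 𝔼 x₀).source
    · refine Or.inl ⟨hps, hN ?_⟩
      change ¬ P _
      rwa [(chartAt 𝔼 x₀).left_inv hps]
    · exact Or.inr ⟨trivial, hps⟩

lemma ae_chart_of_ae {P : M → Prop} (h : ∀ᵐ p ∂riemVol n M, P p) (x₀ : M) :
    ∀ᵐ y ∂(volume.restrict (chartAt 𝔼 x₀).target), P ((chartAt 𝔼 x₀).symm y) :=
  (ae_restrict_source_iff x₀).1 (ae_restrict_of_ae h)

lemma ae_of_ae_chart [SecondCountableTopology M] {P : M → Prop}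
    (h : ∀ x₀ : M, ∀ᵐ y ∂(volume.restrict (chartAt 𝔼 x₀).target), P ((chartAt 𝔼 x₀).symm y)) :
    ∀ᵐ p ∂riemVol n M, P p := by
  obtain ⟨s, hs, hsu⟩ := TopologicalSpace.countable_cover_nhds
    (fun x : M => (chartAt 𝔼 x).open_source.mem_nhds (mem_chart_source 𝔼 x))
  have := (ae_restrict_biUnion_iff (μ := riemVol n M) (fun x : M => (chartAt 𝔼 x).source) hs P).2
    fun x _ => (ae_restrict_source_iff x).2 (h x)
  rwa [hsu, Measure.restrict_univ] at this

/-- Integrals over a chart domain, read in the chart. -/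
lemma setLIntegral_source (x₀ : M) (F : M → ℝ≥0∞)
    (hF : AEMeasurable F (riemVol n M)) {A : Set M} (hA : MeasurableSet A)
    (hAs : A ⊆ (chartAt 𝔼 x₀).source) :
    ∫⁻ p in A, F p ∂riemVol n M =
      ∫⁻ y in (chartAt 𝔼 x₀).target ∩ (chartAt 𝔼 x₀).symm ⁻¹' A,
        chartDensity x₀ y * F ((chartAt 𝔼 x₀).symm y) := by
  have h1 : (riemVol n M).restrict A = (chartVolume (n := n) x₀).restrict A := by
    rw [← riemVol_restrict_source, Measure.restrict_restrict hA, inter_eq_self_of_subset_left hAs]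
  have hF' : AEMeasurable F (chartVolume (n := n) x₀) := by
    rw [← riemVol_restrict_source]; exact hF.restrict
  rw [h1, ← lintegral_indicator hA, chartVolume,
    lintegral_map' (hF'.indicator hA) (aemeasurable_chart_symm_density x₀),
    lintegral_withDensity_eq_lintegral_mul₀ (g := fun y => A.indicator F ((chartAt 𝔼 x₀).symm y))
      (aemeasurable_chartDensity x₀)
      ((hF'.indicator hA).comp_aemeasurable (aemeasurable_chart_symm_density x₀) |>.mono_ac ?_)]
  · rw [← lintegral_indicator (measurableSet_target_inter_preimage x₀ hA),
      ← lintegral_indicator (chartAt 𝔼 x₀).open_target.measurableSet]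
    congr 1
    ext y
    by_cases hy : y ∈ (chartAt 𝔼 x₀).target <;>
      by_cases hyA : (chartAt 𝔼 x₀).symm y ∈ A <;> simp [indicator, hy, hyA]
  · refine withDensity_absolutelyContinuous' (aemeasurable_chartDensity x₀) ?_
    filter_upwards [ae_restrict_mem (chartAt 𝔼 x₀).open_target.measurableSet] with y hy
    exact (chartDensity_pos x₀ hy).ne'

/-- On a compact subset of a chart domain the density is bounded above and below. -/
lemma exists_density_bounds (x₀ : M) {K : Set 𝔼} (hK : IsCompact K)
    (hKt : K ⊆ (chartAt 𝔼 x₀).target) :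
    ∃ C : ℝ≥0, 0 < C ∧ ∀ y ∈ K, chartDensity x₀ y ≤ C ∧ 1 ≤ C * chartDensity x₀ y := by
  rcases K.eq_empty_or_nonempty with rfl | hne
  · exact ⟨1, one_pos, by simp⟩
  have hc : ContinuousOn (fun y => Real.sqrt (gramMat x₀ y).det) K :=
    Real.continuous_sqrt.comp_continuousOn ((continuousOn_gramMat_det x₀).mono hKt)
  obtain ⟨a, ha, hmin⟩ := hK.exists_isMinOn hne hc
  obtain ⟨b, hb, hmax⟩ := hK.exists_isMaxOn hne hc
  have hpos : 0 < Real.sqrt (gramMat x₀ a).det := Real.sqrt_pos.2 (gramMat_det_pos x₀ (hKt ha))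
  set C : ℝ := max (Real.sqrt (gramMat x₀ b).det) (Real.sqrt (gramMat x₀ a).det)⁻¹
  have hC : 0 < C := lt_max_of_lt_right (inv_pos.2 hpos)
  refine ⟨C.toNNReal, Real.toNNReal_pos.2 hC, fun y hy => ?_⟩
  rw [chartDensity_eq]
  change _ ≤ ENNReal.ofReal C ∧ 1 ≤ ENNReal.ofReal C * _
  constructor
  · exact ENNReal.ofReal_le_ofReal ((hmax hy).trans (le_max_left _ _))
  · rw [← ENNReal.ofReal_mul hC.le, ← ENNReal.ofReal_one]
    refine ENNReal.ofReal_le_ofReal ?_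
    calc (1 : ℝ) = (Real.sqrt (gramMat x₀ a).det)⁻¹ * Real.sqrt (gramMat x₀ a).det := by
          rw [inv_mul_cancel₀ hpos.ne']
      _ ≤ _ := mul_le_mul (le_max_right _ _) (hmin hy) hpos.le hC.le

end Volume


/-! ### Mollification in Euclidean space -/

section Mollify

variable {n : ℕ}

local notation "𝔼" => EuclideanSpace ℝ (Fin n)

/-- A sequence of smooth bumps concentrating at the origin. -/
def bumpSeq (n k : ℕ) : ContDiffBump (0 : EuclideanSpace ℝ (Fin n)) where
  rIn := 1 / (k + 1 : ℝ)
  rOut := 2 / (k + 1 : ℝ)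
  rIn_pos := by positivity
  rIn_lt_rOut := by gcongr; norm_num

lemma tendsto_bumpSeq_rOut (n : ℕ) : Tendsto (fun k => (bumpSeq n k).rOut) atTop (𝓝 0) := by
  have := (tendsto_one_div_add_atTop_nhds_zero_nat (𝕜 := ℝ)).const_mul 2
  simpa [bumpSeq, div_eq_mul_inv] using this

/-- The mollification of a function at scale `2 / (k + 1)`. -/
def mollify (k : ℕ) (u : 𝔼 → ℝ) : 𝔼 → ℝ :=
  convolution ((bumpSeq n k).normed volume) u (ContinuousLinearMap.lsmul ℝ ℝ) volume

lemma mollify_apply (k : ℕ) (u : 𝔼 → ℝ) (x : 𝔼) :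
    mollify k u x = ∫ t, (bumpSeq n k).normed volume t * u (x - t) := rfl

lemma mollify_contDiff (k : ℕ) {u : 𝔼 → ℝ} (hu : LocallyIntegrable u volume) :
    ContDiff ℝ ∞ (mollify k u) :=
  (bumpSeq n k).hasCompactSupport_normed.contDiff_convolution_left _
    (bumpSeq n k).contDiff_normed hu

lemma mollify_tsupport_subset (k : ℕ) {u : 𝔼 → ℝ} {S : Set 𝔼}
    (hu : tsupport u ⊆ S) :
    tsupport (mollify k u) ⊆ Metric.cthickening (bumpSeq n k).rOut S := by
  refine closure_minimal ?_ Metric.isClosed_cthickening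
  refine (support_convolution_subset _).trans ?_
  rw [ContDiffBump.support_normed_eq]
  rintro x ⟨t, ht, y, hy, rfl⟩
  refine Metric.mem_cthickening_of_dist_le (t + y) y _ _ (hu (subset_tsupport _ hy)) ?_
  simpa [dist_eq_norm] using (mem_ball_zero_iff.1 ht).le

/-- The outer radius of each bump is twice its inner radius. This bounded ratio is what Lebesgue
differentiation needs, whence the factor 2. -/
lemma mollify_ae_tendsto {u : 𝔼 → ℝ} (hu : LocallyIntegrable u volume) :
    ∀ᵐ x, Tendsto (fun k => mollify k u x) atTop (𝓝 (u x)) := by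
  refine ContDiffBump.ae_convolution_tendsto_right_of_locallyIntegrable (K := 2)
    (tendsto_bumpSeq_rOut n) (Eventually.of_forall fun k => ?_) hu
  simp only [bumpSeq]
  rw [mul_one_div]

lemma lintegral_bumpSeq (k : ℕ) :
    ∫⁻ t, ENNReal.ofReal ((bumpSeq n k).normed volume t) = 1 := by
  rw [← ofReal_integral_eq_lintegral_ofReal (bumpSeq n k).integrable_normed
    (Eventually.of_forall (bumpSeq n k).nonneg_normed), (bumpSeq n k).integral_normed]
  simp

/-- Mollification does not increase the `L^q` norm. -/
lemma eLpNorm_mollify_le (k : ℕ) {u : 𝔼 → ℝ} (hu : AEStronglyMeasurable u volume) {q : ℝ}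
    (hq : 1 ≤ q) :
    eLpNorm (mollify k u) (ENNReal.ofReal q) volume ≤ eLpNorm u (ENNReal.ofReal q) volume := by
  have hq0 : 0 < q := by linarith
  wlog hum : Measurable u generalizing u
  · have h1 := this hu.stronglyMeasurable_mk.aestronglyMeasurable hu.stronglyMeasurable_mk.measurable
    have h2 : mollify k u = mollify k (hu.mk u) := by
      ext x
      rw [mollify_apply, mollify_apply]
      refine integral_congr_ae ?_
      have : ∀ᵐ t, u (x - t) = hu.mk u (x - t) :=
        (quasiMeasurePreserving_sub_left volume x).ae hu.ae_eq_mk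
      filter_upwards [this] with t ht
      rw [ht]
    rw [h2]
    exact h1.trans_eq (eLpNorm_congr_ae hu.ae_eq_mk.symm)
  set ρ : 𝔼 → ℝ≥0∞ := fun t => ENNReal.ofReal ((bumpSeq n k).normed volume t) with hρ
  have hρm : Measurable ρ := (bumpSeq n k).continuous_normed.measurable.ennreal_ofReal
  -- Mollification averages against a probability measure, so Jensen's inequality gives the
  -- pointwise bound; Fubini and translation invariance finish.
  have hprob : IsProbabilityMeasure (volume.withDensity ρ) :=
    ⟨by rw [withDensity_apply _ MeasurableSet.univ, setLIntegral_univ, lintegral_bumpSeq]⟩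
  have key : ∀ x, ‖mollify k u x‖ₑ ^ q ≤ ∫⁻ t, ρ t * ‖u (x - t)‖ₑ ^ q := by
    intro x
    have h1 : ‖mollify k u x‖ₑ ≤ ∫⁻ t, ρ t * ‖u (x - t)‖ₑ := by
      rw [mollify_apply]
      refine (enorm_integral_le_lintegral_enorm _).trans_eq (lintegral_congr fun t => ?_)
      rw [enorm_mul, hρ, Real.enorm_of_nonneg ((bumpSeq n k).nonneg_normed t)]
    have hm : Measurable fun t => ‖u (x - t)‖ₑ :=
      (hum.comp (measurable_const.sub measurable_id)).enorm
    have h2 := eLpNorm'_le_eLpNorm'_of_exponent_le one_pos hq (volume.withDensity ρ)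
      (f := fun t => u (x - t)) (hum.comp (measurable_const.sub measurable_id)).aestronglyMeasurable
    simp only [eLpNorm', ENNReal.rpow_one, one_div, inv_one] at h2
    rw [lintegral_withDensity_eq_lintegral_mul _ hρm hm,
      lintegral_withDensity_eq_lintegral_mul _ hρm (hm.pow_const q)] at h2
    calc ‖mollify k u x‖ₑ ^ q ≤ ((∫⁻ t, ρ t * ‖u (x - t)‖ₑ ^ q) ^ q⁻¹) ^ q := by
          gcongr
          exact h1.trans h2
      _ = _ := by rw [← ENNReal.rpow_mul, inv_mul_cancel₀ hq0.ne', ENNReal.rpow_one]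
  have hq0' : ENNReal.ofReal q ≠ 0 := by simpa using hq0
  rw [eLpNorm_eq_lintegral_rpow_enorm_toReal hq0' ENNReal.ofReal_ne_top,
    eLpNorm_eq_lintegral_rpow_enorm_toReal hq0' ENNReal.ofReal_ne_top,
    ENNReal.toReal_ofReal hq0.le]
  refine ENNReal.rpow_le_rpow ?_ (by positivity)
  calc ∫⁻ x, ‖mollify k u x‖ₑ ^ q ≤ ∫⁻ x, ∫⁻ t, ρ t * ‖u (x - t)‖ₑ ^ q := lintegral_mono key
    _ = ∫⁻ t, ∫⁻ x, ρ t * ‖u (x - t)‖ₑ ^ q := by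
      refine lintegral_lintegral_swap ?_
      have hm : Measurable fun p : 𝔼 × 𝔼 => u (p.1 - p.2) :=
        hum.comp (measurable_fst.sub measurable_snd)
      exact ((hρm.comp measurable_snd).mul (hm.enorm.pow_const q)).aemeasurable
    _ = ∫⁻ t, ρ t * ∫⁻ x, ‖u x‖ₑ ^ q := by
      refine lintegral_congr fun t => ?_
      have hm : Measurable fun x => ‖u (x - t)‖ₑ ^ q :=
        (hum.comp (measurable_id.sub_const t)).enorm.pow_const q
      rw [lintegral_const_mul _ hm]
      congr 1
      exact lintegral_sub_right_eq_self (fun x => ‖u x‖ₑ ^ q) t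
    _ = ∫⁻ x, ‖u x‖ₑ ^ q := by
      rw [lintegral_mul_const _ hρm, lintegral_bumpSeq, one_mul]

lemma mollify_sub (k : ℕ) {u v : 𝔼 → ℝ} (hu : LocallyIntegrable u volume)
    (hv : LocallyIntegrable v volume) :
    mollify k (fun x => u x - v x) = fun x => mollify k u x - mollify k v x := by
  have h : ∀ w : 𝔼 → ℝ, LocallyIntegrable w volume → ∀ x,
      Integrable (fun t => (bumpSeq n k).normed volume t * w (x - t)) := fun w hw x =>
    ((bumpSeq n k).hasCompactSupport_normed.convolutionExists_left
      (ContinuousLinearMap.lsmul ℝ ℝ) (bumpSeq n k).continuous_normed hw) x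
  ext x
  rw [mollify_apply, mollify_apply, mollify_apply, ← integral_sub (h u hu x) (h v hv x)]
  refine integral_congr_ae (Eventually.of_forall fun t => ?_)
  simp only
  ring

/-- Mollifications converge in `L^q`. -/
lemma mollify_tendsto_eLpNorm {u : 𝔼 → ℝ} {q : ℝ} (hq : 1 ≤ q)
    (hu : MemLp u (ENNReal.ofReal q) volume) :
    Tendsto (fun k => eLpNorm (fun x => mollify k u x - u x) (ENNReal.ofReal q) volume)
      atTop (𝓝 0) := by
  have hq1 : 1 ≤ ENNReal.ofReal q := by simpa using ENNReal.ofReal_le_ofReal hq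
  rw [ENNReal.tendsto_nhds_zero]
  intro ε hε
  rcases eq_or_ne ε ⊤ with rfl | hεt
  · simp
  -- A three-term estimate through a continuous `g` with compact support: the error for `u - g` is
  -- controlled by contractivity, that for `g` by uniform continuity on a fixed compact set. Any
  -- thickening radius would do; 2 works once the bumps have radius below 2.
  obtain ⟨g, hgc, hgε, hgcont, hgm⟩ := hu.exists_hasCompactSupport_eLpNorm_sub_le
    ENNReal.ofReal_ne_top (ENNReal.div_pos hε.ne' (by simp : (3 : ℝ≥0∞) ≠ ⊤)).ne'
  set S := Metric.cthickening 2 (tsupport g)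
  have hS : IsCompact S := hgc.isCompact.cthickening
  set V : ℝ≥0∞ := volume S ^ (1 / (ENNReal.ofReal q).toReal)
  have hV : V ≠ ⊤ := ENNReal.rpow_ne_top_of_nonneg (by positivity) hS.measure_lt_top.ne
  obtain ⟨δ, hδ, hδV⟩ : ∃ δ : ℝ, 0 < δ ∧ ENNReal.ofReal δ * V ≤ ε / 3 := by
    have ht : Tendsto (fun δ : ℝ => ENNReal.ofReal δ * V) (𝓝[>] 0) (𝓝 0) := by
      have h1 : Tendsto (fun δ : ℝ => ENNReal.ofReal δ * V) (𝓝 0) (𝓝 (ENNReal.ofReal 0 * V)) :=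
        ENNReal.Tendsto.mul_const (ENNReal.continuous_ofReal.tendsto 0) (Or.inr hV)
      simp only [ENNReal.ofReal_zero, zero_mul] at h1
      exact h1.mono_left nhdsWithin_le_nhds
    have h2 := (ENNReal.tendsto_nhds_zero.1 ht) (ε / 3) (ENNReal.div_pos hε.ne' (by simp))
    obtain ⟨δ, h3, h4⟩ := (h2.and self_mem_nhdsWithin).exists
    exact ⟨δ, h4, h3⟩
  have hunif := hgc.uniformContinuous_of_continuous hgcont
  obtain ⟨r, hr, hrδ⟩ := Metric.uniformContinuous_iff.1 hunif δ hδ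
  have huli : LocallyIntegrable u volume := hu.locallyIntegrable hq1
  have hgli : LocallyIntegrable g volume := hgcont.locallyIntegrable
  filter_upwards [(tendsto_bumpSeq_rOut n).eventually_lt_const hr,
    (tendsto_bumpSeq_rOut n).eventually_lt_const (zero_lt_two)] with k hk hk2
  have hmg : eLpNorm (fun x => mollify k g x - g x) (ENNReal.ofReal q) volume ≤ ε / 3 := by
    have hsupp : ∀ x ∉ S, mollify k g x - g x = 0 := by
      intro x hx
      have h1 : mollify k g x = 0 := by
        refine image_eq_zero_of_notMem_tsupport fun h => hx ?_
        exact Metric.cthickening_mono hk2.le _ (mollify_tsupport_subset k subset_rfl h)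
      have h2 : g x = 0 := by
        refine image_eq_zero_of_notMem_tsupport fun h => hx ?_
        exact Metric.self_subset_cthickening _ h
      rw [h1, h2, sub_zero]
    rw [← eLpNorm_restrict_eq_of_support_subset (s := S)
      (Function.support_subset_iff'.2 hsupp)]
    refine (eLpNorm_le_of_ae_bound (C := δ) (Eventually.of_forall fun x => ?_)).trans ?_
    · have := (bumpSeq n k).dist_normed_convolution_le (μ := volume) (x₀ := x) (ε := δ)
        hgcont.aestronglyMeasurable (fun y hy => (hrδ ((Metric.mem_ball.1 hy).trans hk)).le)
      rw [dist_eq_norm] at this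
      exact this
    · rw [Measure.restrict_apply_univ, mul_comm]
      simpa [V, one_div] using hδV
  have e : (fun x => mollify k u x - u x) = (fun x => mollify k (fun y => u y - g y) x) +
      ((fun x => mollify k g x - g x) + fun x => -(u x - g x)) := by
    ext x
    rw [mollify_sub k huli hgli]
    simp only [Pi.add_apply]
    ring
  have hugm : AEStronglyMeasurable (fun y => u y - g y) volume :=
    hu.1.sub hgcont.aestronglyMeasurable
  rw [e]
  have m1 : AEStronglyMeasurable (fun x => mollify k (fun y => u y - g y) x) volume :=
    (mollify_contDiff k (huli.sub hgli)).continuous.aestronglyMeasurable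
  have m2 : AEStronglyMeasurable (fun x => mollify k g x - g x) volume :=
    ((mollify_contDiff k hgli).continuous.sub hgcont).aestronglyMeasurable
  refine (eLpNorm_add_le m1 (m2.add hugm.neg) hq1).trans ?_
  refine (add_le_add_right (eLpNorm_add_le m2 hugm.neg hq1) _).trans ?_
  have h3 : eLpNorm (fun x => -(u x - g x)) (ENNReal.ofReal q) volume ≤ ε / 3 := by
    have := eLpNorm_neg (fun x => u x - g x) (ENNReal.ofReal q) (volume : Measure 𝔼)
    refine (this.trans_le ?_)
    exact hgε
  calc _ ≤ ε / 3 + (ε / 3 + ε / 3) := by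
        gcongr
        · exact (eLpNorm_mollify_le k hugm hq).trans hgε
        · exact h3
    _ = ε := by rw [← add_assoc, ENNReal.add_thirds]

end Mollify


/-! ### Weak derivatives on open subsets of Euclidean space -/

section WeakDeriv

variable {n : ℕ}

local notation "𝔼" => EuclideanSpace ℝ (Fin n)

/-- `v` is the distributional derivative of `u` on `U` in the direction `e`. -/
structure HasWeakDeriv (U : Set 𝔼) (u v : 𝔼 → ℝ) (e : 𝔼) : Prop where
  locInt : LocallyIntegrableOn u U volume
  locInt_deriv : LocallyIntegrableOn v U volume
  integral_eq : ∀ ψ : 𝔼 → ℝ, ContDiff ℝ ∞ ψ → HasCompactSupport ψ → tsupport ψ ⊆ U →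
    ∫ y, u y * fderiv ℝ ψ y e = -∫ y, v y * ψ y

lemma locallyIntegrableOn_iff_compact {U : Set 𝔼} (hU : IsOpen U) {w : 𝔼 → ℝ} :
    LocallyIntegrableOn w U volume ↔ ∀ K, K ⊆ U → IsCompact K → IntegrableOn w K volume :=
  locallyIntegrableOn_iff hU.isLocallyClosed

lemma integrable_mul_of_tsupport_subset {U : Set 𝔼} {w φ : 𝔼 → ℝ}
    (hw : LocallyIntegrableOn w U volume) (hφ : Continuous φ) (hφc : HasCompactSupport φ)
    (hφU : tsupport φ ⊆ U) : Integrable (fun y => w y * φ y) volume := by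
  have h1 : IntegrableOn (fun y => w y * φ y) (tsupport φ) volume :=
    (hw.integrableOn_compact_subset hφU hφc).mul_continuousOn hφ.continuousOn hφc
  refine (integrableOn_iff_integrable_of_support_subset ?_).1 h1
  refine Function.support_subset_iff'.2 fun x hx => ?_
  rw [image_eq_zero_of_notMem_tsupport hx, mul_zero]

lemma continuous_fderiv_apply {ψ : 𝔼 → ℝ} (hψ : ContDiff ℝ ∞ ψ) (e : 𝔼) :
    Continuous fun y => fderiv ℝ ψ y e :=
  (hψ.continuous_fderiv (by simp)).clm_apply continuous_const

lemma tsupport_fderiv_apply_subset' (ψ : 𝔼 → ℝ) (e : 𝔼) :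
    tsupport (fun y => fderiv ℝ ψ y e) ⊆ tsupport ψ := by
  refine closure_minimal (fun x hx => ?_) (isClosed_tsupport ψ)
  by_contra h
  exact hx (by simp [image_eq_zero_of_notMem_tsupport fun h' => h (tsupport_fderiv_subset ℝ h')])

lemma hasCompactSupport_fderiv_apply {ψ : 𝔼 → ℝ} (hψ : HasCompactSupport ψ) (e : 𝔼) :
    HasCompactSupport fun y => fderiv ℝ ψ y e :=
  hψ.mono' ((subset_tsupport _).trans (tsupport_fderiv_apply_subset' ψ e))

namespace HasWeakDeriv

variable {U : Set (EuclideanSpace ℝ (Fin n))} {u v u' v' : EuclideanSpace ℝ (Fin n) → ℝ}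
  {e : EuclideanSpace ℝ (Fin n)}

lemma integrable_left (h : HasWeakDeriv U u v e) {ψ : 𝔼 → ℝ} (hψ : ContDiff ℝ ∞ ψ)
    (hc : HasCompactSupport ψ) (hs : tsupport ψ ⊆ U) :
    Integrable (fun y => u y * fderiv ℝ ψ y e) volume :=
  integrable_mul_of_tsupport_subset h.locInt (continuous_fderiv_apply hψ e)
    (hasCompactSupport_fderiv_apply hc e) ((tsupport_fderiv_apply_subset' ψ e).trans hs)

lemma integrable_right (h : HasWeakDeriv U u v e) {ψ : 𝔼 → ℝ} (hψ : ContDiff ℝ ∞ ψ)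
    (hc : HasCompactSupport ψ) (hs : tsupport ψ ⊆ U) :
    Integrable (fun y => v y * ψ y) volume :=
  integrable_mul_of_tsupport_subset h.locInt_deriv hψ.continuous hc hs

lemma add (h : HasWeakDeriv U u v e) (h' : HasWeakDeriv U u' v' e) :
    HasWeakDeriv U (fun x => u x + u' x) (fun x => v x + v' x) e where
  locInt := h.locInt.add h'.locInt
  locInt_deriv := h.locInt_deriv.add h'.locInt_deriv
  integral_eq ψ hψ hc hs := by
    simp_rw [add_mul]
    rw [integral_add (h.integrable_left hψ hc hs) (h'.integrable_left hψ hc hs),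
      integral_add (h.integrable_right hψ hc hs) (h'.integrable_right hψ hc hs),
      h.integral_eq ψ hψ hc hs, h'.integral_eq ψ hψ hc hs]
    ring

lemma const_mul (h : HasWeakDeriv U u v e) (c : ℝ) :
    HasWeakDeriv U (fun x => c * u x) (fun x => c * v x) e where
  locInt := h.locInt.smul c
  locInt_deriv := h.locInt_deriv.smul c
  integral_eq ψ hψ hc hs := by
    simp_rw [mul_assoc]
    rw [integral_const_mul, integral_const_mul, h.integral_eq ψ hψ hc hs]
    ring

lemma sub (h : HasWeakDeriv U u v e) (h' : HasWeakDeriv U u' v' e) :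
    HasWeakDeriv U (fun x => u x - u' x) (fun x => v x - v' x) e := by
  have := h.add (h'.const_mul (-1))
  simpa [sub_eq_add_neg] using this

lemma ae_unique (hU : IsOpen U) (h : HasWeakDeriv U u v e) (h' : HasWeakDeriv U u v' e) :
    ∀ᵐ x, x ∈ U → v x = v' x := by
  have := hU.ae_eq_zero_of_integral_contDiff_smul_eq_zero (μ := volume) (f := fun x => v x - v' x)
    (h.locInt_deriv.sub h'.locInt_deriv) fun g hg hgc hgs => by
      have e1 := h.integral_eq g hg hgc hgs
      rw [h'.integral_eq g hg hgc hgs] at e1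
      simp_rw [smul_eq_mul, mul_sub, mul_comm (g _)]
      rw [integral_sub (h.integrable_right hg hgc hgs) (h'.integrable_right hg hgc hgs)]
      linarith
  filter_upwards [this] with x hx hxU
  linarith [hx hxU]

/-- Weak differentiability is tested on compact sets. -/
lemma of_compact (hU : IsOpen U)
    (H : ∀ K, IsCompact K → K ⊆ U → ∃ u' v', HasWeakDeriv U u' v' e ∧
      ∀ᵐ x, x ∈ K → u' x = u x ∧ v' x = v x) : HasWeakDeriv U u v e where
  locInt := by
    refine (locallyIntegrableOn_iff_compact hU).2 fun K hKU hK => ?_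
    obtain ⟨u', v', h, hae⟩ := H K hK hKU
    refine (h.locInt.integrableOn_compact_subset hKU hK).congr_fun_ae ?_
    filter_upwards [ae_restrict_mem hK.measurableSet, ae_restrict_of_ae hae] with x hx hx'
    exact (hx' hx).1
  locInt_deriv := by
    refine (locallyIntegrableOn_iff_compact hU).2 fun K hKU hK => ?_
    obtain ⟨u', v', h, hae⟩ := H K hK hKU
    refine (h.locInt_deriv.integrableOn_compact_subset hKU hK).congr_fun_ae ?_
    filter_upwards [ae_restrict_mem hK.measurableSet, ae_restrict_of_ae hae] with x hx hx'
    exact (hx' hx).2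
  integral_eq ψ hψ hc hs := by
    obtain ⟨u', v', h, hae⟩ := H _ hc hs
    have e1 : ∫ y, u y * fderiv ℝ ψ y e = ∫ y, u' y * fderiv ℝ ψ y e := by
      refine integral_congr_ae ?_
      filter_upwards [hae] with x hx
      by_cases hxs : x ∈ tsupport ψ
      · rw [(hx hxs).1]
      · rw [image_eq_zero_of_notMem_tsupport (f := fun y => fderiv ℝ ψ y e)
          fun h' => hxs (tsupport_fderiv_apply_subset' ψ e h'), mul_zero, mul_zero]
    have e2 : ∫ y, v y * ψ y = ∫ y, v' y * ψ y := by
      refine integral_congr_ae ?_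
      filter_upwards [hae] with x hx
      by_cases hxs : x ∈ tsupport ψ
      · rw [(hx hxs).2]
      · rw [image_eq_zero_of_notMem_tsupport hxs, mul_zero, mul_zero]
    rw [e1, e2, h.integral_eq ψ hψ hc hs]

lemma congr (hU : IsOpen U) (h : HasWeakDeriv U u v e) (hae : ∀ᵐ x, x ∈ U → u' x = u x ∧ v' x = v x) :
    HasWeakDeriv U u' v' e :=
  of_compact hU fun K _ hKU => ⟨u, v, h, by
    filter_upwards [hae] with x hx hxK
    exact ⟨(hx (hKU hxK)).1.symm, (hx (hKU hxK)).2.symm⟩⟩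

lemma mono {V : Set 𝔼} (h : HasWeakDeriv U u v e) (hVU : V ⊆ U) : HasWeakDeriv V u v e :=
  ⟨h.locInt.mono_set hVU, h.locInt_deriv.mono_set hVU,
    fun ψ hψ hc hs => h.integral_eq ψ hψ hc (hs.trans hVU)⟩

/-- Leibniz rule for multiplication with a smooth function, which may also extend the domain. -/
lemma smooth_mul (h : HasWeakDeriv U u v e) {W : Set 𝔼} (hW : IsOpen W) {χ : 𝔼 → ℝ}
    (hχ : ContDiff ℝ ∞ χ) (hWχ : W ∩ tsupport χ ⊆ U) :
    HasWeakDeriv W (fun x => χ x * u x) (fun x => χ x * v x + fderiv ℝ χ x e * u x) e := by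
  have key : ∀ (φ w : 𝔼 → ℝ), Continuous φ → tsupport φ ⊆ tsupport χ →
      LocallyIntegrableOn w U volume → LocallyIntegrableOn (fun x => φ x * w x) W volume := by
    intro φ w hφ hφs hw
    refine (locallyIntegrableOn_iff_compact hW).2 fun K hKW hK => ?_
    have hK' : IsCompact (K ∩ tsupport χ) := hK.inter_right (isClosed_tsupport χ)
    have h1 : IntegrableOn (fun x => φ x * w x) (K ∩ tsupport χ) volume :=
      (hw.integrableOn_compact_subset ((inter_subset_inter_left _ hKW).trans hWχ)
        hK').continuousOn_mul hφ.continuousOn hK'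
    refine h1.of_forall_sdiff_eq_zero hK.measurableSet fun x hx => ?_
    rw [image_eq_zero_of_notMem_tsupport fun h' => hx.2 ⟨hx.1, hφs h'⟩, zero_mul]
  have hχ' := continuous_fderiv_apply hχ e
  refine ⟨key χ u hχ.continuous subset_rfl h.locInt,
    (key χ v hχ.continuous subset_rfl h.locInt_deriv).add
      (key _ u hχ' (tsupport_fderiv_apply_subset' χ e) h.locInt), fun ψ hψ hc hs => ?_⟩
  -- The product `χψ` is an admissible test function on `U` although `ψ` is supported only in `W`;
  -- this is how the domain may grow.
  have hs1 : tsupport (fun x => χ x * ψ x) ⊆ U := fun x hx =>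
    hWχ ⟨hs ((closure_mono (Function.support_mul_subset_right χ ψ)) hx),
      (closure_mono (Function.support_mul_subset_left χ ψ)) hx⟩
  have hc1 : HasCompactSupport fun x => χ x * ψ x := hc.mul_left
  have e1 := h.integral_eq _ (hχ.mul hψ) hc1 hs1
  have hd : ∀ y, fderiv ℝ (fun x => χ x * ψ x) y e =
      χ y * fderiv ℝ ψ y e + fderiv ℝ χ y e * ψ y := by
    intro y
    rw [fderiv_fun_mul (hχ.differentiable (by simp) y) (hψ.differentiable (by simp) y)]
    simp
    ring
  have i1 : Integrable (fun y => u y * (χ y * fderiv ℝ ψ y e)) volume := by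
    refine integrable_mul_of_tsupport_subset h.locInt
      (hχ.continuous.mul (continuous_fderiv_apply hψ e))
      (hasCompactSupport_fderiv_apply hc e).mul_left fun x hx => ?_
    refine hWχ ⟨hs (tsupport_fderiv_apply_subset' ψ e
      ((closure_mono (Function.support_mul_subset_right _ _)) hx)),
      (closure_mono (Function.support_mul_subset_left _ _)) hx⟩
  have i2 : Integrable (fun y => u y * (fderiv ℝ χ y e * ψ y)) volume := by
    refine integrable_mul_of_tsupport_subset h.locInt (hχ'.mul hψ.continuous) hc.mul_left
      fun x hx => ?_
    refine hWχ ⟨hs ((closure_mono (Function.support_mul_subset_right _ _)) hx),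
      tsupport_fderiv_apply_subset' χ e ((closure_mono (Function.support_mul_subset_left _ _)) hx)⟩
  have i3 := h.integrable_right (hχ.mul hψ) hc1 hs1
  simp_rw [hd, mul_add] at e1
  rw [integral_add i1 i2] at e1
  have e2 : ∫ y, χ y * u y * fderiv ℝ ψ y e = ∫ y, u y * (χ y * fderiv ℝ ψ y e) :=
    integral_congr_ae (Eventually.of_forall fun y => by simp only; ring)
  have e3 : ∫ y, (χ y * v y + fderiv ℝ χ y e * u y) * ψ y =
      (∫ y, v y * (χ y * ψ y)) + ∫ y, u y * (fderiv ℝ χ y e * ψ y) := by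
    rw [← integral_add i3 i2]
    exact integral_congr_ae (Eventually.of_forall fun y => by simp only; ring)
  rw [e2, e3]
  linarith

/-- Stability of weak derivatives under local `L¹` convergence. -/
lemma of_tendsto (hu : LocallyIntegrableOn u U volume)
    (hv : LocallyIntegrableOn v U volume) {us vs : ℕ → 𝔼 → ℝ}
    (h : ∀ k, HasWeakDeriv U (us k) (vs k) e)
    (hus : ∀ K, IsCompact K → K ⊆ U →
      Tendsto (fun k => ∫⁻ x in K, ‖us k x - u x‖ₑ) atTop (𝓝 0))
    (hvs : ∀ K, IsCompact K → K ⊆ U →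
      Tendsto (fun k => ∫⁻ x in K, ‖vs k x - v x‖ₑ) atTop (𝓝 0)) :
    HasWeakDeriv U u v e := by
  refine ⟨hu, hv, fun ψ hψ hc hs => ?_⟩
  have key : ∀ (φ w : 𝔼 → ℝ) (ws : ℕ → 𝔼 → ℝ), Continuous φ → HasCompactSupport φ →
      tsupport φ ⊆ U → LocallyIntegrableOn w U volume →
      (∀ k, LocallyIntegrableOn (ws k) U volume) →
      (∀ K, IsCompact K → K ⊆ U →
        Tendsto (fun k => ∫⁻ x in K, ‖ws k x - w x‖ₑ) atTop (𝓝 0)) →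
      Tendsto (fun k => ∫ y, ws k y * φ y) atTop (𝓝 (∫ y, w y * φ y)) := by
    intro φ w ws hφ hφc hφU hw hws hlim
    refine tendsto_integral_of_L1 _ (integrable_mul_of_tsupport_subset hw hφ hφc hφU).1
      (Eventually.of_forall fun k => integrable_mul_of_tsupport_subset (hws k) hφ hφc hφU) ?_
    obtain ⟨C, hC⟩ := hφc.exists_bound_of_continuous hφ
    have hb : ∀ k, ∫⁻ y, ‖ws k y * φ y - w y * φ y‖ₑ ≤
        ENNReal.ofReal C * ∫⁻ y in tsupport φ, ‖ws k y - w y‖ₑ := by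
      intro k
      rw [← lintegral_const_mul' _ _ ENNReal.ofReal_ne_top,
        ← lintegral_indicator (isClosed_tsupport φ).measurableSet]
      refine lintegral_mono fun y => ?_
      by_cases hy : y ∈ tsupport φ
      · rw [indicator_of_mem hy, ← sub_mul, enorm_mul, mul_comm]
        gcongr
        rw [← ofReal_norm]
        exact ENNReal.ofReal_le_ofReal (hC y)
      · simp [image_eq_zero_of_notMem_tsupport hy]
    refine tendsto_of_tendsto_of_tendsto_of_le_of_le tendsto_const_nhds ?_
      (fun _ => zero_le) hb
    have := ENNReal.Tendsto.const_mul (a := ENNReal.ofReal C) (hlim _ hφc hφU)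
      (Or.inr ENNReal.ofReal_ne_top)
    simpa using this
  have t1 := key _ u us (continuous_fderiv_apply hψ e) (hasCompactSupport_fderiv_apply hc e)
    ((tsupport_fderiv_apply_subset' ψ e).trans hs) hu (fun k => (h k).locInt) hus
  have t2 := key _ v vs hψ.continuous hc hs hv (fun k => (h k).locInt_deriv) hvs
  refine tendsto_nhds_unique t1 (t2.neg.congr fun k => ?_)
  exact ((h k).integral_eq ψ hψ hc hs).symm

end HasWeakDeriv

/-- Equality to 1 on a neighbourhood of `K`, not just on `K`, makes the derivative of the cutoff
vanish on `K`, so that multiplication leaves weak derivatives unchanged there. -/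
lemma exists_smooth_cutoff {K U : Set 𝔼} (hK : IsCompact K) (hU : IsOpen U) (hKU : K ⊆ U) :
    ∃ χ : 𝔼 → ℝ, ContDiff ℝ ∞ χ ∧ HasCompactSupport χ ∧ tsupport χ ⊆ U ∧
      (∀ x, χ x ∈ Icc (0 : ℝ) 1) ∧ ∃ V, IsOpen V ∧ K ⊆ V ∧ ∀ x ∈ V, χ x = 1 := by
  obtain ⟨L, hL, hKL, hLU⟩ := exists_compact_between hK hU hKU
  obtain ⟨L', hL', hLL', hLU'⟩ := exists_compact_between hL hU hLU
  obtain ⟨χ, hχ, hr, h0, h1⟩ := exists_contMDiff_zero_iff_one_iff_of_isClosed (n := ⊤)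
    𝓘(ℝ, 𝔼) (s := (interior L')ᶜ) (t := L) isOpen_interior.isClosed_compl hL.isClosed
    (disjoint_compl_left_iff_subset.2 hLL')
  have hsupp : tsupport χ ⊆ L' := by
    refine closure_minimal (fun x hx => ?_) hL'.isClosed
    by_contra h
    exact hx ((h0 x).1 fun h' => h (interior_subset h'))
  exact ⟨χ, hχ.contDiff, hL'.of_isClosed_subset (isClosed_tsupport χ) hsupp, hsupp.trans hLU',
    fun x => hr ⟨x, rfl⟩, interior L, isOpen_interior, hKL,
    fun x hx => (h1 x).1 (interior_subset hx)⟩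

end WeakDeriv


lemma _root_.LocallyLipschitz.mul_real {α : Type*} [PseudoEMetricSpace α] {f g : α → ℝ}
    (hf : LocallyLipschitz f) (hg : LocallyLipschitz g) :
    LocallyLipschitz fun x => f x * g x := by
  intro x
  obtain ⟨C, s, hs, hC⟩ := hf x
  obtain ⟨D, t, ht, hD⟩ := hg x
  have bf : ∀ᶠ y in 𝓝 x, ‖f y‖₊ < ‖f x‖₊ + 1 :=
    (hf.continuous.nnnorm.tendsto x).eventually_lt_const (by simp)
  have bg : ∀ᶠ y in 𝓝 x, ‖g y‖₊ < ‖g x‖₊ + 1 :=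
    (hg.continuous.nnnorm.tendsto x).eventually_lt_const (by simp)
  refine ⟨(‖f x‖₊ + 1) * D + (‖g x‖₊ + 1) * C, _,
    inter_mem (inter_mem hs ht) (inter_mem bf bg), ?_⟩
  rintro a ⟨⟨has, hat⟩, haf, hag⟩ b ⟨⟨hbs, hbt⟩, hbf, hbg⟩
  have e : f a * g a - f b * g b = f a * (g a - g b) + g b * (f a - f b) := by ring
  have h1 := hC has hbs
  have h2 := hD hat hbt
  rw [edist_eq_enorm_sub] at h1 h2 ⊢
  rw [e]
  refine (enorm_add_le _ _).trans ?_
  rw [enorm_mul, enorm_mul]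
  calc ‖f a‖ₑ * ‖g a - g b‖ₑ + ‖g b‖ₑ * ‖f a - f b‖ₑ
      ≤ ((‖f x‖₊ + 1 : ℝ≥0) : ℝ≥0∞) * (D * edist a b) +
        ((‖g x‖₊ + 1 : ℝ≥0) : ℝ≥0∞) * (C * edist a b) := by
        gcongr
        · exact_mod_cast (le_of_lt haf)
        · exact_mod_cast (le_of_lt hbg)
    _ = _ := by push_cast; ring

/-! ### Weak derivatives of Lipschitz functions and products -/

section WeakDerivChain

variable {n : ℕ}

local notation "𝔼" => EuclideanSpace ℝ (Fin n)

/-- On a compact neighbourhood the local Lipschitz constants become uniform, and the restriction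
extends to the whole space. Rademacher's theorem and integration by parts are thus needed only for
globally Lipschitz functions. -/
lemma locallyLipschitzOn_eq_lipschitz {U : Set 𝔼} (hU : IsOpen U) {f : 𝔼 → ℝ}
    (hf : LocallyLipschitzOn U f) {K : Set 𝔼} (hK : IsCompact K) (hKU : K ⊆ U) :
    ∃ (g : 𝔼 → ℝ) (C : ℝ≥0) (V : Set 𝔼), LipschitzWith C g ∧ IsOpen V ∧ K ⊆ V ∧ V ⊆ U ∧
      EqOn f g V := by
  obtain ⟨L, hL, hKL, hLU⟩ := exists_compact_between hK hU hKU
  obtain ⟨C, hC⟩ := (hf.mono hLU).exists_lipschitzOnWith_of_compact hL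
  obtain ⟨g, hg, hfg⟩ := hC.extend_real
  exact ⟨g, C, interior L, hg, isOpen_interior, hKL, interior_subset.trans hLU,
    hfg.mono interior_subset⟩

lemma ae_differentiableAt_of_locallyLipschitzOn {U : Set 𝔼} (hU : IsOpen U) {f : 𝔼 → ℝ}
    (hf : LocallyLipschitzOn U f) : ∀ᵐ x, x ∈ U → DifferentiableAt ℝ f x := by
  have h : ∀ x ∈ U, ∃ V ∈ 𝓝[U] x, ∀ᵐ y, y ∈ V → DifferentiableAt ℝ f y := by
    intro x hx
    obtain ⟨g, C, V, hg, hV, hxV, -, hfg⟩ := locallyLipschitzOn_eq_lipschitz hU hf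
      (isCompact_singleton (x := x)) (by simpa using hx)
    refine ⟨V, mem_nhdsWithin_of_mem_nhds (hV.mem_nhds (hxV rfl)), ?_⟩
    filter_upwards [hg.ae_differentiableAt (μ := volume)] with y hy hyV
    exact hy.congr_of_eventuallyEq (hfg.eventuallyEq_of_mem (hV.mem_nhds hyV))
  have := MeasureTheory.measure_null_of_locally_null (μ := (volume : Measure 𝔼))
    (U ∩ {y | ¬ DifferentiableAt ℝ f y}) (by
      rintro x ⟨hx, -⟩
      obtain ⟨V, hV, hae⟩ := h x hx
      refine ⟨(U ∩ {y | ¬ DifferentiableAt ℝ f y}) ∩ V, ?_, measure_mono_null ?_ hae⟩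
      · exact inter_mem self_mem_nhdsWithin (nhdsWithin_mono _ inter_subset_left hV)
      · rintro y ⟨⟨-, hy⟩, hyV⟩ h'
        exact hy (h' hyV))
  filter_upwards [measure_eq_zero_iff_ae_notMem.1 this] with y hy hyU
  by_contra h'
  exact hy ⟨hyU, h'⟩

/-- Locally Lipschitz functions are weakly differentiable. -/
lemma hasWeakDeriv_of_locallyLipschitzOn {U : Set 𝔼} (hU : IsOpen U) {f : 𝔼 → ℝ}
    (hf : LocallyLipschitzOn U f) (e : 𝔼) :
    HasWeakDeriv U f (fun x => fderiv ℝ f x e) e := by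
  refine HasWeakDeriv.of_compact hU fun K hK hKU => ?_
  obtain ⟨g, C, V, hg, hV, hKV, hVU, hfg⟩ := locallyLipschitzOn_eq_lipschitz hU hf hK hKU
  refine ⟨g, fun x => lineDeriv ℝ g x e, ⟨hg.continuous.locallyIntegrable.locallyIntegrableOn _,
    (hg.locallyIntegrable_lineDeriv e).locallyIntegrableOn _, fun ψ hψ hc hs => ?_⟩, ?_⟩
  · obtain ⟨D, hD⟩ := hψ.lipschitzWith_of_hasCompactSupport hc (by simp)
    rw [hg.integral_lineDeriv_mul_eq hD hc e, ← integral_neg]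
    refine integral_congr_ae (Eventually.of_forall fun y => ?_)
    simp only
    rw [(hψ.differentiable (by simp) y).lineDeriv_eq_fderiv, map_neg]
    ring
  · filter_upwards [hg.ae_differentiableAt (μ := volume)] with y hy hyK
    refine ⟨(hfg (hKV hyK)).symm, ?_⟩
    rw [hy.lineDeriv_eq_fderiv, (hfg.eventuallyEq_of_mem (hV.mem_nhds (hKV hyK))).fderiv_eq]

lemma hasWeakDeriv_of_contDiff {f : 𝔼 → ℝ} (hf : ContDiff ℝ 1 f) (e : 𝔼) (U : Set 𝔼) :
    HasWeakDeriv U f (fun x => fderiv ℝ f x e) e :=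
  (hasWeakDeriv_of_locallyLipschitzOn isOpen_univ
    (hf.locallyLipschitz.locallyLipschitzOn) e).mono (subset_univ U)

/-- The derivative of a mollification is the mollification of the weak derivative. -/
lemma fderiv_mollify {u v : 𝔼 → ℝ} {e : 𝔼} (h : HasWeakDeriv univ u v e) (k : ℕ) (x : 𝔼) :
    fderiv ℝ (mollify k u) x e = mollify k v x := by
  have hu : LocallyIntegrable u volume := locallyIntegrableOn_univ.1 h.locInt
  set φ := (bumpSeq n k).normed volume with hφdef
  have hφ : ContDiff ℝ ∞ φ := (bumpSeq n k).contDiff_normed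
  have hφc : HasCompactSupport φ := (bumpSeq n k).hasCompactSupport_normed
  have hd := hφc.hasFDerivAt_convolution_left (ContinuousLinearMap.lsmul ℝ ℝ)
    (hφ.of_le (by simp)) hu x
  have h1 : fderiv ℝ (mollify k u) x e = ∫ t, fderiv ℝ φ t e * u (x - t) := by
    rw [show mollify k u = convolution φ u (ContinuousLinearMap.lsmul ℝ ℝ) volume from rfl,
      hd.fderiv]
    have hex : ConvolutionExistsAt (fderiv ℝ φ) u x (ContinuousLinearMap.precompL 𝔼
        (ContinuousLinearMap.lsmul ℝ ℝ : ℝ →L[ℝ] ℝ →L[ℝ] ℝ)) volume :=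
      HasCompactSupport.convolutionExists_left _ (hφc.fderiv ℝ)
        (hφ.continuous_fderiv (by simp)) hu x
    unfold ConvolutionExistsAt at hex
    rw [convolution, ContinuousLinearMap.integral_apply hex]
    refine integral_congr_ae (Eventually.of_forall fun t => ?_)
    simp only [ContinuousLinearMap.precompL_apply, ContinuousLinearMap.lsmul_apply, smul_eq_mul]
  -- The derivative of the convolution falls on the bump. Testing with the reflected, translated
  -- bump moves it onto `u`; the sign of the reflection cancels that of integration by parts.
  set ψ : 𝔼 → ℝ := fun s => φ (x - s) with hψdef
  have hψ : ContDiff ℝ ∞ ψ := hφ.comp (contDiff_const.sub contDiff_id)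
  have hψc : HasCompactSupport ψ := hφc.comp_homeomorph (Homeomorph.subLeft x)
  have hψd : ∀ s, fderiv ℝ ψ s e = - fderiv ℝ φ (x - s) e := by
    intro s
    have h2 : HasFDerivAt (fun s : 𝔼 => x - s) (-ContinuousLinearMap.id ℝ 𝔼) s := by
      simpa using (hasFDerivAt_id s).const_sub x
    have h3 := ((hφ.differentiable (by simp) (x - s)).hasFDerivAt).comp s h2
    have h4 : fderiv ℝ ψ s = _ := h3.fderiv
    rw [h4]
    simp
  have h5 := h.integral_eq ψ hψ hψc (subset_univ _)
  rw [h1, mollify_apply]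
  rw [← integral_sub_left_eq_self (fun t => fderiv ℝ φ t e * u (x - t)) volume x,
    ← integral_sub_left_eq_self (fun t => φ t * v (x - t)) volume x]
  simp only [sub_sub_cancel]
  simp_rw [hψd] at h5
  have h6 : ∫ y, fderiv ℝ φ (x - y) e * u y = -∫ y, u y * -(fderiv ℝ φ (x - y)) e := by
    rw [← integral_neg]
    refine integral_congr_ae (Eventually.of_forall fun y => ?_)
    simp only
    ring
  have h7 : ∫ y, φ (x - y) * v y = ∫ y, v y * ψ y :=
    integral_congr_ae (Eventually.of_forall fun y => by simp only [hψdef]; ring)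
  rw [h6, h5, h7, neg_neg]

lemma tendsto_mollify_lintegral {u : 𝔼 → ℝ} (hu : Integrable u volume) :
    Tendsto (fun k => ∫⁻ x, ‖mollify k u x - u x‖ₑ) atTop (𝓝 0) := by
  have := mollify_tendsto_eLpNorm (q := 1) le_rfl (by simpa using memLp_one_iff_integrable.2 hu)
  simpa [eLpNorm_one_eq_lintegral_enorm] using this

namespace HasWeakDeriv

variable {U : Set (EuclideanSpace ℝ (Fin n))} {u v u' v' : EuclideanSpace ℝ (Fin n) → ℝ}
  {e : EuclideanSpace ℝ (Fin n)}

/-- A weakly differentiable function agrees near a compact set with a globally integrable one. -/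
lemma exists_global (h : HasWeakDeriv U u v e) (hU : IsOpen U) {K : Set 𝔼} (hK : IsCompact K)
    (hKU : K ⊆ U) : ∃ u' v', HasWeakDeriv univ u' v' e ∧ Integrable u' volume ∧
      Integrable v' volume ∧ ∀ x ∈ K, u' x = u x ∧ v' x = v x := by
  obtain ⟨χ, hχ, hχc, hχU, -, V, hV, hKV, hχ1⟩ := exists_smooth_cutoff hK hU hKU
  have hw := h.smooth_mul isOpen_univ hχ (by simpa using hχU)
  have hi : ∀ (φ w : 𝔼 → ℝ), Continuous φ → tsupport φ ⊆ tsupport χ →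
      LocallyIntegrableOn w U volume → Integrable (fun x => φ x * w x) volume := by
    intro φ w hφ hφs hw
    have := integrable_mul_of_tsupport_subset hw hφ
      (hχc.of_isClosed_subset (isClosed_tsupport φ) hφs) (hφs.trans hχU)
    simpa only [mul_comm] using this
  refine ⟨_, _, hw, hi _ _ hχ.continuous subset_rfl h.locInt,
    (hi _ _ hχ.continuous subset_rfl h.locInt_deriv).add
      (hi _ _ (continuous_fderiv_apply hχ e) (tsupport_fderiv_apply_subset' χ e) h.locInt),
    fun x hx => ?_⟩
  have h1 : χ =ᶠ[𝓝 x] fun _ => 1 := by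
    filter_upwards [hV.mem_nhds (hKV hx)] with y hy using hχ1 y hy
  simp [h1.fderiv_eq, hχ1 x (hKV hx)]

/-- Leibniz rule for multiplication with a locally Lipschitz function. -/
lemma lipschitz_mul (h : HasWeakDeriv U u v e) (hU : IsOpen U) {η : 𝔼 → ℝ}
    (hη : LocallyLipschitzOn U η) :
    HasWeakDeriv U (fun x => η x * u x) (fun x => η x * v x + fderiv ℝ η x e * u x) e := by
  refine of_compact hU fun K hK hKU => ?_
  obtain ⟨u', v', h', hu', hv', hK'⟩ := h.exists_global hU hK hKU
  obtain ⟨g, C, V, hg, hV, hKV, hVU, hηg⟩ := locallyLipschitzOn_eq_lipschitz hU hη hK hKU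
  refine ⟨fun x => g x * u' x, fun x => g x * v' x + lineDeriv ℝ g x e * u' x, ?_, ?_⟩
  · have hgl : ∀ x, ‖lineDeriv ℝ g x e‖ ≤ C * ‖e‖ := fun x => norm_lineDeriv_le_of_lipschitz ℝ hg
    have hglm : AEStronglyMeasurable (fun x => lineDeriv ℝ g x e) volume :=
      (hg.memLp_lineDeriv e).1
    have hli1 : ∀ w : 𝔼 → ℝ, Integrable w volume →
        LocallyIntegrableOn (fun x => g x * w x) U volume := fun w hw =>
      (locallyIntegrableOn_iff_compact hU).2 fun K _ hK =>
        hw.integrableOn.continuousOn_mul hg.continuous.continuousOn hK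
    have hli2 : ∀ w : 𝔼 → ℝ, Integrable w volume →
        Integrable (fun x => lineDeriv ℝ g x e * w x) volume := fun w hw =>
      hw.bdd_mul hglm (Eventually.of_forall hgl)
    -- Mollifying only the Sobolev factor keeps the product locally Lipschitz, so its derivative is
    -- the classical one almost everywhere. Local boundedness of `g` and the global bound on its
    -- line derivative carry the `L¹` limits through.
    refine of_tendsto (us := fun k x => g x * mollify k u' x)
      (vs := fun k x => g x * mollify k v' x + lineDeriv ℝ g x e * mollify k u' x)
      (hli1 _ hu') ((hli1 _ hv').add ((hli2 _ hu').locallyIntegrable.locallyIntegrableOn _))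
      (fun k => ?_) ?_ ?_
    · have hs : ContDiff ℝ 1 (mollify k u') :=
        (mollify_contDiff k hu'.locallyIntegrable).of_le (by simp)
      have := hasWeakDeriv_of_locallyLipschitzOn hU (f := fun x => g x * mollify k u' x)
        (hg.locallyLipschitz.mul_real hs.locallyLipschitz).locallyLipschitzOn e
      refine this.congr hU ?_
      filter_upwards [hg.ae_differentiableAt (μ := volume)] with x hx _
      refine ⟨rfl, ?_⟩
      rw [fderiv_fun_mul hx (hs.differentiable (by simp) x), hx.lineDeriv_eq_fderiv,
        ← fderiv_mollify h']
      simp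
      ring
    · intro L hL _
      obtain ⟨B, hB⟩ := hL.exists_bound_of_continuousOn hg.continuous.continuousOn
      refine tendsto_of_tendsto_of_tendsto_of_le_of_le tendsto_const_nhds
        (h := fun k => ENNReal.ofReal B * ∫⁻ x, ‖mollify k u' x - u' x‖ₑ) ?_
        (fun _ => zero_le) fun k => ?_
      · simpa using ENNReal.Tendsto.const_mul (a := ENNReal.ofReal B)
          (tendsto_mollify_lintegral hu') (Or.inr ENNReal.ofReal_ne_top)
      · beta_reduce
        rw [← lintegral_const_mul' _ _ ENNReal.ofReal_ne_top]
        refine (setLIntegral_mono' hL.measurableSet fun x hx => ?_).trans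
          (setLIntegral_le_lintegral L _)
        rw [← mul_sub, enorm_mul]
        gcongr
        rw [← ofReal_norm]
        exact ENNReal.ofReal_le_ofReal (hB x hx)
    · intro L hL _
      obtain ⟨B, hB⟩ := hL.exists_bound_of_continuousOn hg.continuous.continuousOn
      refine tendsto_of_tendsto_of_tendsto_of_le_of_le tendsto_const_nhds
        (h := fun k => ENNReal.ofReal B * (∫⁻ x, ‖mollify k v' x - v' x‖ₑ) +
          ENNReal.ofReal (C * ‖e‖) * ∫⁻ x, ‖mollify k u' x - u' x‖ₑ) ?_
        (fun _ => zero_le) fun k => ?_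
      · simpa using (ENNReal.Tendsto.const_mul (a := ENNReal.ofReal B)
          (tendsto_mollify_lintegral hv') (Or.inr ENNReal.ofReal_ne_top)).add
            (ENNReal.Tendsto.const_mul (a := ENNReal.ofReal (C * ‖e‖))
          (tendsto_mollify_lintegral hu') (Or.inr ENNReal.ofReal_ne_top))
      · beta_reduce
        rw [← lintegral_const_mul' _ _ ENNReal.ofReal_ne_top,
          ← lintegral_const_mul' _ _ ENNReal.ofReal_ne_top, ← lintegral_add_left']
        · refine (setLIntegral_mono' hL.measurableSet fun x hx => ?_).trans
            (setLIntegral_le_lintegral L _)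
          have e1 : g x * mollify k v' x + lineDeriv ℝ g x e * mollify k u' x -
              (g x * v' x + lineDeriv ℝ g x e * u' x) = g x * (mollify k v' x - v' x) +
              lineDeriv ℝ g x e * (mollify k u' x - u' x) := by ring
          rw [e1]
          refine (enorm_add_le _ _).trans ?_
          rw [enorm_mul, enorm_mul]
          gcongr
          · rw [← ofReal_norm]
            exact ENNReal.ofReal_le_ofReal (hB x hx)
          · rw [← ofReal_norm]
            exact ENNReal.ofReal_le_ofReal (hgl x)
        · exact (((mollify_contDiff k hv'.locallyIntegrable).continuous.aestronglyMeasurable.sub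
            hv'.1).enorm).const_mul _
  · filter_upwards [hg.ae_differentiableAt (μ := volume)] with x hx hxK
    have h1 : η =ᶠ[𝓝 x] g := hηg.eventuallyEq_of_mem (hV.mem_nhds (hKV hxK))
    rw [hx.lineDeriv_eq_fderiv, h1.fderiv_eq, (hK' x hxK).1, (hK' x hxK).2, hηg (hKV hxK)]
    exact ⟨rfl, rfl⟩

end HasWeakDeriv

end WeakDerivChain


/-! ### Vanishing of weak derivatives on zero sets -/

section WeakDerivAbs

variable {n : ℕ}

local notation "𝔼" => EuclideanSpace ℝ (Fin n)

/-- A smooth approximation of the absolute value at scale `ε`, centred at `c * ε`. -/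
def absApprox (c ε s : ℝ) : ℝ := Real.sqrt ((s - c * ε) ^ 2 + ε ^ 2)

/-- The derivative of `absApprox`. -/
def absApproxDeriv (c ε s : ℝ) : ℝ := (s - c * ε) / Real.sqrt ((s - c * ε) ^ 2 + ε ^ 2)

/-- The limit of `absApproxDeriv c ε s` as `ε` tends to `0`. -/
def absLimDeriv (c s : ℝ) : ℝ := if s = 0 then -c / Real.sqrt (c ^ 2 + 1) else s / |s|

lemma hasDerivAt_absApprox (c : ℝ) {ε : ℝ} (hε : 0 < ε) (s : ℝ) :
    HasDerivAt (absApprox c ε) (absApproxDeriv c ε s) s := by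
  have h0 : (s - c * ε) ^ 2 + ε ^ 2 ≠ 0 := by positivity
  have h1 : HasDerivAt (fun s : ℝ => (s - c * ε) ^ 2 + ε ^ 2) (2 * (s - c * ε)) s := by
    have := (((hasDerivAt_id s).sub_const (c * ε)).pow 2).add_const (ε ^ 2)
    simpa using this
  have h2 := h1.sqrt h0
  have h3 : absApproxDeriv c ε s = 2 * (s - c * ε) / (2 * Real.sqrt ((s - c * ε) ^ 2 + ε ^ 2)) := by
    unfold absApproxDeriv
    field_simp
  rw [h3]
  exact h2

lemma contDiff_absApprox (c : ℝ) {ε : ℝ} (hε : 0 < ε) : ContDiff ℝ 1 (absApprox c ε) := by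
  unfold absApprox
  refine ContDiff.sqrt (by fun_prop) fun s => ?_
  positivity

lemma abs_absApproxDeriv_le (c ε s : ℝ) : |absApproxDeriv c ε s| ≤ 1 := by
  rw [absApproxDeriv, abs_div, abs_of_nonneg (Real.sqrt_nonneg _)]
  refine div_le_one_of_le₀ ?_ (Real.sqrt_nonneg _)
  rw [← Real.sqrt_sq_eq_abs]
  exact Real.sqrt_le_sqrt (by nlinarith [sq_nonneg ε])

lemma continuous_absApproxDeriv (c : ℝ) {ε : ℝ} (hε : 0 < ε) :
    Continuous (absApproxDeriv c ε) := by
  unfold absApproxDeriv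
  refine Continuous.div (by fun_prop) (by fun_prop) fun s => ?_
  have : 0 < (s - c * ε) ^ 2 + ε ^ 2 := by positivity
  exact (Real.sqrt_pos.2 this).ne'

lemma lipschitzWith_absApprox (c : ℝ) {ε : ℝ} (hε : 0 < ε) : LipschitzWith 1 (absApprox c ε) := by
  refine lipschitzWith_of_nnnorm_deriv_le
    (fun s => (hasDerivAt_absApprox c hε s).differentiableAt) fun s => ?_
  rw [(hasDerivAt_absApprox c hε s).deriv]
  exact abs_absApproxDeriv_le c ε s

lemma abs_absApprox_sub_le (c : ℝ) {ε : ℝ} (hε : 0 < ε) (s : ℝ) :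
    |absApprox c ε s - (|s|)| ≤ (|c| + 1) * ε := by
  have h1 : |absApprox c ε s - (|s - c * ε|)| ≤ ε := by
    rw [abs_le, absApprox]
    constructor
    · have : |s - c * ε| ≤ Real.sqrt ((s - c * ε) ^ 2 + ε ^ 2) := by
        rw [← Real.sqrt_sq_eq_abs]
        exact Real.sqrt_le_sqrt (by nlinarith [sq_nonneg ε])
      linarith
    · have : Real.sqrt ((s - c * ε) ^ 2 + ε ^ 2) ≤ |s - c * ε| + ε := by
        refine Real.sqrt_le_iff.2 ⟨by positivity, ?_⟩
        nlinarith [sq_abs (s - c * ε), abs_nonneg (s - c * ε)]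
      linarith
  have h2 : |(|s - c * ε|) - (|s|)| ≤ |c| * ε := by
    refine (abs_abs_sub_abs_le_abs_sub _ _).trans ?_
    rw [sub_sub_cancel_left, abs_neg, abs_mul, abs_of_pos hε]
  calc |absApprox c ε s - (|s|)| = |(absApprox c ε s - (|s - c * ε|)) + ((|s - c * ε|) - (|s|))| := by
        congr 1; ring
    _ ≤ ε + |c| * ε := (abs_add_le _ _).trans (add_le_add h1 h2)
    _ = _ := by ring

/-- The shift is proportional to `ε`, so at `s = 0` the derivative does not change with `ε` and
equals a number depending on `c`; elsewhere the limit is the sign of `s`. This dependence on `c` at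
zero alone is the purpose of the shift. -/
lemma tendsto_absApproxDeriv (c s : ℝ) :
    Tendsto (fun ε => absApproxDeriv c ε s) (𝓝[>] 0) (𝓝 (absLimDeriv c s)) := by
  by_cases hs : s = 0
  · subst hs
    refine tendsto_const_nhds.congr' ?_
    filter_upwards [self_mem_nhdsWithin] with ε hε
    have hε' : (0 : ℝ) < ε := hε
    simp only [absLimDeriv, absApproxDeriv, if_true]
    have h1 : (0 - c * ε) ^ 2 + ε ^ 2 = (c ^ 2 + 1) * ε ^ 2 := by ring
    rw [h1, Real.sqrt_mul (by positivity), Real.sqrt_sq hε'.le]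
    have : Real.sqrt (c ^ 2 + 1) ≠ 0 := (Real.sqrt_pos.2 (by positivity)).ne'
    field_simp
    ring
  · have h : ContinuousAt (fun ε => absApproxDeriv c ε s) 0 := by
      unfold absApproxDeriv
      refine ContinuousAt.div (by fun_prop) (by fun_prop) ?_
      have : 0 < (s - c * 0) ^ 2 + 0 ^ 2 := by simp; positivity
      exact (Real.sqrt_pos.2 this).ne'
    have h2 := h.tendsto.mono_left (nhdsWithin_le_nhds (s := Ioi 0))
    convert h2 using 2
    simp [absApproxDeriv, absLimDeriv, hs, Real.sqrt_sq_eq_abs]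

lemma abs_absLimDeriv_le (c s : ℝ) : |absLimDeriv c s| ≤ 1 :=
  le_of_tendsto (tendsto_absApproxDeriv c s).abs
    (Eventually.of_forall fun ε => abs_absApproxDeriv_le c ε s)

namespace HasWeakDeriv

variable {U : Set (EuclideanSpace ℝ (Fin n))} {u v : EuclideanSpace ℝ (Fin n) → ℝ}
  {e : EuclideanSpace ℝ (Fin n)}

lemma integrable_mul_of_abs_le_one {θ v : 𝔼 → ℝ} (hθ : AEStronglyMeasurable θ volume)
    (h1 : ∀ x, |θ x| ≤ 1) (hv : Integrable v volume) : Integrable (fun x => θ x * v x) volume :=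
  hv.bdd_mul (c := 1) hθ (Eventually.of_forall h1)

/-- Dominated convergence for products with uniformly bounded factors. -/
lemma tendsto_lintegral_mul_sub {θ : ℕ → 𝔼 → ℝ} {θ' v : 𝔼 → ℝ}
    (hθ : ∀ k, AEStronglyMeasurable (θ k) volume) (hθ' : AEStronglyMeasurable θ' volume)
    (h1 : ∀ k x, |θ k x| ≤ 1) (h1' : ∀ x, |θ' x| ≤ 1) (hv : Integrable v volume)
    (hlim : ∀ᵐ x, Tendsto (fun k => θ k x) atTop (𝓝 (θ' x))) :
    Tendsto (fun k => ∫⁻ x, ‖θ k x * v x - θ' x * v x‖ₑ) atTop (𝓝 0) := by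
  have h := tendsto_lintegral_of_dominated_convergence' (μ := volume) (fun x => 2 * ‖v x‖ₑ)
    (F := fun k x => ‖θ k x * v x - θ' x * v x‖ₑ) (f := fun _ => 0)
    (fun k => (((hθ k).mul hv.1).sub (hθ'.mul hv.1)).enorm)
    (fun k => Eventually.of_forall fun x => ?_) ?_ ?_
  · simpa using h
  · beta_reduce
    rw [← sub_mul, enorm_mul]
    gcongr
    rw [← ofReal_norm]
    refine (ENNReal.ofReal_le_ofReal (q := 2) ?_).trans (by simp)
    refine (abs_sub _ _).trans ?_
    linarith [h1 k x, h1' x]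
  · rw [lintegral_const_mul' _ _ (by simp)]
    exact ENNReal.mul_ne_top (by simp) hv.2.ne
  · filter_upwards [hlim] with x hx
    have : Tendsto (fun k => θ k x * v x - θ' x * v x) atTop (𝓝 (θ' x * v x - θ' x * v x)) :=
      (hx.mul_const _).sub_const _
    simpa using this.enorm

/-- The chain rule is classical for mollifications. In the limit the product is split into
convergence of the derivative in `L¹` and dominated convergence of the bounded outer factor. -/
lemma absApprox_comp (h : HasWeakDeriv univ u v e) (hu : Integrable u volume)
    (hv : Integrable v volume) (c : ℝ) {ε : ℝ} (hε : 0 < ε) :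
    HasWeakDeriv univ (fun x => absApprox c ε (u x)) (fun x => absApproxDeriv c ε (u x) * v x) e := by
  have hG := lipschitzWith_absApprox c hε
  have hG' := continuous_absApproxDeriv c hε
  have hli : LocallyIntegrable (fun x => absApprox c ε (u x)) volume := by
    have h0 : LocallyIntegrable (fun x => |u x| + (|c| + 1) * ε) volume :=
      hu.abs.locallyIntegrable.add (locallyIntegrable_const _)
    refine h0.mono (hG.continuous.comp_aestronglyMeasurable hu.1)
      (Eventually.of_forall fun x => ?_)
    have h1 := abs_le.1 (abs_absApprox_sub_le c hε (u x))
    have h2 : 0 ≤ absApprox c ε (u x) := Real.sqrt_nonneg _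
    rw [Real.norm_of_nonneg h2]
    refine le_trans ?_ (le_abs_self _)
    linarith [h1.2]
  have hi : Integrable (fun x => absApproxDeriv c ε (u x) * v x) volume :=
    integrable_mul_of_abs_le_one (hG'.comp_aestronglyMeasurable hu.1)
      (fun x => abs_absApproxDeriv_le c ε _) hv
  refine of_tendsto (us := fun k x => absApprox c ε (mollify k u x))
    (vs := fun k x => absApproxDeriv c ε (mollify k u x) * mollify k v x)
    (hli.locallyIntegrableOn _) (hi.locallyIntegrable.locallyIntegrableOn _) (fun k => ?_) ?_ ?_
  · have hs : ContDiff ℝ 1 (mollify k u) :=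
      (mollify_contDiff k hu.locallyIntegrable).of_le (by simp)
    have h1 := hasWeakDeriv_of_contDiff ((contDiff_absApprox c hε).comp hs) e univ
    refine h1.congr isOpen_univ (Eventually.of_forall fun x _ => ⟨rfl, ?_⟩)
    have h2 := (hasDerivAt_absApprox c hε (mollify k u x)).comp_hasFDerivAt x
      (hs.differentiable (by simp) x).hasFDerivAt
    rw [h2.fderiv, ← fderiv_mollify h]
    simp
  · intro K hK _
    refine tendsto_of_tendsto_of_tendsto_of_le_of_le tendsto_const_nhds
      (tendsto_mollify_lintegral hu) (fun _ => zero_le) fun k => ?_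
    refine (setLIntegral_le_lintegral K _).trans (lintegral_mono fun x => ?_)
    have := hG (mollify k u x) (u x)
    simpa [edist_eq_enorm_sub] using this
  · intro K hK _
    have t1 := tendsto_lintegral_mul_sub (θ := fun k x => absApproxDeriv c ε (mollify k u x))
      (θ' := fun x => absApproxDeriv c ε (u x))
      (fun k => (hG'.comp (mollify_contDiff k hu.locallyIntegrable).continuous).aestronglyMeasurable)
      (hG'.comp_aestronglyMeasurable hu.1) (fun k x => abs_absApproxDeriv_le c ε _)
      (fun x => abs_absApproxDeriv_le c ε _) hv (by
        filter_upwards [mollify_ae_tendsto hu.locallyIntegrable] with x hx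
        exact (hG'.tendsto _).comp hx)
    refine tendsto_of_tendsto_of_tendsto_of_le_of_le tendsto_const_nhds
      (by simpa using (tendsto_mollify_lintegral hv).add t1) (fun _ => zero_le) fun k => ?_
    have hm : AEMeasurable (fun x => ‖mollify k v x - v x‖ₑ) volume :=
      ((mollify_contDiff k hv.locallyIntegrable).continuous.aestronglyMeasurable.sub hv.1).enorm
    beta_reduce
    rw [← lintegral_add_left' hm]
    refine (setLIntegral_le_lintegral K _).trans (lintegral_mono fun x => ?_)
    have e1 : absApproxDeriv c ε (mollify k u x) * mollify k v x - absApproxDeriv c ε (u x) * v x =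
      absApproxDeriv c ε (mollify k u x) * (mollify k v x - v x) +
      (absApproxDeriv c ε (mollify k u x) * v x - absApproxDeriv c ε (u x) * v x) := by ring
    rw [e1]
    refine (enorm_add_le _ _).trans ?_
    gcongr
    rw [enorm_mul]
    refine mul_le_of_le_one_left zero_le ?_
    rw [← ofReal_norm]
    exact (ENNReal.ofReal_le_ofReal (abs_absApproxDeriv_le c ε _)).trans (by simp)

/-- Letting `ε` tend to 0 yields, for every `c`, a weak derivative of the same function `|u|`. -/
lemma abs_aux (h : HasWeakDeriv U u v e) (hU : IsOpen U) (c : ℝ) :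
    HasWeakDeriv U (fun x => |u x|) (fun x => absLimDeriv c (u x) * v x) e := by
  refine of_compact hU fun K hK hKU => ?_
  obtain ⟨u', v', h', hu', hv', hK'⟩ := h.exists_global hU hK hKU
  refine ⟨fun x => |u' x|, fun x => absLimDeriv c (u' x) * v' x, ?_,
    Eventually.of_forall fun x hx => by beta_reduce; rw [(hK' x hx).1, (hK' x hx).2]; exact ⟨rfl, rfl⟩⟩
  set ε : ℕ → ℝ := fun k => 1 / ((k : ℝ) + 1)
  have hε : ∀ k, 0 < ε k := fun k => by positivity
  have hε0 : Tendsto ε atTop (𝓝 0) := tendsto_one_div_add_atTop_nhds_zero_nat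
  have hε' : Tendsto ε atTop (𝓝[>] 0) :=
    tendsto_nhdsWithin_iff.2 ⟨hε0, Eventually.of_forall hε⟩
  have hlim : ∀ s, Tendsto (fun k => absApproxDeriv c (ε k) s) atTop (𝓝 (absLimDeriv c s)) :=
    fun s => (tendsto_absApproxDeriv c s).comp hε'
  have hm : ∀ k, AEStronglyMeasurable (fun x => absApproxDeriv c (ε k) (u' x)) volume := fun k =>
    (continuous_absApproxDeriv c (hε k)).comp_aestronglyMeasurable hu'.1
  have hm' : AEStronglyMeasurable (fun x => absLimDeriv c (u' x)) volume :=
    aestronglyMeasurable_of_tendsto_ae atTop hm (Eventually.of_forall fun x => hlim (u' x))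
  have hi : Integrable (fun x => absLimDeriv c (u' x) * v' x) volume :=
    integrable_mul_of_abs_le_one hm' (fun x => abs_absLimDeriv_le c _) hv'
  refine (of_tendsto (U := univ) (us := fun k x => absApprox c (ε k) (u' x))
    (vs := fun k x => absApproxDeriv c (ε k) (u' x) * v' x)
    (hu'.abs.locallyIntegrable.locallyIntegrableOn _) (hi.locallyIntegrable.locallyIntegrableOn _)
    (fun k => h'.absApprox_comp hu' hv' c (hε k)) ?_ ?_).mono (subset_univ U)
  · intro L hL _
    have t : Tendsto (fun k => ENNReal.ofReal ((|c| + 1) * ε k) * volume L) atTop (𝓝 0) := by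
      have h1 : Tendsto (fun k => (|c| + 1) * ε k) atTop (𝓝 0) := by
        simpa using hε0.const_mul (|c| + 1)
      have h2 := ENNReal.Tendsto.mul_const (b := volume L)
        ((ENNReal.continuous_ofReal.tendsto 0).comp h1) (Or.inr hL.measure_lt_top.ne)
      simpa using h2
    refine tendsto_of_tendsto_of_tendsto_of_le_of_le tendsto_const_nhds t (fun _ => zero_le)
      fun k => ?_
    beta_reduce
    rw [← setLIntegral_const]
    refine lintegral_mono fun x => ?_
    rw [← ofReal_norm]
    exact ENNReal.ofReal_le_ofReal (abs_absApprox_sub_le c (hε k) _)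
  · intro L hL _
    have := tendsto_lintegral_mul_sub (θ := fun k x => absApproxDeriv c (ε k) (u' x)) hm hm'
      (fun k x => abs_absApproxDeriv_le c _ _) (fun x => abs_absLimDeriv_le c _) hv'
      (Eventually.of_forall fun x => hlim (u' x))
    exact tendsto_of_tendsto_of_tendsto_of_le_of_le tendsto_const_nhds this (fun _ => zero_le)
      fun k => setLIntegral_le_lintegral L _

/-- The weak derivative vanishes almost everywhere on the zero set. -/
lemma ae_eq_zero_of_eq_zero (h : HasWeakDeriv U u v e) (hU : IsOpen U) :
    ∀ᵐ x, x ∈ U → u x = 0 → v x = 0 := by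
  -- The formulas for `c = 0` and `c = 1` must agree almost everywhere. Where `u = 0` they read `0`
  -- and `-v / √2`, so `v = 0`.
  filter_upwards [(h.abs_aux hU 0).ae_unique hU (h.abs_aux hU 1)] with x hx hxU h0
  have h1 := hx hxU
  have h2 : Real.sqrt (1 + 1) ≠ 0 := by positivity
  simp only [absLimDeriv, h0, if_true] at h1
  norm_num at h1
  exact h1

end HasWeakDeriv

end WeakDerivAbs


/-! ### Riemannian distance and Lipschitz functions in charts -/

section LipschitzChart

variable {n : ℕ} {M : Type*} [MetricSpace M] [ChartedSpace (EuclideanSpace ℝ (Fin n)) M]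
  [IsManifold (𝓡 n) ∞ M]
  [RiemannianBundle (fun x : M => TangentSpace (𝓡 n) x)]

local notation "𝔼" => EuclideanSpace ℝ (Fin n)

variable [IsContMDiffRiemannianBundle (𝓡 n) ∞ (EuclideanSpace ℝ (Fin n))
      (fun x : M => TangentSpace (𝓡 n) x)]

section Dist

variable [IsRiemannianManifold (𝓡 n) M]

/-- The distance of two points in a chart is at most the length of the coordinate segment. -/
lemma edist_chart_symm_le (x₀ : M) (y w : 𝔼) {c : ℝ}
    (h : ∀ t ∈ Icc (0 : ℝ) 1, y + t • w ∈ (chartAt 𝔼 x₀).target)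
    (hc : ∀ t ∈ Icc (0 : ℝ) 1, ‖frame x₀ (y + t • w) w‖ ≤ c) :
    edist ((chartAt 𝔼 x₀).symm y) ((chartAt 𝔼 x₀).symm (y + w)) ≤ ENNReal.ofReal c := by
  rw [IsRiemannianManifold.out (I := 𝓡 n)]
  set γ : ℝ → M := fun t => (chartAt 𝔼 x₀).symm (y + t • w) with hγdef
  have hline : ContDiff ℝ 1 fun t : ℝ => y + t • w := by fun_prop
  have hγ : ContMDiffOn 𝓘(ℝ, ℝ) (𝓡 n) 1 γ (Icc 0 1) :=
    ((contMDiffOn_chart_symm (I := 𝓡 n) (n := ∞) (x := x₀)).of_le (by simp)).comp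
      hline.contMDiff.contMDiffOn h
  refine (Manifold.riemannianEDist_le_pathELength hγ (by simp [γ]) (by simp [γ])
    zero_le_one).trans ?_
  rw [Manifold.pathELength_eq_lintegral_mfderiv_Icc]
  calc _ ≤ ∫⁻ _ in Icc (0 : ℝ) 1, ENNReal.ofReal c := by
        refine setLIntegral_mono' measurableSet_Icc fun t ht => ?_
        have hl : HasDerivAt (fun t : ℝ => y + t • w) w t := by
          simpa using ((hasDerivAt_id t).smul_const w).const_add y
        have h1 := mfderiv_comp t (frame_mdiff x₀ (h t ht)) hl.differentiableAt.mdifferentiableAt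
        have h2 : mfderiv 𝓘(ℝ, ℝ) (𝓡 n) γ t (1 : ℝ) = frame x₀ (y + t • w) w := by
          have h3 := DFunLike.congr_fun h1 (1 : ℝ)
          refine h3.trans ?_
          change frame x₀ (y + t • w) (mfderiv 𝓘(ℝ, ℝ) (𝓡 n) (fun t : ℝ => y + t • w) t (1 : ℝ)) = _
          congr 1
          rw [mfderiv_eq_fderiv]
          have h4 : fderiv ℝ (fun t : ℝ => y + t • w) t 1 = w := by
            rw [hl.hasFDerivAt.fderiv]
            simp
          exact h4
        have h5 : ‖mfderiv 𝓘(ℝ, ℝ) (𝓡 n) γ t (1 : ℝ)‖ₑ = ‖frame x₀ (y + t • w) w‖ₑ :=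
          congrArg (fun v : TangentSpace (𝓡 n) (γ t) => ‖v‖ₑ) h2
        refine h5.trans_le ?_
        rw [← ofReal_norm]
        exact ENNReal.ofReal_le_ofReal (hc t ht)
    _ = _ := by simp

/-- The frame is bounded on a small closed coordinate ball, and the segments between its points stay
inside by convexity. -/
lemma locallyLipschitzOn_chart_symm (x₀ : M) :
    LocallyLipschitzOn (chartAt 𝔼 x₀).target (chartAt 𝔼 x₀).symm := by
  intro y hy
  obtain ⟨r, hr, hrt⟩ := Metric.nhds_basis_closedBall.mem_iff.1
    ((chartAt 𝔼 x₀).open_target.mem_nhds hy)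
  obtain ⟨C, hC, hb⟩ := exists_frame_bounds x₀ (isCompact_closedBall y r) hrt
  refine ⟨C.toNNReal, Metric.closedBall y r, mem_nhdsWithin_of_mem_nhds
    (Metric.closedBall_mem_nhds y hr), fun a ha b hb' => ?_⟩
  have hseg : ∀ t ∈ Icc (0 : ℝ) 1, a + t • (b - a) ∈ Metric.closedBall y r := fun t ht =>
    (convex_closedBall y r).add_smul_sub_mem ha hb' ht
  have := edist_chart_symm_le x₀ a (b - a) (c := C * ‖b - a‖) (fun t ht => hrt (hseg t ht))
    (fun t ht => (hb _ (hseg t ht) _).1)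
  rw [add_sub_cancel] at this
  refine this.trans_eq ?_
  rw [ENNReal.ofReal_mul hC.le, ofReal_norm, ← edist_eq_enorm_sub, edist_comm]
  rfl

lemma locallyLipschitzOn_comp_chart_symm {f : M → ℝ} (hf : LocallyLipschitz f) (x₀ : M) :
    LocallyLipschitzOn (chartAt 𝔼 x₀).target fun y => f ((chartAt 𝔼 x₀).symm y) := by
  intro y hy
  obtain ⟨C, s, hs, hC⟩ := locallyLipschitzOn_chart_symm x₀ hy
  obtain ⟨D, t, ht, hD⟩ := hf ((chartAt 𝔼 x₀).symm y)
  refine ⟨D * C, s ∩ (chartAt 𝔼 x₀).symm ⁻¹' t, inter_mem hs ?_, ?_⟩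
  · exact mem_nhdsWithin_of_mem_nhds (((chartAt 𝔼 x₀).continuousAt_symm hy).preimage_mem_nhds ht)
  · exact (hD.comp (hC.mono inter_subset_left) fun z hz => hz.2)

/-- Increments over `[0, t]` are controlled by any bound for `N` there; continuity lets this bound
decrease to `N 0` in the difference quotient, so the sharp factor survives. -/
lemma deriv_le_of_increment_le {φ N : ℝ → ℝ} {d L : ℝ} (hφ : HasDerivAt φ d 0)
    (hN : ContinuousAt N 0)
    (h : ∀ᶠ t in 𝓝[>] (0 : ℝ), ∀ c, (∀ s ∈ Icc (0 : ℝ) t, N s ≤ c) → φ t - φ 0 ≤ L * (t * c)) :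
    d ≤ L * N 0 := by
  have key : ∀ ε > 0, d ≤ L * (N 0 + ε) := by
    intro ε hε
    obtain ⟨δ, hδ0, hδ⟩ := Metric.eventually_nhds_iff.1
      (hN.tendsto.eventually_lt_const (lt_add_of_pos_right (N 0) hε))
    refine le_of_tendsto hφ.tendsto_slope_zero_right ?_
    filter_upwards [Ioo_mem_nhdsGT hδ0, h] with t ht h'
    simp only [zero_add, smul_eq_mul]
    rw [inv_mul_le_iff₀ ht.1]
    refine (h' (N 0 + ε) fun s hs => (hδ ?_).le).trans_eq (by ring)
    rw [Real.dist_eq, sub_zero, abs_of_nonneg hs.1]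
    exact hs.2.trans_lt ht.2
  have h1 : Tendsto (fun ε : ℝ => L * (N 0 + ε)) (𝓝[>] 0) (𝓝 (L * (N 0 + 0))) :=
    ((tendsto_id.mono_left nhdsWithin_le_nhds).const_add (N 0)).const_mul L
  rw [add_zero] at h1
  exact ge_of_tendsto h1 (by filter_upwards [self_mem_nhdsWithin] with ε hε using key ε hε)

lemma continuousAt_norm_frame_line (x₀ : M) {y : 𝔼} (hy : y ∈ (chartAt 𝔼 x₀).target) (v : 𝔼) :
    ContinuousAt (fun t : ℝ => ‖frame x₀ (y + t • v) v‖) 0 := by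
  have h1 : ContinuousAt (fun q : 𝔼 × 𝔼 => ‖frame x₀ q.1 q.2‖) (y + (0 : ℝ) • v, v) := by
    refine (continuousOn_norm_frame x₀).continuousAt
      (((chartAt 𝔼 x₀).open_target.prod isOpen_univ).mem_nhds ⟨?_, trivial⟩)
    simpa using hy
  have h2 : ContinuousAt (fun t : ℝ => ((y + t • v, v) : 𝔼 × 𝔼)) 0 := by fun_prop
  exact ContinuousAt.comp (f := fun t : ℝ => ((y + t • v, v) : 𝔼 × 𝔼)) (x := 0) h1 h2

/-- Following `v` for time `t` covers a distance of at most `t` times the largest frame length on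
the way; the infinitesimal estimate therefore has constant exactly `L`. -/
lemma fderiv_comp_chart_symm_le {f : M → ℝ} {L : ℝ≥0} (hf : LipschitzWith L f) (x₀ : M) {y : 𝔼}
    (hy : y ∈ (chartAt 𝔼 x₀).target)
    (hd : DifferentiableAt ℝ (fun y => f ((chartAt 𝔼 x₀).symm y)) y) (v : 𝔼) :
    fderiv ℝ (fun y => f ((chartAt 𝔼 x₀).symm y)) y v ≤ L * ‖frame x₀ y v‖ := by
  have hl : HasDerivAt (fun t : ℝ => f ((chartAt 𝔼 x₀).symm (y + t • v)))
      (fderiv ℝ (fun y => f ((chartAt 𝔼 x₀).symm y)) y v) 0 := by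
    have h4 : HasDerivAt (fun t : ℝ => y + t • v) v 0 := by
      simpa using ((hasDerivAt_id (0 : ℝ)).smul_const v).const_add y
    have h5 : HasFDerivAt (fun y => f ((chartAt 𝔼 x₀).symm y))
        (fderiv ℝ (fun y => f ((chartAt 𝔼 x₀).symm y)) y) (y + (0 : ℝ) • v) := by
      simpa using hd.hasFDerivAt
    exact h5.comp_hasDerivAt 0 h4
  have hev : ∀ᶠ t : ℝ in 𝓝 0, y + t • v ∈ (chartAt 𝔼 x₀).target := by
    have h3 : Continuous fun t : ℝ => y + t • v := by fun_prop
    have h2 : Tendsto (fun t : ℝ => y + t • v) (𝓝 0) (𝓝 y) := by simpa using h3.tendsto 0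
    exact h2.eventually ((chartAt 𝔼 x₀).open_target.mem_nhds hy)
  obtain ⟨δ, hδ0, hδ⟩ := Metric.eventually_nhds_iff.1 hev
  have := deriv_le_of_increment_le hl (continuousAt_norm_frame_line x₀ hy v) (by
    filter_upwards [Ioo_mem_nhdsGT hδ0] with t ht c hc
    have h7 := edist_chart_symm_le x₀ y (t • v) (c := t * c)
      (fun s hs => by
        rw [smul_smul]
        refine hδ ?_
        rw [Real.dist_eq, sub_zero, abs_of_nonneg (mul_nonneg hs.1 ht.1.le)]
        nlinarith [hs.2, ht.1, ht.2])
      (fun s hs => by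
        rw [smul_smul, map_smul, norm_smul, Real.norm_of_nonneg ht.1.le]
        exact mul_le_mul_of_nonneg_left
          (hc _ ⟨mul_nonneg hs.1 ht.1.le, by nlinarith [hs.2, ht.1]⟩) ht.1.le)
    have h8 : 0 ≤ t * c :=
      mul_nonneg ht.1.le ((norm_nonneg _).trans (hc 0 ⟨le_rfl, ht.1.le⟩))
    rw [edist_dist, ENNReal.ofReal_le_ofReal_iff h8, dist_comm] at h7
    rw [zero_smul, add_zero]
    refine (le_abs_self _).trans ((hf.dist_le_mul _ _).trans ?_)
    exact mul_le_mul_of_nonneg_left h7 L.2)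
  have e0 : y + (0 : ℝ) • v = y := by simp
  rwa [e0] at this

/-- The gradient of a Lipschitz function is bounded by its Lipschitz constant. -/
lemma norm_grad_le {f : M → ℝ} {L : ℝ≥0} (hf : LipschitzWith L f) (p : M) :
    ‖grad (n := n) f p‖ ≤ L := by
  by_cases hd : MDifferentiableAt (𝓡 n) 𝓘(ℝ, ℝ) f p
  swap
  -- Where `f` is not differentiable, `mfderiv` takes its default value 0, hence so does `grad`.
  · have h0 : grad (n := n) f p = 0 := by
      have h1 : ∀ v : TangentSpace (𝓡 n) p, (inner ℝ (grad f p) v : ℝ) = 0 := fun v => by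
        rw [inner_grad, mfderiv_zero_of_not_mdifferentiableAt hd]; rfl
      exact inner_self_eq_zero.1 (h1 _)
    rw [h0, norm_zero]
    exact L.2
  have hp : p ∈ (chartAt 𝔼 p).source := mem_chart_source 𝔼 p
  have hy := (chartAt 𝔼 p).map_source hp
  have hep : (chartAt 𝔼 p).symm (chartAt 𝔼 p p) = p := (chartAt 𝔼 p).left_inv hp
  have hdc : DifferentiableAt ℝ (fun y => f ((chartAt 𝔼 p).symm y)) (chartAt 𝔼 p p) := by
    rw [← hep] at hd
    exact (hd.comp (chartAt 𝔼 p p) (frame_mdiff p hy)).differentiableAt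
  rw [← hep]
  -- For the direction that the frame maps to the gradient itself, the bound reads `‖grad f‖² ≤ L
  -- ‖grad f‖`.
  obtain ⟨v, hv⟩ := frame_surjective p hy (grad f ((chartAt 𝔼 p).symm (chartAt 𝔼 p p)))
  have h1 := fderiv_comp_chart_symm_le hf p hy hdc v
  rw [← inner_grad_frame f p hy hdc, hv, real_inner_self_eq_norm_mul_norm] at h1
  by_contra! h2
  have h3 := lt_of_le_of_lt L.2 h2
  exact absurd (le_of_mul_le_mul_right h1 h3) (not_le.2 h2)

end Dist

end LipschitzChart


/-! ### Distributional gradients on the manifold -/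

section WeakGrad

variable {n : ℕ} {M : Type*} [MetricSpace M] [ChartedSpace (EuclideanSpace ℝ (Fin n)) M]
  [IsManifold (𝓡 n) ∞ M]
  [RiemannianBundle (fun x : M => TangentSpace (𝓡 n) x)]
  [IsContMDiffRiemannianBundle (𝓡 n) ∞ (EuclideanSpace ℝ (Fin n))
    (fun x : M => TangentSpace (𝓡 n) x)]

local notation "𝔼" => EuclideanSpace ℝ (Fin n)

/-- Local integrability stands apart from the derivative conditions because for `n = 0` there is no
index to supply it. -/
lemma isWeakGrad_iff {f : M → ℝ} {X : ∀ x : M, TangentSpace (𝓡 n) x} :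
    IsWeakGrad f X ↔ ∀ x₀ : M,
      LocallyIntegrableOn (fun y => f ((chartAt 𝔼 x₀).symm y)) (chartAt 𝔼 x₀).target volume ∧
      ∀ i, HasWeakDeriv (chartAt 𝔼 x₀).target (fun y => f ((chartAt 𝔼 x₀).symm y))
        (fun y => (inner ℝ (X ((chartAt 𝔼 x₀).symm y)) (coordVec x₀ y i) : ℝ))
        (EuclideanSpace.single i (1 : ℝ)) := by
  refine forall_congr' fun x₀ => ⟨fun h => ⟨h.1, fun i => ⟨h.1, (h.2 i).1, (h.2 i).2⟩⟩,
    fun h => ⟨h.1, fun i => ⟨(h.2 i).2, (h.2 i).3⟩⟩⟩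

namespace IsWeakGrad

variable {f f' : M → ℝ} {X X' : ∀ x : M, TangentSpace (𝓡 n) x}

lemma locInt (h : IsWeakGrad f X) (x₀ : M) :
    LocallyIntegrableOn (fun y => f ((chartAt 𝔼 x₀).symm y)) (chartAt 𝔼 x₀).target volume :=
  (h x₀).1

lemma hasWeakDeriv (h : IsWeakGrad f X) (x₀ : M) (i : Fin n) :
    HasWeakDeriv (chartAt 𝔼 x₀).target (fun y => f ((chartAt 𝔼 x₀).symm y))
      (fun y => (inner ℝ (X ((chartAt 𝔼 x₀).symm y)) (coordVec x₀ y i) : ℝ))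
      (EuclideanSpace.single i (1 : ℝ)) :=
  (isWeakGrad_iff.1 h x₀).2 i

lemma add (h : IsWeakGrad f X) (h' : IsWeakGrad f' X') :
    IsWeakGrad (fun p => f p + f' p) (fun p => X p + X' p) := by
  refine isWeakGrad_iff.2 fun x₀ => ⟨(h.locInt x₀).add (h'.locInt x₀), fun i => ?_⟩
  simpa only [inner_add_left] using (h.hasWeakDeriv x₀ i).add (h'.hasWeakDeriv x₀ i)

lemma sub (h : IsWeakGrad f X) (h' : IsWeakGrad f' X') :
    IsWeakGrad (fun p => f p - f' p) (fun p => X p - X' p) := by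
  refine isWeakGrad_iff.2 fun x₀ => ⟨(h.locInt x₀).sub (h'.locInt x₀), fun i => ?_⟩
  simpa only [inner_sub_left] using (h.hasWeakDeriv x₀ i).sub (h'.hasWeakDeriv x₀ i)

variable [MeasurableSpace M] [BorelSpace M]

lemma congr (h : IsWeakGrad f X) (hf : ∀ᵐ p ∂riemVol n M, f' p = f p)
    (hX : ∀ᵐ p ∂riemVol n M, X' p = X p) : IsWeakGrad f' X' := by
  refine isWeakGrad_iff.2 fun x₀ => ?_
  have hm : MeasurableSet (chartAt 𝔼 x₀).target := (chartAt 𝔼 x₀).open_target.measurableSet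
  have h1 := (ae_restrict_iff' hm).1 (ae_chart_of_ae hf x₀)
  have h2 := (ae_restrict_iff' hm).1 (ae_chart_of_ae hX x₀)
  refine ⟨?_, fun i => ?_⟩
  · refine (locallyIntegrableOn_iff_compact (chartAt 𝔼 x₀).open_target).2 fun K hKU hK => ?_
    refine ((h.locInt x₀).integrableOn_compact_subset hKU hK).congr_fun_ae ?_
    filter_upwards [ae_restrict_mem hK.measurableSet, ae_restrict_of_ae h1] with y hy hy'
    exact (hy' (hKU hy)).symm
  · refine (h.hasWeakDeriv x₀ i).congr (chartAt 𝔼 x₀).open_target ?_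
    filter_upwards [h1, h2] with y hy hy' hyU
    exact ⟨hy hyU, by rw [hy' hyU]⟩

variable [SecondCountableTopology M]

/-- Weak derivatives are unique in each chart, the finitely many components determine a tangent
vector, and countably many charts cover. -/
lemma ae_unique (h : IsWeakGrad f X) (h' : IsWeakGrad f X') :
    ∀ᵐ p ∂riemVol n M, X p = X' p := by
  refine ae_of_ae_chart fun x₀ => ?_
  have hm : MeasurableSet (chartAt 𝔼 x₀).target := (chartAt 𝔼 x₀).open_target.measurableSet
  have h1 := ae_all_iff.2 fun i => ((h.hasWeakDeriv x₀ i).ae_unique (chartAt 𝔼 x₀).open_target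
    (h'.hasWeakDeriv x₀ i))
  filter_upwards [ae_restrict_mem hm, ae_restrict_of_ae h1] with y hy hy'
  obtain ⟨C, hC, hb⟩ := exists_norm_coord_bounds x₀ (isCompact_singleton (x := y))
    (singleton_subset_iff.2 hy)
  have h2 := (hb y rfl (X ((chartAt 𝔼 x₀).symm y) - X' ((chartAt 𝔼 x₀).symm y))).2
  simp only [inner_sub_left, hy' _ hy, sub_self, abs_zero, Finset.sum_const_zero, mul_zero] at h2
  exact sub_eq_zero.1 (norm_le_zero_iff.1 h2)

/-- Applied to a difference, this is the locality of the gradient: functions that agree on a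
measurable set have equal gradients almost everywhere on it, with no openness required. -/
lemma ae_eq_zero_of_eq_zero (h : IsWeakGrad f X) :
    ∀ᵐ p ∂riemVol n M, f p = 0 → X p = 0 := by
  refine ae_of_ae_chart fun x₀ => ?_
  have hm : MeasurableSet (chartAt 𝔼 x₀).target := (chartAt 𝔼 x₀).open_target.measurableSet
  have h1 := ae_all_iff.2 fun i => ((h.hasWeakDeriv x₀ i).ae_eq_zero_of_eq_zero
    (chartAt 𝔼 x₀).open_target)
  filter_upwards [ae_restrict_mem hm, ae_restrict_of_ae h1] with y hy hy' h0
  obtain ⟨C, hC, hb⟩ := exists_norm_coord_bounds x₀ (isCompact_singleton (x := y))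
    (singleton_subset_iff.2 hy)
  have h2 := (hb y rfl (X ((chartAt 𝔼 x₀).symm y))).2
  simp only [hy' _ hy h0, abs_zero, Finset.sum_const_zero, mul_zero] at h2
  exact norm_le_zero_iff.1 h2

lemma ae_eq_weakGrad (h : IsWeakGrad f X) : ∀ᵐ p ∂riemVol n M, weakGrad f p = X p := by
  have hf : HasWeakGrad n f := ⟨X, h⟩
  have := hf.choose_spec.ae_unique h
  filter_upwards [this] with p hp
  rw [weakGrad, dif_pos hf, hp]

lemma gradLen_ae_eq (h : IsWeakGrad f X) : gradLen n f =ᵐ[riemVol n M] fun p => ‖X p‖ := by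
  filter_upwards [h.ae_eq_weakGrad] with p hp
  rw [gradLen, hp]

end IsWeakGrad

lemma HasWeakGrad.isWeakGrad {f : M → ℝ} (h : HasWeakGrad n f) :
    IsWeakGrad f (fun p => (weakGrad f p : TangentSpace (𝓡 n) p)) := by
  have : (fun p => (weakGrad f p : TangentSpace (𝓡 n) p)) = h.choose := by
    funext p
    rw [weakGrad, dif_pos h]
  rw [this]
  exact h.choose_spec

/-- A function with locally Lipschitz chart representatives has a weak gradient. -/
lemma isWeakGrad_grad {f : M → ℝ} (hf : ∀ x₀ : M, LocallyLipschitzOn (chartAt 𝔼 x₀).target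
    fun y => f ((chartAt 𝔼 x₀).symm y)) :
    IsWeakGrad f (fun p => (grad f p : TangentSpace (𝓡 n) p)) := by
  refine isWeakGrad_iff.2 fun x₀ => ?_
  have hU := (chartAt 𝔼 x₀).open_target
  refine ⟨(hf x₀).continuousOn.locallyIntegrableOn hU.measurableSet, fun i => ?_⟩
  refine (hasWeakDeriv_of_locallyLipschitzOn hU (hf x₀) _).congr hU ?_
  filter_upwards [ae_differentiableAt_of_locallyLipschitzOn hU (hf x₀)] with y hy hyU
  refine ⟨rfl, ?_⟩
  rw [← frame_single, inner_grad_frame f x₀ hyU (hy hyU)]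

lemma isWeakGrad_grad_of_contMDiff {f : M → ℝ} (hf : ContMDiff (𝓡 n) 𝓘(ℝ, ℝ) ∞ f) :
    IsWeakGrad f (fun p => (grad f p : TangentSpace (𝓡 n) p)) := by
  refine isWeakGrad_grad fun x₀ y hy => ?_
  have h1 : ContMDiffAt 𝓘(ℝ, 𝔼) 𝓘(ℝ, ℝ) ∞ (fun y => f ((chartAt 𝔼 x₀).symm y)) y :=
    hf.contMDiffAt.comp y ((contMDiffOn_chart_symm (I := 𝓡 n) (n := ∞) (x := x₀)).contMDiffAt
      ((chartAt 𝔼 x₀).open_target.mem_nhds hy))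
  obtain ⟨K, t, ht, hK⟩ := (h1.contDiffAt.of_le (by simp)).exists_lipschitzOnWith
  exact ⟨K, t, mem_nhdsWithin_of_mem_nhds ht, hK⟩

lemma isWeakGrad_const (c : ℝ) : IsWeakGrad (fun _ : M => c)
    (fun p => (0 : TangentSpace (𝓡 n) p)) := by
  have h : IsWeakGrad (fun _ : M => c) (fun p => (grad (fun _ : M => c) p : TangentSpace (𝓡 n) p)) :=
    isWeakGrad_grad_of_contMDiff contMDiff_const
  have h0 : (fun p => (grad (fun _ : M => c) p : TangentSpace (𝓡 n) p)) = fun p => 0 := by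
    funext p
    refine ext_inner_right ℝ fun v => ?_
    rw [inner_grad, mfderiv_const, inner_zero_left]
    rfl
  rwa [h0] at h

section Measurability

variable [MeasurableSpace M] [BorelSpace M] [SecondCountableTopology M]

lemma aemeasurable_of_chart {β : Type*} [MeasurableSpace β] {F : M → β}
    (h : ∀ x₀ : M, AEMeasurable (fun y => F ((chartAt 𝔼 x₀).symm y))
      (volume.restrict (chartAt 𝔼 x₀).target)) : AEMeasurable F (riemVol n M) := by
  obtain ⟨s, hs, hsu⟩ := TopologicalSpace.countable_cover_nhds
    (fun x : M => (chartAt 𝔼 x).open_source.mem_nhds (mem_chart_source 𝔼 x))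
  have : Countable s := hs.to_subtype
  have h1 : AEMeasurable F ((riemVol n M).restrict (⋃ x : s, (chartAt 𝔼 (x : M)).source)) := by
    refine AEMeasurable.iUnion fun x => ?_
    obtain ⟨g, hg, hgF⟩ := h x
    set e := chartAt 𝔼 (x : M)
    have hcm : AEMeasurable e ((riemVol n M).restrict e.source) :=
      e.continuousOn.aemeasurable e.open_source.measurableSet
    have hg' : AEMeasurable (fun p => g (e p)) ((riemVol n M).restrict e.source) :=
      hg.comp_aemeasurable hcm
    refine hg'.congr ?_
    have h2 : ∀ᵐ p ∂(riemVol n M).restrict e.source, p ∈ e.source ∧ g (e p) = F p := by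
      refine (ae_restrict_source_iff (x : M)).2 ?_
      filter_upwards [ae_restrict_mem e.open_target.measurableSet, hgF] with y hy hy'
      exact ⟨e.map_target hy, by rw [e.right_inv hy]; exact hy'.symm⟩
    filter_upwards [h2] with p hp using hp.2
  have h2 : (⋃ x : s, (chartAt 𝔼 (x : M)).source) = univ := by
    rw [← hsu, biUnion_eq_iUnion]
  rwa [h2, Measure.restrict_univ] at h1

lemma IsWeakGrad.aemeasurable {f : M → ℝ} {X : ∀ x : M, TangentSpace (𝓡 n) x}
    (h : IsWeakGrad f X) : AEMeasurable f (riemVol n M) :=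
  aemeasurable_of_chart fun x₀ => (h.locInt x₀).aestronglyMeasurable.aemeasurable

lemma IsWeakGrad.aemeasurable_norm {f : M → ℝ} {X : ∀ x : M, TangentSpace (𝓡 n) x}
    (h : IsWeakGrad f X) : AEMeasurable (fun p => ‖X p‖) (riemVol n M) :=
  aemeasurable_of_chart fun x₀ => aemeasurable_norm_of_coord x₀
    (chartAt 𝔼 x₀).open_target.measurableSet subset_rfl X fun i =>
      (h.hasWeakDeriv x₀ i).locInt_deriv.aestronglyMeasurable.aemeasurable

lemma HasWeakGrad.aemeasurable_gradLen {f : M → ℝ} (h : HasWeakGrad n f) :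
    AEMeasurable (gradLen n f) (riemVol n M) :=
  h.isWeakGrad.aemeasurable_norm

end Measurability

/-- Product rule with a function that is locally Lipschitz in charts. -/
lemma IsWeakGrad.lipschitz_mul {f : M → ℝ} {X : ∀ x : M, TangentSpace (𝓡 n) x}
    (h : IsWeakGrad f X) {η : M → ℝ} (hη : ∀ x₀ : M, LocallyLipschitzOn (chartAt 𝔼 x₀).target
      fun y => η ((chartAt 𝔼 x₀).symm y)) :
    IsWeakGrad (fun p => η p * f p)
      (fun p => η p • X p + f p • (grad η p : TangentSpace (𝓡 n) p)) := by
  refine isWeakGrad_iff.2 fun x₀ => ?_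
  have hU := (chartAt 𝔼 x₀).open_target
  refine ⟨?_, fun i => ?_⟩
  · refine (locallyIntegrableOn_iff_compact hU).2 fun K hKU hK => ?_
    exact ((h.locInt x₀).integrableOn_compact_subset hKU hK).continuousOn_mul
      ((hη x₀).continuousOn.mono hKU) hK
  · refine ((h.hasWeakDeriv x₀ i).lipschitz_mul hU (hη x₀)).congr hU ?_
    filter_upwards [ae_differentiableAt_of_locallyLipschitzOn hU (hη x₀)] with y hy hyU
    refine ⟨rfl, ?_⟩
    rw [inner_add_left, real_inner_smul_left, real_inner_smul_left,
      ← frame_single x₀ y i, inner_grad_frame η x₀ hyU (hy hyU)]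
    ring

section Lipschitz

variable [IsRiemannianManifold (𝓡 n) M]

lemma isWeakGrad_grad_of_lipschitz {f : M → ℝ} {L : ℝ≥0} (hf : LipschitzWith L f) :
    IsWeakGrad f (fun p => (grad f p : TangentSpace (𝓡 n) p)) :=
  isWeakGrad_grad fun x₀ => locallyLipschitzOn_comp_chart_symm hf.locallyLipschitz x₀

end Lipschitz

end WeakGrad

/-! ### Smooth approximation inside one chart -/

section ChartApprox

variable {n : ℕ} {M : Type*} [MetricSpace M] [ChartedSpace (EuclideanSpace ℝ (Fin n)) M]
  [IsManifold (𝓡 n) ∞ M]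
  [RiemannianBundle (fun x : M => TangentSpace (𝓡 n) x)]
  [IsContMDiffRiemannianBundle (𝓡 n) ∞ (EuclideanSpace ℝ (Fin n))
    (fun x : M => TangentSpace (𝓡 n) x)]
  [MeasurableSpace M] [BorelSpace M] [SecondCountableTopology M]

local notation "𝔼" => EuclideanSpace ℝ (Fin n)

/-- On compact sets of a chart the `L_q` norms for the Riemannian measure and for Lebesgue measure
are equivalent. -/
lemma exists_eLpNorm_chart_bounds (x₀ : M) {S : Set 𝔼} (hS : IsCompact S)
    (hSt : S ⊆ (chartAt 𝔼 x₀).target) {q : ℝ} (hq : 0 < q) :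
    ∃ C : ℝ≥0, ∀ F : M → ℝ, AEMeasurable F (riemVol n M) →
      eLpNorm F (ENNReal.ofReal q) ((riemVol n M).restrict ((chartAt 𝔼 x₀).symm '' S)) ≤
        C * eLpNorm (fun y => F ((chartAt 𝔼 x₀).symm y)) (ENNReal.ofReal q) (volume.restrict S) ∧
      eLpNorm (fun y => F ((chartAt 𝔼 x₀).symm y)) (ENNReal.ofReal q) (volume.restrict S) ≤
        C * eLpNorm F (ENNReal.ofReal q) ((riemVol n M).restrict ((chartAt 𝔼 x₀).symm '' S)) := by
  obtain ⟨C, hC, hb⟩ := exists_density_bounds x₀ hS hSt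
  set e := chartAt 𝔼 x₀ with he
  have hq0 : ENNReal.ofReal q ≠ 0 := by simpa using hq
  have hSc : IsCompact (e.symm '' S) := hS.image_of_continuousOn (e.continuousOn_symm.mono hSt)
  have hSs : e.symm '' S ⊆ e.source := by
    rintro _ ⟨y, hy, rfl⟩
    exact e.map_target (hSt hy)
  have hpre : e.target ∩ e.symm ⁻¹' (e.symm '' S) = S := by
    ext y
    constructor
    · rintro ⟨hy, z, hz, hzy⟩
      rwa [← e.symm.injOn (hSt hz) hy hzy]
    · exact fun hy => ⟨hSt hy, y, hy, rfl⟩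
  have key : ∀ F : M → ℝ, AEMeasurable F (riemVol n M) →
      ∫⁻ p in e.symm '' S, ‖F p‖ₑ ^ q ∂riemVol n M =
        ∫⁻ y in S, chartDensity x₀ y * ‖F (e.symm y)‖ₑ ^ q := by
    intro F hF
    have := setLIntegral_source x₀ (fun p => ‖F p‖ₑ ^ q) (hF.enorm.pow_const q) hSc.measurableSet
      hSs
    rwa [← he, hpre] at this
  refine ⟨C ^ (1 / q), fun F hF => ?_⟩
  rw [eLpNorm_eq_lintegral_rpow_enorm_toReal hq0 ENNReal.ofReal_ne_top,
    eLpNorm_eq_lintegral_rpow_enorm_toReal hq0 ENNReal.ofReal_ne_top,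
    ENNReal.toReal_ofReal hq.le, key F hF, ENNReal.coe_rpow_of_nonneg C (by positivity : (0:ℝ) ≤ 1 / q)]
  rw [← ENNReal.mul_rpow_of_nonneg _ _ (by positivity), ← ENNReal.mul_rpow_of_nonneg _ _ (by positivity),
    ← lintegral_const_mul' _ _ ENNReal.coe_ne_top, ← lintegral_const_mul' _ _ ENNReal.coe_ne_top]
  constructor
  · refine ENNReal.rpow_le_rpow (setLIntegral_mono' hS.measurableSet fun y hy => ?_) (by positivity)
    gcongr
    exact (hb y hy).1
  · refine ENNReal.rpow_le_rpow (setLIntegral_mono' hS.measurableSet fun y hy => ?_) (by positivity)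
    rw [← mul_assoc]
    exact le_mul_of_one_le_left' (hb y hy).2

/-- `f`, with weak gradient `X`, is a limit of compactly supported smooth functions in the Sobolev
norm of exponent `q`. -/
structure SmoothApprox (q : ℝ) (f : M → ℝ) (X : ∀ x : M, TangentSpace (𝓡 n) x) : Prop where
  isWeakGrad : IsWeakGrad f X
  exists_approx : ∀ ε : ℝ≥0∞, 0 < ε → ∃ φ : M → ℝ, ContMDiff (𝓡 n) 𝓘(ℝ, ℝ) ∞ φ ∧
    HasCompactSupport φ ∧ eLpNorm (fun p => φ p - f p) (ENNReal.ofReal q) (riemVol n M) +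
      eLpNorm (fun p => ‖(grad φ p - X p : TangentSpace (𝓡 n) p)‖) (ENNReal.ofReal q)
        (riemVol n M) ≤ ε

/-- Extension by zero of a smooth function with compact support in a chart. -/
lemma contMDiff_chart_extend (x₀ : M) {w : 𝔼 → ℝ} (hw : ContDiff ℝ ∞ w) {S : Set 𝔼}
    (hS : IsCompact S) (hSt : S ⊆ (chartAt 𝔼 x₀).target) (hwS : ∀ y, y ∉ S → w y = 0) :
    ContMDiff (𝓡 n) 𝓘(ℝ, ℝ) ∞
        ((chartAt 𝔼 x₀).source.indicator fun p => w (chartAt 𝔼 x₀ p)) ∧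
      ∀ p, p ∉ (chartAt 𝔼 x₀).symm '' S →
        (chartAt 𝔼 x₀).source.indicator (fun p => w (chartAt 𝔼 x₀ p)) p = 0 := by
  set e := chartAt 𝔼 x₀ with he
  have hzero : ∀ p, p ∉ e.symm '' S → e.source.indicator (fun p => w (e p)) p = 0 := by
    intro p hp
    by_cases hps : p ∈ e.source
    · rw [indicator_of_mem hps]
      exact hwS _ fun h => hp ⟨e p, h, e.left_inv hps⟩
    · exact indicator_of_notMem hps _
  have hSc : IsCompact (e.symm '' S) := hS.image_of_continuousOn (e.continuousOn_symm.mono hSt)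
  refine ⟨fun p => ?_, hzero⟩
  by_cases hp : p ∈ e.source
  · have h1 : ContMDiffAt (𝓡 n) 𝓘(ℝ, ℝ) ∞ (fun p => w (e p)) p :=
      hw.contMDiff.contMDiffAt.comp p ((contMDiffOn_chart (I := 𝓡 n) (n := ∞) (x := x₀)).contMDiffAt
        (e.open_source.mem_nhds hp))
    refine h1.congr_of_eventuallyEq ?_
    filter_upwards [e.open_source.mem_nhds hp] with r hr
    exact indicator_of_mem hr _
  -- The support is the image of a compact set, hence closed in `M`; the extension vanishes near
  -- every point outside the chart domain.
  · have h1 : p ∉ e.symm '' S := fun ⟨y, hy, h⟩ => hp (h ▸ e.map_target (hSt hy))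
    refine (contMDiffAt_const (c := (0 : ℝ))).congr_of_eventuallyEq ?_
    filter_upwards [hSc.isClosed.isOpen_compl.mem_nhds h1] with r hr
    exact hzero r hr

/-- The gradient of a function vanishes where the function vanishes locally. -/
lemma grad_eq_zero_of_eventuallyEq {f : M → ℝ} {p : M} (h : f =ᶠ[𝓝 p] fun _ => 0) :
    (grad f p : TangentSpace (𝓡 n) p) = 0 := by
  refine ext_inner_right ℝ fun v => ?_
  rw [inner_grad, h.mfderiv_eq, mfderiv_const, inner_zero_left]
  rfl

/-- Read in the chart, `f` becomes a compactly supported function on Euclidean space with global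
weak derivatives; it is mollified there and extended by zero to `M`. All supports stay in a fixed
compact set, where Riemannian and Euclidean norms are equivalent. -/
lemma SmoothApprox.of_chart {q : ℝ} (hq : 1 ≤ q) {f : M → ℝ} {X : ∀ x : M, TangentSpace (𝓡 n) x}
    (h : IsWeakGrad f X) (x₀ : M) {K : Set M} (hK : IsCompact K)
    (hKs : K ⊆ (chartAt 𝔼 x₀).source) (hfK : ∀ p, p ∉ K → f p = 0)
    (hf : MemLp f (ENNReal.ofReal q) (riemVol n M))
    (hX : MemLp (fun p => ‖X p‖) (ENNReal.ofReal q) (riemVol n M)) : SmoothApprox q f X := by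
  have hq1 : 1 ≤ ENNReal.ofReal q := by simpa using ENNReal.ofReal_le_ofReal hq
  set e := chartAt 𝔼 x₀ with he
  set μ := riemVol n M with hμ
  set Q := ENNReal.ofReal q with hQ
  set E : Fin n → 𝔼 := fun i => EuclideanSpace.single i (1 : ℝ) with hE
  have hU := e.open_target
  set K' := e '' K with hK'def
  have hK' : IsCompact K' := hK.image_of_continuousOn (e.continuousOn.mono hKs)
  have hK't : K' ⊆ e.target := by
    rintro _ ⟨p, hp, rfl⟩
    exact e.map_source (hKs hp)
  have hmemK : ∀ y ∈ e.target, y ∉ K' → e.symm y ∉ K := fun y hy hyK hc =>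
    hyK ⟨e.symm y, hc, e.right_inv hy⟩
  obtain ⟨δ, hδ, hδt⟩ := hK'.exists_cthickening_subset_open hU hK't
  set S := Metric.cthickening δ K' with hSdef
  have hS : IsCompact S := hK'.cthickening
  have hKS : K' ⊆ S := Metric.self_subset_cthickening _
  have hSc : IsCompact (e.symm '' S) := hS.image_of_continuousOn (e.continuousOn_symm.mono hδt)
  have hKS' : K ⊆ e.symm '' S := fun p hp => ⟨e p, hKS ⟨p, hp, rfl⟩, e.left_inv (hKs hp)⟩
  obtain ⟨χ, hχ, hχc, hχU, -, V, hV, hKV, hχ1⟩ := exists_smooth_cutoff hK' hU hK't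
  -- Multiplication by `χ` only removes the arbitrary values of the inverse chart outside its
  -- target; inside, `w` is `f` because `f` vanishes off `K`.
  set w : 𝔼 → ℝ := fun y => χ y * f (e.symm y) with hwdef
  set v : Fin n → 𝔼 → ℝ := fun i y => χ y * inner ℝ (X (e.symm y)) (coordVec x₀ y i) +
    fderiv ℝ χ y (E i) * f (e.symm y) with hvdef
  have hwv : ∀ i, HasWeakDeriv univ w (v i) (E i) := fun i =>
    (h.hasWeakDeriv x₀ i).smooth_mul isOpen_univ hχ (by simpa using hχU)
  have hw1 : ∀ y ∈ e.target, w y = f (e.symm y) := by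
    intro y hy
    by_cases hyK : y ∈ K'
    · simp [hwdef, hχ1 y (hKV hyK)]
    · simp [hwdef, hfK _ (hmemK y hy hyK)]
  have hw2 : ∀ y, y ∉ K' → w y = 0 := by
    intro y hyK
    by_cases hy : y ∈ e.target
    · rw [hw1 y hy, hfK _ (hmemK y hy hyK)]
    · simp [hwdef, image_eq_zero_of_notMem_tsupport fun h' => hy (hχU h')]
  -- Off `K` the function vanishes, hence so does `X` almost everywhere. Thus the Leibniz
  -- derivatives of `w` are the components of `X` on the whole target.
  have hXf : ∀ᵐ y, y ∈ e.target → f (e.symm y) = 0 → X (e.symm y) = 0 :=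
    (ae_restrict_iff' hU.measurableSet).1 (ae_chart_of_ae h.ae_eq_zero_of_eq_zero x₀)
  have hv1 : ∀ i, ∀ᵐ y, y ∈ e.target → v i y = inner ℝ (X (e.symm y)) (coordVec x₀ y i) := by
    intro i
    filter_upwards [hXf] with y hyX hy
    by_cases hyK : y ∈ K'
    · have h1 : χ =ᶠ[𝓝 y] fun _ => 1 := by
        filter_upwards [hV.mem_nhds (hKV hyK)] with z hz using hχ1 z hz
      simp [hvdef, hχ1 y (hKV hyK), h1.fderiv_eq]
    · have h1 := hfK _ (hmemK y hy hyK)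
      simp [hvdef, h1, hyX hy h1]
  have hv2 : ∀ i, ∀ᵐ y, y ∉ K' → v i y = 0 := by
    intro i
    filter_upwards [hXf, hv1 i] with y hyX hyv hyK
    by_cases hy : y ∈ e.target
    · rw [hyv hy, hyX hy (hfK _ (hmemK y hy hyK)), inner_zero_left]
    · have h1 : y ∉ tsupport χ := fun h' => hy (hχU h')
      have h2 : fderiv ℝ χ y = 0 :=
        image_eq_zero_of_notMem_tsupport fun h' => h1 (tsupport_fderiv_subset ℝ h')
      simp [hvdef, image_eq_zero_of_notMem_tsupport h1, h2]
  have hwi : Integrable w volume := by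
    simpa [hwdef, mul_comm] using integrable_mul_of_tsupport_subset (h.locInt x₀) hχ.continuous
      hχc hχU
  have hvl : ∀ i, LocallyIntegrable (v i) volume := fun i =>
    locallyIntegrableOn_univ.1 (hwv i).locInt_deriv
  have hSm := hS.measurableSet
  obtain ⟨C, hC⟩ := exists_eLpNorm_chart_bounds x₀ hS hδt (q := q) (by linarith)
  obtain ⟨D, hD, hDb⟩ := exists_norm_coord_bounds x₀ hS hδt
  have hwL : MemLp w Q volume := by
    refine ⟨hwi.aestronglyMeasurable, ?_⟩
    rw [← eLpNorm_restrict_eq_of_support_subset (s := S)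
      (Function.support_subset_iff'.2 fun y hy => hw2 y fun h' => hy (hKS h'))]
    have h1 : eLpNorm w Q (volume.restrict S) =
        eLpNorm (fun y => f (e.symm y)) Q (volume.restrict S) := by
      refine eLpNorm_congr_ae ?_
      filter_upwards [ae_restrict_mem hSm] with y hy using hw1 y (hδt hy)
    rw [h1]
    refine (hC f h.aemeasurable).2.trans_lt (ENNReal.mul_lt_top ENNReal.coe_lt_top ?_)
    exact (eLpNorm_mono_measure _ Measure.restrict_le_self).trans_lt hf.2
  have hvL : ∀ i, MemLp (v i) Q volume := by
    intro i
    refine ⟨(hvl i).aestronglyMeasurable, ?_⟩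
    have h0 : v i =ᵐ[volume] S.indicator (v i) := by
      filter_upwards [hv2 i] with y hy
      by_cases hyS : y ∈ S
      · rw [indicator_of_mem hyS]
      · rw [indicator_of_notMem hyS, hy fun h' => hyS (hKS h')]
    rw [eLpNorm_congr_ae h0, eLpNorm_indicator_eq_eLpNorm_restrict hSm]
    have h1 : eLpNorm (v i) Q (volume.restrict S) ≤
        eLpNorm (D • fun y => ‖X (e.symm y)‖) Q (volume.restrict S) := by
      refine eLpNorm_mono_ae_real ?_
      filter_upwards [ae_restrict_mem hSm, ae_restrict_of_ae (hv1 i)] with y hy hyv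
      rw [hyv (hδt hy)]
      exact (hDb y hy (X (e.symm y))).1 i
    refine h1.trans_lt ?_
    rw [eLpNorm_const_smul]
    refine ENNReal.mul_lt_top enorm_lt_top ?_
    refine (hC (fun p => ‖X p‖) h.aemeasurable_norm).2.trans_lt
      (ENNReal.mul_lt_top ENNReal.coe_lt_top ?_)
    exact (eLpNorm_mono_measure _ Measure.restrict_le_self).trans_lt hX.2
  have hlim : Tendsto (fun k => C * eLpNorm (fun y => mollify k w y - w y) Q volume +
      C * (‖D‖ₑ * ∑ i, eLpNorm (fun y => mollify k (v i) y - v i y) Q volume)) atTop (𝓝 0) := by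
    have h1 := ENNReal.Tendsto.const_mul (a := (C : ℝ≥0∞)) (mollify_tendsto_eLpNorm hq hwL)
      (Or.inr ENNReal.coe_ne_top)
    have h2 := tendsto_finsetSum Finset.univ fun i _ => mollify_tendsto_eLpNorm hq (hvL i)
    have h3 := ENNReal.Tendsto.const_mul (a := (C : ℝ≥0∞)) (ENNReal.Tendsto.const_mul (a := ‖D‖ₑ) h2
      (Or.inr enorm_ne_top)) (Or.inr ENNReal.coe_ne_top)
    simpa using h1.add h3
  refine ⟨h, fun ε hε => ?_⟩
  obtain ⟨k, hkε, hkδ⟩ := ((hlim.eventually (ge_mem_nhds hε)).and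
    ((tendsto_bumpSeq_rOut n).eventually (ge_mem_nhds hδ))).exists
  have hws : ContDiff ℝ ∞ (mollify k w) := mollify_contDiff k hwi.locallyIntegrable
  have hwS : ∀ y, y ∉ S → mollify k w y = 0 := fun y hy =>
    image_eq_zero_of_notMem_tsupport fun h' => hy (Metric.cthickening_mono hkδ _
      (mollify_tsupport_subset k (closure_minimal (Function.support_subset_iff'.2 hw2)
        hK'.isClosed) h'))
  obtain ⟨hφ, hφ0⟩ := contMDiff_chart_extend x₀ hws hS hδt hwS
  set φ := e.source.indicator fun p => mollify k w (e p) with hφdef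
  have hφe : ∀ y ∈ e.target, φ (e.symm y) = mollify k w y := fun y hy => by
    rw [hφdef, indicator_of_mem (e.map_target hy), e.right_inv hy]
  refine ⟨φ, hφ, HasCompactSupport.intro hSc hφ0, le_trans (add_le_add ?_ ?_) hkε⟩
  · rw [← eLpNorm_restrict_eq_of_support_subset (s := e.symm '' S)
      (Function.support_subset_iff'.2 fun p hp => by
        rw [hφ0 p hp, hfK p fun h' => hp (hKS' h'), sub_zero])]
    refine (hC (fun p => φ p - f p) (hφ.continuous.measurable.aemeasurable.sub h.aemeasurable)).1.trans ?_
    gcongr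
    refine le_trans (le_of_eq (eLpNorm_congr_ae ?_)) (eLpNorm_mono_measure _ Measure.restrict_le_self)
    filter_upwards [ae_restrict_mem hSm] with y hy
    rw [hφe y (hδt hy), hw1 y (hδt hy)]
  · have hφX := (isWeakGrad_grad_of_contMDiff hφ).sub h
    have h0 : (fun p => ‖(grad φ p - X p : TangentSpace (𝓡 n) p)‖) =ᵐ[μ]
        (e.symm '' S).indicator fun p => ‖(grad φ p - X p : TangentSpace (𝓡 n) p)‖ := by
      filter_upwards [h.ae_eq_zero_of_eq_zero] with p hp
      by_cases hpS : p ∈ e.symm '' S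
      · rw [indicator_of_mem hpS]
      · rw [indicator_of_notMem hpS, hp (hfK p fun h' => hpS (hKS' h')), sub_zero,
          grad_eq_zero_of_eventuallyEq, norm_zero]
        filter_upwards [hSc.isClosed.isOpen_compl.mem_nhds hpS] with r hr using hφ0 r hr
    rw [eLpNorm_congr_ae h0, eLpNorm_indicator_eq_eLpNorm_restrict hSc.measurableSet]
    refine (hC _ hφX.aemeasurable_norm).1.trans ?_
    gcongr
    have h1 : eLpNorm (fun y => ‖(grad φ (e.symm y) - X (e.symm y) : TangentSpace (𝓡 n) (e.symm y))‖) Q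
        (volume.restrict S) ≤ eLpNorm (D • ∑ i, fun y => |mollify k (v i) y - v i y|) Q
          (volume.restrict S) := by
      refine eLpNorm_mono_ae_real ?_
      filter_upwards [ae_restrict_mem hSm, ae_restrict_of_ae (ae_all_iff.2 hv1)] with y hy hyv
      rw [norm_norm]
      refine (hDb y hy _).2.trans_eq ?_
      simp only [Pi.smul_apply, Finset.sum_apply, smul_eq_mul]
      congr 1
      refine Finset.sum_congr rfl fun i _ => ?_
      have h2 : (fun y => φ (e.symm y)) =ᶠ[𝓝 y] mollify k w := by
        filter_upwards [hU.mem_nhds (hδt hy)] with z hz using hφe z hz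
      rw [inner_sub_left, hyv i (hδt hy), ← fderiv_mollify (hwv i), ← h2.fderiv_eq, ← frame_single,
        inner_grad_frame φ x₀ (hδt hy)
          (((hws.differentiable (by simp)) y).congr_of_eventuallyEq h2)]
    refine h1.trans ?_
    rw [eLpNorm_const_smul]
    gcongr
    refine (eLpNorm_sum_le (fun i _ => ?_) hq1).trans (Finset.sum_le_sum fun i _ => ?_)
    · exact ((((mollify_contDiff k (hvl i)).continuous.aestronglyMeasurable).sub
        (hvl i).aestronglyMeasurable).norm).restrict
    · refine (eLpNorm_norm (fun y => mollify k (v i) y - v i y)).trans_le ?_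
      exact eLpNorm_mono_measure _ Measure.restrict_le_self

end ChartApprox

/-! ### Smooth approximation of compactly supported functions -/

section CompactApprox

variable {n : ℕ} {M : Type*} [MetricSpace M] [ChartedSpace (EuclideanSpace ℝ (Fin n)) M]
  [IsManifold (𝓡 n) ∞ M]
  [RiemannianBundle (fun x : M => TangentSpace (𝓡 n) x)]
  [IsContMDiffRiemannianBundle (𝓡 n) ∞ (EuclideanSpace ℝ (Fin n))
    (fun x : M => TangentSpace (𝓡 n) x)]

local notation "𝔼" => EuclideanSpace ℝ (Fin n)

lemma contDiffOn_comp_chart_symm {f : M → ℝ} (hf : ContMDiff (𝓡 n) 𝓘(ℝ, ℝ) ∞ f) (x₀ : M) :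
    ContDiffOn ℝ ∞ (fun y => f ((chartAt 𝔼 x₀).symm y)) (chartAt 𝔼 x₀).target := by
  have h : ContMDiffOn 𝓘(ℝ, 𝔼) 𝓘(ℝ, ℝ) ∞ (fun y => f ((chartAt 𝔼 x₀).symm y))
      (chartAt 𝔼 x₀).target :=
    hf.comp_contMDiffOn (contMDiffOn_chart_symm (I := 𝓡 n) (n := ∞) (x := x₀))
  exact h.contDiffOn

lemma exists_norm_grad_le {f : M → ℝ} (hf : ContMDiff (𝓡 n) 𝓘(ℝ, ℝ) ∞ f) (x₀ : M) {K : Set M}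
    (hK : IsCompact K) (hKs : K ⊆ (chartAt 𝔼 x₀).source) :
    ∃ C : ℝ, 0 ≤ C ∧ ∀ p ∈ K, ‖(grad f p : TangentSpace (𝓡 n) p)‖ ≤ C := by
  set e := chartAt 𝔼 x₀ with he
  have hK' : IsCompact (e '' K) := hK.image_of_continuousOn (e.continuousOn.mono hKs)
  have hK't : e '' K ⊆ e.target := by
    rintro _ ⟨p, hp, rfl⟩
    exact e.map_source (hKs hp)
  obtain ⟨D, hD, hDb⟩ := exists_norm_coord_bounds x₀ hK' hK't
  have hs := contDiffOn_comp_chart_symm hf x₀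
  have hc : ContinuousOn (fun y => ∑ i, |fderiv ℝ (fun y => f (e.symm y)) y
      (EuclideanSpace.single i (1 : ℝ))|) (e '' K) := by
    refine continuousOn_finsetSum _ fun i _ => ContinuousOn.abs ?_
    exact ((hs.continuousOn_fderiv_of_isOpen e.open_target (by simp)).mono hK't).clm_apply
      continuousOn_const
  obtain ⟨C, hC⟩ := hK'.bddAbove_image hc
  refine ⟨D * max C 0, by positivity, fun p hp => ?_⟩
  have hpK : e p ∈ e '' K := ⟨p, hp, rfl⟩
  have h1 : ∀ r, e.symm (e p) = r → ‖(grad f r : TangentSpace (𝓡 n) r)‖ ≤ D * max C 0 := by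
    rintro _ rfl
    refine (hDb _ hpK _).2.trans (mul_le_mul_of_nonneg_left ?_ hD.le)
    refine le_trans (le_of_eq ?_) ((hC ⟨e p, hpK, rfl⟩).trans (le_max_left _ _))
    refine Finset.sum_congr rfl fun i _ => ?_
    rw [← frame_single, inner_grad_frame f x₀ (hK't hpK)
      ((hs.contDiffAt (e.open_target.mem_nhds (hK't hpK))).differentiableAt (by simp))]
  exact h1 p (e.left_inv (hKs hp))

variable [MeasurableSpace M] [BorelSpace M] [SecondCountableTopology M]

namespace SmoothApprox

variable {q : ℝ} {f f' : M → ℝ} {X X' : ∀ x : M, TangentSpace (𝓡 n) x}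

lemma congr_grad (h : SmoothApprox q f X) (h' : IsWeakGrad f X') : SmoothApprox q f X' := by
  refine ⟨h', fun ε hε => ?_⟩
  obtain ⟨φ, hφ, hφc, hφε⟩ := h.exists_approx ε hε
  refine ⟨φ, hφ, hφc, le_of_eq_of_le ?_ hφε⟩
  congr 1
  refine eLpNorm_congr_ae ?_
  filter_upwards [h.isWeakGrad.ae_unique h'] with p hp
  rw [hp]

lemma add (hq : 1 ≤ q) (h : SmoothApprox q f X) (h' : SmoothApprox q f' X') :
    SmoothApprox q (fun p => f p + f' p) (fun p => X p + X' p) := by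
  have hq1 : 1 ≤ ENNReal.ofReal q := by simpa using ENNReal.ofReal_le_ofReal hq
  refine ⟨h.isWeakGrad.add h'.isWeakGrad, fun ε hε => ?_⟩
  obtain ⟨φ, hφ, hφc, hφε⟩ := h.exists_approx (ε / 2) (ENNReal.half_pos hε.ne')
  obtain ⟨φ', hφ', hφc', hφε'⟩ := h'.exists_approx (ε / 2) (ENNReal.half_pos hε.ne')
  have hg := isWeakGrad_grad_of_contMDiff hφ
  have hg' := isWeakGrad_grad_of_contMDiff hφ'
  have hs : ContMDiff (𝓡 n) 𝓘(ℝ, ℝ) ∞ (fun p => φ p + φ' p) := hφ.add hφ'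
  refine ⟨fun p => φ p + φ' p, hs, hφc.add hφc', ?_⟩
  refine le_trans (add_le_add (b := eLpNorm (fun p => φ p - f p) (ENNReal.ofReal q) (riemVol n M) +
    eLpNorm (fun p => φ' p - f' p) (ENNReal.ofReal q) (riemVol n M)) (d :=
    eLpNorm (fun p => ‖(grad φ p - X p : TangentSpace (𝓡 n) p)‖) (ENNReal.ofReal q) (riemVol n M) +
    eLpNorm (fun p => ‖(grad φ' p - X' p : TangentSpace (𝓡 n) p)‖) (ENNReal.ofReal q)
      (riemVol n M)) ?_ ?_)
    ((add_add_add_comm _ _ _ _).trans_le ((add_le_add hφε hφε').trans_eq (ENNReal.add_halves ε)))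
  · refine le_trans (le_of_eq (congrArg (fun u => eLpNorm u _ _) ?_)) (eLpNorm_add_le
      (hg.sub h.isWeakGrad).aemeasurable.aestronglyMeasurable
      (hg'.sub h'.isWeakGrad).aemeasurable.aestronglyMeasurable hq1)
    funext p
    simp only [Pi.add_apply]
    ring
  · refine le_trans (eLpNorm_mono_ae_real ?_) (eLpNorm_add_le
      (hg.sub h.isWeakGrad).aemeasurable_norm.aestronglyMeasurable
      (hg'.sub h'.isWeakGrad).aemeasurable_norm.aestronglyMeasurable hq1)
    filter_upwards [(isWeakGrad_grad_of_contMDiff hs).ae_unique (hg.add hg')] with p hp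
    rw [norm_norm, hp, add_sub_add_comm]
    exact norm_add_le _ _

lemma zero : SmoothApprox q (fun _ : M => 0) (fun p => (0 : TangentSpace (𝓡 n) p)) := by
  refine ⟨isWeakGrad_const 0, fun ε _ => ⟨fun _ => 0, contMDiff_const, HasCompactSupport.zero, ?_⟩⟩
  have h0 : (fun p => ‖(grad (fun _ : M => (0 : ℝ)) p - 0 : TangentSpace (𝓡 n) p)‖) = fun _ => 0 := by
    funext p
    rw [grad_eq_zero_of_eventuallyEq (Eventually.of_forall fun _ => rfl), sub_zero, norm_zero]
  rw [h0]
  simp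

lemma sum (hq : 1 ≤ q) {ι : Type*} (s : Finset ι) {F : ι → M → ℝ}
    {Y : ι → ∀ x : M, TangentSpace (𝓡 n) x} (h : ∀ i ∈ s, SmoothApprox q (F i) (Y i)) :
    SmoothApprox q (fun p => ∑ i ∈ s, F i p) (fun p => ∑ i ∈ s, Y i p) := by
  classical
  induction s using Finset.induction_on with
  | empty => simpa using zero
  | insert i s hi ih =>
    simp only [Finset.sum_insert hi]
    exact (h i (Finset.mem_insert_self i s)).add hq
      (ih fun j hj => h j (Finset.mem_insert_of_mem hj))

/-- Compactly supported Sobolev functions are limits of compactly supported smooth functions. -/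
lemma of_compact (hq : 1 ≤ q) (h : IsWeakGrad f X) {K : Set M} (hK : IsCompact K)
    (hfK : ∀ p, p ∉ K → f p = 0) (hf : MemLp f (ENNReal.ofReal q) (riemVol n M))
    (hX : MemLp (fun p => ‖X p‖) (ENNReal.ofReal q) (riemVol n M)) : SmoothApprox q f X := by
  have : LocallyCompactSpace M := ChartedSpace.locallyCompactSpace 𝔼 M
  obtain ⟨t, -, ht⟩ := hK.elim_nhds_subcover (fun x : M => (chartAt 𝔼 x).source)
    fun x _ => (chartAt 𝔼 x).open_source.mem_nhds (mem_chart_source 𝔼 x)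
  obtain ⟨ρ, hρ⟩ := SmoothPartitionOfUnity.exists_isSubordinate (𝓡 n) hK.isClosed
    (fun i : t => (chartAt 𝔼 (i : M)).source) (fun i => (chartAt 𝔼 (i : M)).open_source)
    (by rwa [iUnion_subtype])
  have hρs : ∀ i, ContMDiff (𝓡 n) 𝓘(ℝ, ℝ) ∞ (ρ i) := fun i => (ρ i).contMDiff
  have hρ1 : ∀ i p, ‖ρ i p‖ ≤ 1 := fun i p => by
    rw [Real.norm_of_nonneg (ρ.nonneg i p)]
    exact ρ.le_one i p
  have hρl : ∀ i x₀, LocallyLipschitzOn (chartAt 𝔼 x₀).target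
      fun y => ρ i ((chartAt 𝔼 x₀).symm y) := by
    intro i x₀ y hy
    obtain ⟨C, s, hs, hC⟩ := (((contDiffOn_comp_chart_symm (hρs i) x₀).contDiffAt
      ((chartAt 𝔼 x₀).open_target.mem_nhds hy)).of_le (by simp)).exists_lipschitzOnWith
    exact ⟨C, s, mem_nhdsWithin_of_mem_nhds hs, hC⟩
  have hi : ∀ i ∈ Finset.univ, SmoothApprox q (fun p => ρ i p * f p)
      (fun p => ρ i p • X p + f p • (grad (ρ i) p : TangentSpace (𝓡 n) p)) := by
    intro i _
    -- Each piece `ρ i * f` lives on a compact part of one chart domain, where the gradient of `ρ i`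
    -- is bounded, so the product rule keeps it in the Sobolev space.
    have hKi : IsCompact (K ∩ tsupport (ρ i)) := hK.inter_right (isClosed_tsupport _)
    have hKis : K ∩ tsupport (ρ i) ⊆ (chartAt 𝔼 (i : M)).source := inter_subset_right.trans (hρ i)
    have hw := h.lipschitz_mul (hρl i)
    obtain ⟨C, hC0, hC⟩ := exists_norm_grad_le (hρs i) (i : M) hKi hKis
    refine of_chart hq hw (i : M) hKi hKis (fun p hp => ?_) ?_ ?_
    · by_cases hpK : p ∈ K
      · rw [image_eq_zero_of_notMem_tsupport fun h' => hp ⟨hpK, h'⟩, zero_mul]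
      · rw [hfK p hpK, mul_zero]
    · refine hf.of_le hw.aemeasurable.aestronglyMeasurable (Eventually.of_forall fun p => ?_)
      rw [norm_mul]
      exact mul_le_of_le_one_left (norm_nonneg _) (hρ1 i p)
    · refine (hX.add (hf.norm.const_mul C)).mono' hw.aemeasurable_norm.aestronglyMeasurable
        (Eventually.of_forall fun p => ?_)
      rw [norm_norm]
      refine (norm_add_le _ _).trans (add_le_add ?_ ?_)
      · rw [norm_smul]
        exact mul_le_of_le_one_left (norm_nonneg _) (hρ1 i p)
      · rw [norm_smul, mul_comm]
        by_cases hpK : p ∈ K ∩ tsupport (ρ i)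
        · exact mul_le_mul_of_nonneg_right (hC p hpK) (norm_nonneg _)
        · by_cases hpK' : p ∈ K
          · rw [grad_eq_zero_of_eventuallyEq (notMem_tsupport_iff_eventuallyEq.1
              fun h' => hpK ⟨hpK', h'⟩)]
            simp only [norm_zero, zero_mul]
            exact mul_nonneg hC0 (norm_nonneg _)
          · simp [hfK p hpK']
  have hsum := sum hq Finset.univ hi
  have h0 : (fun p => ∑ i, ρ i p * f p) = f := by
    funext p
    rw [← Finset.sum_mul]
    by_cases hp : p ∈ K
    · rw [← finsum_eq_sum_of_fintype, ρ.sum_eq_one hp, one_mul]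
    · rw [hfK p hp, mul_zero]
  rw [h0] at hsum
  exact hsum.congr_grad h

end SmoothApprox

end CompactApprox

lemma measure_ball_two_pow_le {M : Type*} [MetricSpace M] [MeasurableSpace M] {μ : Measure M}
    {C : ℝ≥0} (hC : ∀ (x : M) (r : ℝ), 0 < r →
    μ (Metric.ball x (2 * r)) ≤ C * μ (Metric.ball x r)) (x : M) {r : ℝ}
    (hr : 0 < r) (k : ℕ) :
    μ (Metric.ball x (2 ^ k * r)) ≤ C ^ k * μ (Metric.ball x r) := by
  induction k with
  | zero => simp
  | succ k ih =>
    calc _ = μ (Metric.ball x (2 * (2 ^ k * r))) := by congr 2; ring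
      _ ≤ C * μ (Metric.ball x (2 ^ k * r)) := hC x _ (by positivity)
      _ ≤ C * (C ^ k * μ (Metric.ball x r)) := by gcongr
      _ = _ := by ring

/-! ### Doubling, finiteness of balls and properness -/

section Doubling

variable {n : ℕ} {M : Type*} [MetricSpace M] [ChartedSpace (EuclideanSpace ℝ (Fin n)) M]
  [IsManifold (𝓡 n) ∞ M]
  [RiemannianBundle (fun x : M => TangentSpace (𝓡 n) x)]
  [IsContMDiffRiemannianBundle (𝓡 n) ∞ (EuclideanSpace ℝ (Fin n))
    (fun x : M => TangentSpace (𝓡 n) x)]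
  [MeasurableSpace M] [BorelSpace M]

local notation "𝔼" => EuclideanSpace ℝ (Fin n)

/-- The density is bounded on a compact coordinate neighbourhood. -/
instance isLocallyFiniteMeasure_riemVol : IsLocallyFiniteMeasure (riemVol n M) := by
  refine ⟨fun x₀ => ?_⟩
  set e := chartAt 𝔼 x₀ with he
  have hx : x₀ ∈ e.source := mem_chart_source 𝔼 x₀
  obtain ⟨S, hSn, hSt, hS⟩ := LocallyCompactSpace.local_compact_nhds (e x₀) e.target
    (e.open_target.mem_nhds (e.map_source hx))
  have hSc : IsCompact (e.symm '' S) := hS.image_of_continuousOn (e.continuousOn_symm.mono hSt)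
  have hSs : e.symm '' S ⊆ e.source := by
    rintro _ ⟨y, hy, rfl⟩
    exact e.map_target (hSt hy)
  have hpre : e.target ∩ e.symm ⁻¹' (e.symm '' S) ⊆ S := by
    rintro y ⟨hy, z, hz, hzy⟩
    rwa [← e.symm.injOn (hSt hz) hy hzy]
  refine ⟨e.symm '' S, ?_, ?_⟩
  · filter_upwards [e.open_source.mem_nhds hx, (e.continuousAt hx).preimage_mem_nhds hSn] with p hp hpS
    exact ⟨e p, hpS, e.left_inv hp⟩
  · obtain ⟨C, hC, hb⟩ := exists_density_bounds x₀ hS hSt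
    have h1 := setLIntegral_source x₀ (fun _ => 1) aemeasurable_const hSc.measurableSet hSs
    simp only [lintegral_const, Measure.restrict_apply MeasurableSet.univ, univ_inter, one_mul,
      mul_one] at h1
    rw [h1]
    calc _ ≤ ∫⁻ y in S, chartDensity x₀ y := lintegral_mono_set hpre
      _ ≤ ∫⁻ _ in S, C := setLIntegral_mono' hS.measurableSet fun y hy => (hb y hy).1
      _ < ⊤ := by
        rw [setLIntegral_const]
        exact ENNReal.mul_lt_top ENNReal.coe_lt_top hS.measure_lt_top

instance isOpenPosMeasure_riemVol : (riemVol n M).IsOpenPosMeasure := by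
  refine ⟨fun U hU ⟨x₀, hx⟩ h0 => ?_⟩
  set e := chartAt 𝔼 x₀ with he
  have hxs : x₀ ∈ e.source := mem_chart_source 𝔼 x₀
  have h1 : ∀ᵐ p ∂riemVol n M, p ∉ U := measure_eq_zero_iff_ae_notMem.1 h0
  have h2 := ae_chart_of_ae h1 x₀
  rw [ae_restrict_iff' e.open_target.measurableSet] at h2
  have h3 : IsOpen (e.target ∩ e.symm ⁻¹' U) := e.isOpen_inter_preimage_symm hU
  refine (h3.measure_pos volume ⟨e x₀, e.map_source hxs, ?_⟩).ne' ?_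
  · rw [mem_preimage, e.left_inv hxs]
    exact hx
  · refine measure_eq_zero_iff_ae_notMem.2 ?_
    filter_upwards [h2] with y hy hyU using hy hyU.1 hyU.2

/-- A small ball about `x` has finite measure by local finiteness, and repeated doubling reaches any
radius. -/
lemma Doubling.measure_ball_lt_top (hD : Doubling n M) (x : M) (r : ℝ) :
    riemVol n M (Metric.ball x r) < ⊤ := by
  obtain ⟨C, hC⟩ := hD
  obtain ⟨r₀, hr₀, h⟩ := Metric.nhds_basis_ball.mem_iff.1
    ((riemVol n M).finiteAt_nhds x).choose_spec.1
  have h' := (measure_mono h).trans_lt ((riemVol n M).finiteAt_nhds x).choose_spec.2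
  obtain ⟨k, hk⟩ := pow_unbounded_of_one_lt (r / r₀) one_lt_two
  rw [div_lt_iff₀ hr₀] at hk
  exact (measure_mono (Metric.ball_subset_ball hk.le)).trans_lt
    ((measure_ball_two_pow_le hC x hr₀ k).trans_lt
      (ENNReal.mul_lt_top (ENNReal.pow_lt_top ENNReal.coe_lt_top) h'))

/-- A Vitali family of disjoint balls of radius `ε / 10` centred in the ball is finite, since each
has at least a fixed measure and their union has finite measure; its enlargements cover. -/
lemma Doubling.totallyBounded_ball (hD : Doubling n M) (x : M) (R : ℝ) :
    TotallyBounded (Metric.ball x R) := by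
  refine Metric.totallyBounded_iff.2 fun ε hε => ?_
  have hfin := hD.measure_ball_lt_top x (R + ε)
  obtain ⟨C, hC⟩ := hD
  obtain ⟨u, hu, hdisj, hcov⟩ := Vitali.exists_disjoint_subfamily_covering_enlargement_closedBall
    (Metric.ball x R) id (fun _ => ε / 10) (ε / 10) (fun _ _ => le_rfl) 5 (by norm_num)
  refine ⟨u, ?_, fun y hy => ?_⟩
  swap
  · obtain ⟨b, hb, hsub⟩ := hcov y hy
    have h1 : y ∈ Metric.closedBall b (5 * (ε / 10)) :=
      hsub (Metric.mem_closedBall_self (by positivity))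
    refine mem_biUnion hb (Metric.mem_ball.2 ?_)
    linarith [Metric.mem_closedBall.1 h1]
  rcases u.eq_empty_or_nonempty with rfl | ⟨b₀, hb₀⟩
  · exact finite_empty
  have hR : 0 < R := Metric.pos_of_mem_ball (hu hb₀)
  obtain ⟨k, hk⟩ := pow_unbounded_of_one_lt (2 * R / (ε / 10)) one_lt_two
  rw [div_lt_iff₀ (by positivity)] at hk
  -- The ball `B(x, R)` lies in `B(b, 2R)`, hence in `B(b, 2^k ε/10)` for each centre `b`, so `k`
  -- doublings give this lower bound uniformly in `b`.
  set c := riemVol n M (Metric.ball x R) / (C : ℝ≥0∞) ^ k with hc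
  have hc0 : 0 < c := ENNReal.div_pos (Metric.isOpen_ball.measure_pos _
    (Metric.nonempty_ball.2 hR)).ne' (ENNReal.pow_ne_top ENNReal.coe_ne_top)
  have hcb : ∀ b : u, c ≤ riemVol n M (Metric.ball (b : M) (ε / 10)) := by
    intro b
    refine ENNReal.div_le_of_le_mul' ?_
    refine (measure_mono ?_).trans (measure_ball_two_pow_le hC (b : M) (by positivity) k)
    refine Metric.ball_subset_ball' ?_
    have := Metric.mem_ball.1 (hu b.2)
    rw [dist_comm] at this
    linarith
  have hfs := Measure.finite_const_le_meas_of_disjoint_iUnion (riemVol n M) hc0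
    (As := fun b : u => Metric.ball (b : M) (ε / 10)) (fun _ => Metric.isOpen_ball.measurableSet)
    (fun a b hab => (hdisj a.2 b.2 fun h => hab (Subtype.ext h)).mono
      Metric.ball_subset_closedBall Metric.ball_subset_closedBall)
    (ne_top_of_le_ne_top hfin.ne (measure_mono (iUnion_subset fun b => Metric.ball_subset_ball' (y := x)
      (ε₂ := R + ε) (by linarith [Metric.mem_ball.1 (hu b.2)]))))
  have : {i : u | c ≤ riemVol n M (Metric.ball (i : M) (ε / 10))} = univ :=
    eq_univ_of_forall hcb
  rw [this] at hfs
  exact finite_coe_iff.1 (finite_univ_iff.1 hfs)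

lemma Doubling.properSpace [CompleteSpace M] (hD : Doubling n M) : ProperSpace M := by
  refine ⟨fun x r => ?_⟩
  refine isCompact_iff_totallyBounded_isComplete.2 ⟨?_, Metric.isClosed_closedBall.isComplete⟩
  exact (hD.totallyBounded_ball x (r + 1)).subset (Metric.closedBall_subset_ball (by linarith))

end Doubling

/-! ### Radial Lipschitz cutoffs -/

section Cutoff

variable {M : Type*} [MetricSpace M]

/-- A Lipschitz function that is `1` on the ball of radius `R` and `0` off the ball of radius
`2 R`. -/
def cutoff (x₀ : M) (R : ℝ) (p : M) : ℝ := max 0 (min 1 (2 - dist p x₀ / R))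

lemma lipschitzWith_cutoff (x₀ : M) {R : ℝ} (hR : 0 < R) :
    LipschitzWith (R⁻¹).toNNReal (cutoff x₀ R) := by
  have h : LipschitzWith (R⁻¹).toNNReal fun p : M => 2 - dist p x₀ / R := by
    refine LipschitzWith.of_dist_le_mul fun p r => ?_
    rw [Real.coe_toNNReal _ (by positivity), Real.dist_eq,
      show 2 - dist p x₀ / R - (2 - dist r x₀ / R) = R⁻¹ * (dist r x₀ - dist p x₀) by
        field_simp; ring, abs_mul, abs_of_pos (by positivity : 0 < R⁻¹)]
    gcongr
    rw [dist_comm p r]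
    exact abs_dist_sub_le r p x₀
  exact (h.const_min 1).const_max 0

lemma cutoff_nonneg (x₀ : M) (R : ℝ) (p : M) : 0 ≤ cutoff x₀ R p := le_max_left _ _

lemma cutoff_le_one (x₀ : M) (R : ℝ) (p : M) : cutoff x₀ R p ≤ 1 :=
  max_le zero_le_one (min_le_left _ _)

lemma cutoff_eq_one {x₀ p : M} {R : ℝ} (hR : 0 < R) (hp : dist p x₀ ≤ R) : cutoff x₀ R p = 1 := by
  have : dist p x₀ / R ≤ 1 := (div_le_one hR).2 hp
  rw [cutoff, min_eq_left (by linarith), max_eq_right zero_le_one]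

lemma cutoff_eq_zero {x₀ p : M} {R : ℝ} (hR : 0 < R) (hp : p ∉ Metric.closedBall x₀ (2 * R)) :
    cutoff x₀ R p = 0 := by
  have : 2 < dist p x₀ / R := by
    rw [lt_div_iff₀ hR]
    simpa using hp
  rw [cutoff, max_eq_left]
  exact (min_le_right _ _).trans (by linarith)

end Cutoff

/-! ### Membership in the Sobolev space -/

section Sobolev

variable {n : ℕ} {M : Type*} [MetricSpace M] [ChartedSpace (EuclideanSpace ℝ (Fin n)) M]
  [IsManifold (𝓡 n) ∞ M]
  [RiemannianBundle (fun x : M => TangentSpace (𝓡 n) x)]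
  [IsContMDiffRiemannianBundle (𝓡 n) ∞ (EuclideanSpace ℝ (Fin n))
    (fun x : M => TangentSpace (𝓡 n) x)]
  [MeasurableSpace M] [BorelSpace M] [SecondCountableTopology M]

local notation "𝔼" => EuclideanSpace ℝ (Fin n)

/-- `MemW` measures convergence against the chosen `weakGrad`, so `X` is first exchanged for it. The
approximants lie in `L_q` with their gradients because they are at finite distance from `f`. -/
lemma SmoothApprox.memW {q : ℝ} {f : M → ℝ} {X : ∀ x : M, TangentSpace (𝓡 n) x}
    (h : SmoothApprox q f X) (hf : MemLp f (ENNReal.ofReal q) (riemVol n M))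
    (hX : MemLp (fun p => ‖X p‖) (ENNReal.ofReal q) (riemVol n M)) : MemW n q f := by
  have hw : HasWeakGrad n f := ⟨X, h.isWeakGrad⟩
  have h0 := h.isWeakGrad
  replace h := h.congr_grad hw.isWeakGrad
  have hX' : MemLp (fun p => ‖(weakGrad f p : TangentSpace (𝓡 n) p)‖) (ENNReal.ofReal q)
      (riemVol n M) := by
    refine hX.congr_norm hw.isWeakGrad.aemeasurable_norm.aestronglyMeasurable ?_
    filter_upwards [h0.ae_eq_weakGrad] with p hp
    rw [hp]
  have hε : ∀ k : ℕ, (0 : ℝ≥0∞) < (k + 1 : ℝ≥0∞)⁻¹ := fun k =>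
    ENNReal.inv_pos.2 (by simp)
  choose φ hφ hφc hφε using fun k : ℕ => h.exists_approx _ (hε k)
  have hlt : ∀ k : ℕ, (k + 1 : ℝ≥0∞)⁻¹ < ⊤ := fun k => ENNReal.inv_lt_top.2 (by simp)
  refine ⟨hf, hw, φ, fun k => ⟨hφ k, ?_, ?_⟩, ?_⟩
  · have h1 : MemLp (fun p => φ k p - f p) (ENNReal.ofReal q) (riemVol n M) :=
      ⟨((isWeakGrad_grad_of_contMDiff (hφ k)).sub h.isWeakGrad).aemeasurable.aestronglyMeasurable,
        (le_self_add.trans (hφε k)).trans_lt (hlt k)⟩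
    refine (h1.add hf).ae_eq (Eventually.of_forall fun p => ?_)
    simp
  · have h1 : MemLp (fun p => ‖(grad (φ k) p - weakGrad f p : TangentSpace (𝓡 n) p)‖)
        (ENNReal.ofReal q) (riemVol n M) :=
      ⟨((isWeakGrad_grad_of_contMDiff (hφ k)).sub
        h.isWeakGrad).aemeasurable_norm.aestronglyMeasurable,
        (le_add_self.trans (hφε k)).trans_lt (hlt k)⟩
    refine (h1.add hX').mono'
      (isWeakGrad_grad_of_contMDiff (hφ k)).aemeasurable_norm.aestronglyMeasurable
      (Eventually.of_forall fun p => ?_)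
    rw [norm_norm]
    have h2 := norm_add_le (grad (φ k) p - weakGrad f p : TangentSpace (𝓡 n) p) (weakGrad f p)
    rwa [sub_add_cancel] at h2
  · refine tendsto_of_tendsto_of_tendsto_of_le_of_le tendsto_const_nhds
      (h := fun k : ℕ => (k + 1 : ℝ≥0∞)⁻¹) ?_ (fun _ => zero_le) hφε
    have := ENNReal.tendsto_inv_nat_nhds_zero.comp (tendsto_add_atTop_nat 1)
    refine this.congr fun k => ?_
    simp

lemma MemW.memLp_gradLen {q : ℝ} {f : M → ℝ} (h : MemW n q f) :
    MemLp (gradLen n f) (ENNReal.ofReal q) (riemVol n M) := by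
  obtain ⟨hf, hw, φ, hφ, hlim⟩ := h
  obtain ⟨k, hk⟩ := (hlim.eventually (ge_mem_nhds zero_lt_one)).exists
  have hφk := isWeakGrad_grad_of_contMDiff (hφ k).1
  have h1 : MemLp (fun p => ‖(grad (φ k) p - weakGrad f p : TangentSpace (𝓡 n) p)‖)
      (ENNReal.ofReal q) (riemVol n M) :=
    ⟨(hφk.sub hw.isWeakGrad).aemeasurable_norm.aestronglyMeasurable,
      (le_add_self.trans hk).trans_lt ENNReal.one_lt_top⟩
  refine ((hφ k).2.2.add h1).mono' hw.aemeasurable_gradLen.aestronglyMeasurable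
    (Eventually.of_forall fun p => ?_)
  rw [gradLen, norm_norm]
  have h2 := norm_sub_le (grad (φ k) p : TangentSpace (𝓡 n) p) (grad (φ k) p - weakGrad f p)
  rwa [sub_sub_cancel] at h2

lemma MemW.memEDot {q : ℝ} {f : M → ℝ} (h : MemW n q f) :
    MemEDot n (ENNReal.ofReal q) f :=
  ⟨h.2.1, h.memLp_gradLen⟩

/-- Dominated convergence: at each point the factor is at most 1 and eventually 0. -/
lemma tendsto_eLpNorm_one_sub_cutoff {μ : Measure M} {q : ℝ} (hq : 0 < q) {g : M → ℝ}
    (hg : MemLp g (ENNReal.ofReal q) μ) (x₀ : M) :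
    Tendsto (fun k : ℕ => eLpNorm (fun p => (1 - cutoff x₀ (k + 1) p) * g p) (ENNReal.ofReal q) μ)
      atTop (𝓝 0) := by
  have hq0 : ENNReal.ofReal q ≠ 0 := by simpa using hq
  have hk : ∀ k : ℕ, (0 : ℝ) < k + 1 := fun k => by positivity
  have hint := lintegral_rpow_enorm_lt_top_of_eLpNorm_lt_top hq0 ENNReal.ofReal_ne_top hg.2
  rw [ENNReal.toReal_ofReal hq.le] at hint
  have hlim : Tendsto (fun k : ℕ => ∫⁻ p, ‖(1 - cutoff x₀ (k + 1) p) * g p‖ₑ ^ q ∂μ) atTop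
      (𝓝 (∫⁻ _, 0 ∂μ)) := by
    refine tendsto_lintegral_of_dominated_convergence' (fun p => ‖g p‖ₑ ^ q) (fun k => ?_)
      (fun k => Eventually.of_forall fun p => ?_) hint.ne (Eventually.of_forall fun p => ?_)
    · exact (((lipschitzWith_cutoff x₀ (hk k)).continuous.measurable.const_sub
        1).aemeasurable.mul hg.1.aemeasurable).enorm.pow_const q
    · refine ENNReal.rpow_le_rpow ?_ hq.le
      refine enorm_le_iff_norm_le.2 ?_
      rw [norm_mul]
      refine mul_le_of_le_one_left (norm_nonneg _) ?_
      rw [Real.norm_eq_abs, abs_le]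
      constructor <;> linarith [cutoff_nonneg x₀ (k + 1 : ℝ) p, cutoff_le_one x₀ (k + 1 : ℝ) p]
    · refine tendsto_const_nhds.congr' ?_
      obtain ⟨m, hm⟩ := exists_nat_ge (dist p x₀)
      filter_upwards [eventually_ge_atTop m] with k hkm
      have : dist p x₀ ≤ k + 1 := hm.trans (by exact_mod_cast hkm.trans (Nat.le_succ k))
      rw [cutoff_eq_one (hk k) this]
      simp [hq]
  rw [lintegral_zero] at hlim
  have := hlim.ennrpow_const (1 / q)
  rw [ENNReal.zero_rpow_of_pos (by positivity)] at this
  refine this.congr fun k => ?_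
  rw [eLpNorm_eq_lintegral_rpow_enorm_toReal hq0 ENNReal.ofReal_ne_top, ENNReal.toReal_ofReal hq.le]

variable [IsRiemannianManifold (𝓡 n) M]

lemma locallyLipschitzOn_cutoff_chart (x x₀ : M) {R : ℝ} (hR : 0 < R) :
    LocallyLipschitzOn (chartAt 𝔼 x₀).target fun y => cutoff x R ((chartAt 𝔼 x₀).symm y) :=
  locallyLipschitzOn_comp_chart_symm (lipschitzWith_cutoff x hR).locallyLipschitz x₀

lemma IsWeakGrad.cutoff_mul {f : M → ℝ} {X : ∀ x : M, TangentSpace (𝓡 n) x}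
    (h : IsWeakGrad f X) (x₀ : M) {R : ℝ} (hR : 0 < R) :
    IsWeakGrad (fun p => cutoff x₀ R p * f p)
      (fun p => cutoff x₀ R p • X p + f p • (grad (cutoff x₀ R) p : TangentSpace (𝓡 n) p)) :=
  h.lipschitz_mul fun x => locallyLipschitzOn_cutoff_chart x₀ x hR

lemma norm_grad_cutoff_le (x₀ : M) {R : ℝ} (hR : 0 < R) (p : M) :
    ‖(grad (cutoff x₀ R) p : TangentSpace (𝓡 n) p)‖ ≤ R⁻¹ := by
  have := norm_grad_le (n := n) (lipschitzWith_cutoff x₀ hR) p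
  rwa [Real.coe_toNNReal _ (by positivity)] at this

/-- On a proper manifold, compactly supported smooth functions are dense in the Sobolev space. -/
lemma SmoothApprox.of_memLp [ProperSpace M] {q : ℝ} (hq : 1 ≤ q) {f : M → ℝ}
    {X : ∀ x : M, TangentSpace (𝓡 n) x}
    (h : IsWeakGrad f X) (hf : MemLp f (ENNReal.ofReal q) (riemVol n M))
    (hX : MemLp (fun p => ‖X p‖) (ENNReal.ofReal q) (riemVol n M)) : SmoothApprox q f X := by
  rcases isEmpty_or_nonempty M with hM | ⟨⟨x₀⟩⟩
  · exact .of_compact hq h isCompact_univ (fun p => hM.elim p) hf hX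
  have hq1 : 1 ≤ ENNReal.ofReal q := by simpa using ENNReal.ofReal_le_ofReal hq
  have hq0 : 0 < q := by linarith
  refine ⟨h, fun ε hε => ?_⟩
  set Q := ENNReal.ofReal q with hQ
  set μ := riemVol n M with hμ
  -- The three tails of cutting off at radius `k + 1`: the loss of `f`, the loss of `X`, and `f`
  -- times the gradient of the cutoff, which is at most `1 / (k + 1)`.
  have hlim : Tendsto (fun k : ℕ => eLpNorm (fun p => (1 - cutoff x₀ (k + 1) p) * f p) Q μ +
      (eLpNorm (fun p => (1 - cutoff x₀ (k + 1) p) * ‖X p‖) Q μ +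
        ‖(1 / (k + 1) : ℝ)‖ₑ * eLpNorm f Q μ)) atTop (𝓝 0) := by
    have h3 : Tendsto (fun k : ℕ => ‖(1 / (k + 1) : ℝ)‖ₑ) atTop (𝓝 0) := by
      simpa using (tendsto_one_div_add_atTop_nhds_zero_nat (𝕜 := ℝ)).enorm
    have h4 := ENNReal.Tendsto.mul_const (b := eLpNorm f Q μ) h3 (Or.inr hf.2.ne)
    simpa using (tendsto_eLpNorm_one_sub_cutoff hq0 hf x₀).add
      ((tendsto_eLpNorm_one_sub_cutoff hq0 hX x₀).add h4)
  obtain ⟨k, hk⟩ := (hlim.eventually (ge_mem_nhds (ENNReal.half_pos hε.ne'))).exists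
  have hk0 : (0 : ℝ) < k + 1 := by positivity
  have hη := h.cutoff_mul x₀ hk0
  have hη0 := cutoff_nonneg x₀ (k + 1 : ℝ)
  have hη1 := cutoff_le_one x₀ (k + 1 : ℝ)
  have hηm : Measurable (cutoff x₀ (k + 1 : ℝ)) :=
    (lipschitzWith_cutoff x₀ hk0).continuous.measurable
  have happ : SmoothApprox q _ _ := .of_compact hq hη (isCompact_closedBall x₀ (2 * (k + 1 : ℝ)))
    (fun p hp => by rw [cutoff_eq_zero hk0 hp, zero_mul])
    (hf.of_le hη.aemeasurable.aestronglyMeasurable (Eventually.of_forall fun p => by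
      rw [norm_mul, Real.norm_of_nonneg (hη0 p)]
      exact mul_le_of_le_one_left (norm_nonneg _) (hη1 p)))
    ((hX.add (hf.norm.const_mul (k + 1 : ℝ)⁻¹)).mono' hη.aemeasurable_norm.aestronglyMeasurable
      (Eventually.of_forall fun p => by
        rw [norm_norm]
        refine (norm_add_le _ _).trans (add_le_add ?_ ?_)
        · rw [norm_smul, Real.norm_of_nonneg (hη0 p)]
          exact mul_le_of_le_one_left (norm_nonneg _) (hη1 p)
        · rw [norm_smul, mul_comm]
          exact mul_le_mul_of_nonneg_right (norm_grad_cutoff_le x₀ hk0 p) (norm_nonneg _)))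
  obtain ⟨φ, hφ, hφc, hφε⟩ := happ.exists_approx (ε / 2) (ENNReal.half_pos hε.ne')
  have hφw := (isWeakGrad_grad_of_contMDiff hφ).sub hη
  refine ⟨φ, hφ, hφc, ?_⟩
  rw [← ENNReal.add_halves ε]
  refine le_trans ?_ (add_le_add hφε hk)
  rw [add_add_add_comm]
  have hmf : AEStronglyMeasurable (fun p => (1 - cutoff x₀ (k + 1 : ℝ) p) * f p) μ :=
    ((hηm.const_sub 1).aemeasurable.mul h.aemeasurable).aestronglyMeasurable
  have hmX : AEStronglyMeasurable (fun p => (1 - cutoff x₀ (k + 1 : ℝ) p) * ‖X p‖) μ :=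
    ((hηm.const_sub 1).aemeasurable.mul h.aemeasurable_norm).aestronglyMeasurable
  refine add_le_add ?_ ?_
  · refine (eLpNorm_mono_real (g := fun p => ‖φ p - cutoff x₀ (k + 1 : ℝ) p * f p‖ +
      ‖(1 - cutoff x₀ (k + 1 : ℝ) p) * f p‖) fun p => ?_).trans
      ((eLpNorm_add_le hφw.aemeasurable.aestronglyMeasurable.norm hmf.norm hq1).trans_eq ?_)
    · refine le_trans (le_of_eq (congrArg _ ?_)) (norm_sub_le _ _)
      ring
    · rw [eLpNorm_norm (fun p => φ p - cutoff x₀ (k + 1 : ℝ) p * f p),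
        eLpNorm_norm (fun p => (1 - cutoff x₀ (k + 1 : ℝ) p) * f p)]
  · have hsm : eLpNorm (((1 / (k + 1) : ℝ)) • fun p => ‖f p‖) Q μ =
        ‖(1 / (k + 1) : ℝ)‖ₑ * eLpNorm f Q μ := by
      rw [eLpNorm_const_smul, eLpNorm_norm]
    rw [← hsm]
    refine le_trans ?_ (add_le_add_right (eLpNorm_add_le hmX
      (hf.1.norm.const_smul _) hq1) _)
    refine le_trans (eLpNorm_mono_real fun p => ?_) (eLpNorm_add_le
      hφw.aemeasurable_norm.aestronglyMeasurable (hmX.add (hf.1.norm.const_smul _)) hq1)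
    rw [norm_norm]
    have e1 : (grad φ p - X p : TangentSpace (𝓡 n) p) =
        (grad φ p - (cutoff x₀ (k + 1 : ℝ) p • X p + f p • grad (cutoff x₀ (k + 1 : ℝ)) p)) +
          (-((1 - cutoff x₀ (k + 1 : ℝ) p) • X p) + f p • grad (cutoff x₀ (k + 1 : ℝ)) p) := by
      module
    rw [e1]
    refine (norm_add_le _ _).trans (add_le_add le_rfl ((norm_add_le _ _).trans (add_le_add ?_ ?_)))
    · rw [norm_neg, norm_smul, Real.norm_of_nonneg (by linarith [hη1 p])]
    · rw [norm_smul, mul_comm]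
      simp only [Pi.smul_apply, smul_eq_mul, one_div]
      exact mul_le_mul_of_nonneg_right (norm_grad_cutoff_le x₀ hk0 p) (norm_nonneg _)

/-- The coincidence of the completion with the space defined by weak gradients; it allows non-smooth
pieces of a decomposition to be placed in `W^1_q`. -/
lemma memW_of_memLp [ProperSpace M] {q : ℝ} (hq : 1 ≤ q) {f : M → ℝ}
    {X : ∀ x : M, TangentSpace (𝓡 n) x}
    (h : IsWeakGrad f X) (hf : MemLp f (ENNReal.ofReal q) (riemVol n M))
    (hX : MemLp (fun p => ‖X p‖) (ENNReal.ofReal q) (riemVol n M)) : MemW n q f :=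
  (SmoothApprox.of_memLp hq h hf hX).memW hf hX

lemma gradLen_le_of_lipschitz {g : M → ℝ} {L : ℝ≥0} (hg : LipschitzWith L g) :
    ∀ᵐ p ∂riemVol n M, gradLen n g p ≤ L := by
  filter_upwards [(isWeakGrad_grad_of_lipschitz (n := n) hg).gradLen_ae_eq] with p hp
  rw [hp]
  exact norm_grad_le hg p

lemma eLpNorm_gradLen_le_of_lipschitz {g : M → ℝ} {L : ℝ≥0} (hg : LipschitzWith L g) :
    eLpNorm (gradLen n g) ⊤ (riemVol n M) ≤ L := by
  rw [eLpNorm_exponent_top]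
  refine eLpNormEssSup_le_of_ae_nnnorm_bound ?_
  filter_upwards [gradLen_le_of_lipschitz (n := n) hg] with p hp
  rw [← NNReal.coe_le_coe, coe_nnnorm, gradLen, norm_norm]
  exact hp

lemma MemWInfty.memEDot {g : M → ℝ} (h : MemWInfty g) : MemEDot n ⊤ g := by
  obtain ⟨-, L, hL⟩ := h
  have hw : HasWeakGrad n g := ⟨_, isWeakGrad_grad_of_lipschitz hL⟩
  exact ⟨hw, hw.aemeasurable_gradLen.aestronglyMeasurable,
    (eLpNorm_gradLen_le_of_lipschitz hL).trans_lt ENNReal.coe_lt_top⟩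

end Sobolev

/-! ### The Poincaré inequality for Sobolev functions -/

section Poincare

variable {n : ℕ} {M : Type*} [MetricSpace M] [ChartedSpace (EuclideanSpace ℝ (Fin n)) M]
  [IsManifold (𝓡 n) ∞ M]
  [RiemannianBundle (fun x : M => TangentSpace (𝓡 n) x)]
  [IsContMDiffRiemannianBundle (𝓡 n) ∞ (EuclideanSpace ℝ (Fin n))
    (fun x : M => TangentSpace (𝓡 n) x)]
  [MeasurableSpace M] [BorelSpace M] [SecondCountableTopology M] [IsRiemannianManifold (𝓡 n) M]

local notation "𝔼" => EuclideanSpace ℝ (Fin n)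

/-- The Poincaré inequality extends from smooth functions with compact support to functions that
are locally in the Sobolev space. -/
lemma laverage_sub_average_le [ProperSpace M] {q : ℝ} (hq : 1 ≤ q) {C : ℝ≥0}
    (hC : ∀ f : M → ℝ, ContMDiff (𝓡 n) 𝓘(ℝ, ℝ) ∞ f → HasCompactSupport f →
    ∀ (x : M) (r : ℝ), 0 < r →
      (⨍⁻ y in Metric.ball x r,
          ‖f y - ⨍ z in Metric.ball x r, f z ∂(riemVol n M)‖ₑ ^ q ∂(riemVol n M)) ^ (1 / q) ≤
        C * ENNReal.ofReal r *
          (⨍⁻ y in Metric.ball x r,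
            ‖(grad f y : TangentSpace (𝓡 n) y)‖ₑ ^ q ∂(riemVol n M)) ^ (1 / q))
    {f : M → ℝ} {X : ∀ x : M, TangentSpace (𝓡 n) x} (h : IsWeakGrad f X)
    (hf : ∀ x r, MemLp f (ENNReal.ofReal q) ((riemVol n M).restrict (Metric.ball x r)))
    (hX : ∀ x r, MemLp (fun p => ‖X p‖) (ENNReal.ofReal q)
      ((riemVol n M).restrict (Metric.ball x r))) (x : M) {r : ℝ} (hr : 0 < r) :
    ⨍⁻ y in Metric.ball x r, ‖f y - ⨍ z in Metric.ball x r, f z ∂(riemVol n M)‖ₑ ∂(riemVol n M) ≤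
      C * ENNReal.ofReal r *
        (⨍⁻ y in Metric.ball x r, ‖X y‖ₑ ^ q ∂(riemVol n M)) ^ (1 / q) := by
  have hq1 : 1 ≤ ENNReal.ofReal q := by simpa using ENNReal.ofReal_le_ofReal hq
  have hq0 : 0 < q := by linarith
  have hQ0 : ENNReal.ofReal q ≠ 0 := by simpa using hq0
  set Q := ENNReal.ofReal q with hQ
  set μ := riemVol n M with hμ
  set B := Metric.ball x r with hB
  have hBm : MeasurableSet B := Metric.isOpen_ball.measurableSet
  have hB0 : μ B ≠ 0 := (Metric.isOpen_ball.measure_pos _ (Metric.nonempty_ball.2 hr)).ne'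
  have hBt : μ B ≠ ⊤ := (measure_ball_lt_top (μ := μ)).ne
  -- Averages over the ball become integrals for a probability measure, so norms with different
  -- exponents compare without constants.
  set ν := (μ.restrict B univ)⁻¹ • μ.restrict B with hν
  have hνu : ν univ = 1 := by
    rw [hν, Measure.smul_apply, Measure.restrict_apply_univ, smul_eq_mul,
      ENNReal.inv_mul_cancel hB0 hBt]
  have : IsProbabilityMeasure ν := ⟨hνu⟩
  have hνac : ν ≪ μ.restrict B := Measure.smul_absolutelyContinuous
  have hνμ : ν ≪ μ := hνac.trans Measure.absolutelyContinuous_restrict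
  have hpow : ∀ g : M → ℝ, (∫⁻ y, ‖g y‖ₑ ^ q ∂ν) ^ (1 / q) = eLpNorm g Q ν := fun g => by
    rw [eLpNorm_eq_lintegral_rpow_enorm_toReal hQ0 ENNReal.ofReal_ne_top,
      ENNReal.toReal_ofReal hq0.le]
  have hpowX : ∀ Y : ∀ p : M, TangentSpace (𝓡 n) p, (∫⁻ y, ‖Y y‖ₑ ^ q ∂ν) ^ (1 / q) =
      eLpNorm (fun y => ‖Y y‖) Q ν := fun Y => by
    rw [← hpow]
    simp only [enorm_norm]
  set c : ℝ≥0∞ := ((μ B)⁻¹) ^ (1 / Q).toReal with hc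
  have hct : c ≠ ⊤ := ENNReal.rpow_ne_top_of_nonneg ENNReal.toReal_nonneg (ENNReal.inv_ne_top.2 hB0)
  have hcν : ∀ g : M → ℝ, eLpNorm g Q ν ≤ c * eLpNorm g Q μ := fun g => by
    rw [hν, eLpNorm_smul_measure_of_ne_top ENNReal.ofReal_ne_top, Measure.restrict_apply_univ,
      smul_eq_mul]
    gcongr
    exact Measure.restrict_le_self
  -- The cutoff is 1 on the ball, so `F` agrees with `f` there while having compact support; local
  -- integrability of `f` and `X` is then enough to approximate `F`.
  have hη := h.cutoff_mul x hr
  set F := fun p => cutoff x r p * f p with hF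
  set Z := fun p => cutoff x r p • X p + f p • (grad (cutoff x r) p : TangentSpace (𝓡 n) p) with hZ
  have hoff : ∀ p, p ∉ Metric.ball x (3 * r) → F p = 0 := fun p hp => by
    rw [hF]
    simp only
    rw [cutoff_eq_zero hr, zero_mul]
    simp only [Metric.mem_ball, Metric.mem_closedBall, not_lt, not_le] at hp ⊢
    linarith
  have happ : SmoothApprox q F Z := by
    refine .of_compact hq hη (isCompact_closedBall x (3 * r))
      (fun p hp => hoff p fun h' => hp (Metric.ball_subset_closedBall h')) ?_ ?_
    · have h1 := ((memLp_indicator_iff_restrict Metric.isOpen_ball.measurableSet).2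
        (hf x (3 * r)))
      refine h1.norm.mono' hη.aemeasurable.aestronglyMeasurable (Eventually.of_forall fun p => ?_)
      by_cases hp : p ∈ Metric.ball x (3 * r)
      · rw [indicator_of_mem hp, norm_mul, Real.norm_of_nonneg (cutoff_nonneg x r p)]
        exact mul_le_of_le_one_left (norm_nonneg _) (cutoff_le_one x r p)
      · rw [hoff p hp, norm_zero]
        exact norm_nonneg _
    · have h1 := ((memLp_indicator_iff_restrict Metric.isOpen_ball.measurableSet).2
        ((hX x (3 * r)).add ((hf x (3 * r)).norm.const_mul r⁻¹)))
      refine h1.norm.mono' hη.aemeasurable_norm.aestronglyMeasurable ?_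
      filter_upwards [hη.ae_eq_zero_of_eq_zero] with p hpZ
      by_cases hp : p ∈ Metric.ball x (3 * r)
      · rw [indicator_of_mem hp, norm_norm]
        refine ((norm_add_le _ _).trans (add_le_add ?_ ?_)).trans (Real.le_norm_self _)
        · rw [norm_smul, Real.norm_of_nonneg (cutoff_nonneg x r p)]
          exact mul_le_of_le_one_left (norm_nonneg _) (cutoff_le_one x r p)
        · rw [norm_smul, mul_comm]
          exact mul_le_mul_of_nonneg_right (norm_grad_cutoff_le x hr p) (norm_nonneg _)
      · rw [hpZ (hoff p hp), norm_norm, norm_zero]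
        exact norm_nonneg _
  have hFB : ∀ p ∈ B, F p = f p := fun p hp => by
    rw [hF]
    simp only
    rw [cutoff_eq_one hr (Metric.mem_ball.1 hp).le, one_mul]
  have hνB : ∀ᵐ p ∂ν, p ∈ B := hνac.ae_le (ae_restrict_mem hBm)
  have hZB : ∀ᵐ p ∂ν, Z p = X p := by
    filter_upwards [hνB, hνμ.ae_le (hη.sub h).ae_eq_zero_of_eq_zero] with p hp hpZ
    exact sub_eq_zero.1 (hpZ (sub_eq_zero.2 (hFB p hp)))
  have hfν : Integrable f ν := (((hf x r).smul_measure (c := (μ.restrict B univ)⁻¹) (by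
    rw [Measure.restrict_apply_univ]; exact ENNReal.inv_ne_top.2 hB0)).integrable hq1)
  rw [laverage_eq', laverage_eq', average_eq', ← hν, hpowX]
  set m := ∫ z, f z ∂ν with hm
  have hfm : AEStronglyMeasurable f ν := hfν.1
  -- Replacing `f` on the ball by a smooth function `δ`-close to `F` costs an error linear in `δ`.
  -- On the left the exponent drops from `q` to 1, which suffices for the oscillation estimate.
  have key : ∀ δ : ℝ≥0∞, 0 < δ → ∫⁻ y, ‖f y - m‖ₑ ∂ν ≤
      (2 * c + C * ENNReal.ofReal r * c) * δ +
        C * ENNReal.ofReal r * eLpNorm (fun y => ‖X y‖) Q ν := by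
    intro δ hδ
    obtain ⟨φ, hφ, hφc, hφδ⟩ := happ.exists_approx δ hδ
    have hφw := isWeakGrad_grad_of_contMDiff hφ
    have hP := hC φ hφ hφc x r hr
    rw [laverage_eq', laverage_eq', average_eq', ← hν, hpowX] at hP
    have hP' := hpow (fun y => φ y - ∫ z, φ z ∂ν)
    rw [hP'] at hP
    have hφm : AEStronglyMeasurable φ ν := hφ.continuous.measurable.aestronglyMeasurable
    have hφi : Integrable φ ν := by
      have := hφ.continuous.integrable_of_hasCompactSupport (μ := μ) hφc
      exact (this.integrableOn (s := B)).smul_measure (by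
        rw [Measure.restrict_apply_univ]; exact ENNReal.inv_ne_top.2 hB0)
    have hd1 : eLpNorm (fun y => f y - φ y) Q ν ≤ c * δ := by
      have : eLpNorm (fun y => f y - φ y) Q ν = eLpNorm (fun y => φ y - F y) Q ν := by
        rw [← eLpNorm_neg]
        refine eLpNorm_congr_ae ?_
        filter_upwards [hνB] with p hp
        rw [hFB p hp]
        simp
      rw [this]
      exact (hcν _).trans (by gcongr; exact le_self_add.trans hφδ)
    have hd2 : ∫⁻ y, ‖f y - φ y‖ₑ ∂ν ≤ c * δ := by
      rw [← eLpNorm_one_eq_lintegral_enorm]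
      exact (eLpNorm_le_eLpNorm_of_exponent_le hq1 (hfm.sub hφm)).trans hd1
    have hd3 : ‖(∫ z, φ z ∂ν) - m‖ₑ ≤ c * δ := by
      rw [hm, ← integral_sub hφi hfν]
      refine (enorm_integral_le_lintegral_enorm _).trans (le_of_eq_of_le ?_ hd2)
      exact lintegral_congr fun y => enorm_sub_rev _ _
    have hd4 : ∫⁻ y, ‖φ y - ∫ z, φ z ∂ν‖ₑ ∂ν ≤ C * ENNReal.ofReal r *
        (eLpNorm (fun y => ‖X y‖) Q ν + c * δ) := by
      rw [← eLpNorm_one_eq_lintegral_enorm]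
      refine (eLpNorm_le_eLpNorm_of_exponent_le hq1 (hφm.sub
        aestronglyMeasurable_const)).trans (hP.trans ?_)
      gcongr
      have hXm : AEStronglyMeasurable (fun y => ‖X y‖) ν :=
        h.aemeasurable_norm.aestronglyMeasurable.mono_ac hνμ
      have hdm : AEStronglyMeasurable (fun y => ‖(grad φ y - Z y : TangentSpace (𝓡 n) y)‖) ν :=
        (hφw.sub hη).aemeasurable_norm.aestronglyMeasurable.mono_ac hνμ
      refine (eLpNorm_mono_ae_real ?_).trans ((eLpNorm_add_le hXm hdm hq1).trans
        (add_le_add le_rfl ((hcν _).trans (by gcongr; exact le_add_self.trans hφδ))))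
      filter_upwards [hZB] with p hp
      rw [norm_norm, Pi.add_apply, hp]
      have := norm_add_le (X p) (grad φ p - X p : TangentSpace (𝓡 n) p)
      rwa [add_sub_cancel] at this
    calc ∫⁻ y, ‖f y - m‖ₑ ∂ν
        ≤ ∫⁻ y, (‖f y - φ y‖ₑ + (‖φ y - ∫ z, φ z ∂ν‖ₑ + ‖(∫ z, φ z ∂ν) - m‖ₑ)) ∂ν := by
          refine lintegral_mono fun y => ?_
          have e1 : f y - m = (f y - φ y) + ((φ y - ∫ z, φ z ∂ν) + ((∫ z, φ z ∂ν) - m)) := by ring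
          refine le_trans (le_of_eq (congrArg _ e1)) ((enorm_add_le _ _).trans ?_)
          gcongr
          exact enorm_add_le _ _
      _ = (∫⁻ y, ‖f y - φ y‖ₑ ∂ν) + ((∫⁻ y, ‖φ y - ∫ z, φ z ∂ν‖ₑ ∂ν) +
          ‖(∫ z, φ z ∂ν) - m‖ₑ) := by
          have hm1 : AEMeasurable (fun y => ‖f y - φ y‖ₑ) ν := (hfm.sub hφm).enorm
          rw [lintegral_add_left' hm1, lintegral_add_right' _ aemeasurable_const,
            lintegral_const, hνu, mul_one]
      _ ≤ c * δ + (C * ENNReal.ofReal r * (eLpNorm (fun y => ‖X y‖) Q ν + c * δ) + c * δ) := by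
          gcongr
      _ = _ := by ring
  have hlim : Tendsto (fun δ : ℝ≥0∞ => (2 * c + C * ENNReal.ofReal r * c) * δ +
        C * ENNReal.ofReal r * eLpNorm (fun y => ‖X y‖) Q ν) (𝓝[>] 0)
      (𝓝 ((2 * c + C * ENNReal.ofReal r * c) * 0 +
        C * ENNReal.ofReal r * eLpNorm (fun y => ‖X y‖) Q ν)) := by
    refine Tendsto.add_const _ (ENNReal.Tendsto.const_mul
      (tendsto_id.mono_left nhdsWithin_le_nhds) (Or.inr ?_))
    exact ENNReal.add_ne_top.2 ⟨ENNReal.mul_ne_top (by simp) hct,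
      ENNReal.mul_ne_top (ENNReal.mul_ne_top ENNReal.coe_ne_top ENNReal.ofReal_ne_top) hct⟩
  rw [mul_zero, zero_add] at hlim
  exact ge_of_tendsto hlim (by filter_upwards [self_mem_nhdsWithin] with δ hδ using key δ hδ)

end Poincare

/-! ### Maximal function, Lebesgue points and Lipschitz regularity -/

section Maximal

variable {M : Type*} [MetricSpace M] [MeasurableSpace M]

/-- The centred maximal function. -/
def maximalFun (μ : Measure M) (w : M → ℝ≥0∞) (x : M) : ℝ≥0∞ :=
  ⨆ (r : ℝ) (_ : 0 < r), ⨍⁻ y in Metric.ball x r, w y ∂μ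

lemma laverage_le_maximalFun (μ : Measure M) (w : M → ℝ≥0∞) (x : M) {r : ℝ} (hr : 0 < r) :
    ⨍⁻ y in Metric.ball x r, w y ∂μ ≤ maximalFun μ w x :=
  le_iSup₂ (f := fun (r : ℝ) (_ : 0 < r) => ⨍⁻ y in Metric.ball x r, w y ∂μ) r hr

variable [BorelSpace M] [SecondCountableTopology M] {μ : Measure M} [μ.IsOpenPosMeasure]
  {C : ℝ≥0}

/-- The weak type inequality for the centred maximal function of a doubling measure. -/
lemma mul_measure_maximalFun_le (hC : ∀ (x : M) (r : ℝ), 0 < r →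
    μ (Metric.ball x (2 * r)) ≤ C * μ (Metric.ball x r)) (hfin : ∀ (x : M) (r : ℝ),
    μ (Metric.ball x r) < ⊤) (w : M → ℝ≥0∞) (s : ℝ≥0∞) :
    s * μ {x | s < maximalFun μ w x} ≤ C ^ 3 * ∫⁻ x, w x ∂μ := by
  -- The Vitali covering lemma requires bounded radii. The bound `R` does not enter the constant and
  -- is removed by monotone exhaustion.
  have key : ∀ R : ℕ, s * μ {x | ∃ r : ℝ, 0 < r ∧ r ≤ R ∧
      s * μ (Metric.ball x r) ≤ ∫⁻ y in Metric.ball x r, w y ∂μ} ≤ C ^ 3 * ∫⁻ x, w x ∂μ := by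
    intro R
    set t := {x | ∃ r : ℝ, 0 < r ∧ r ≤ R ∧
      s * μ (Metric.ball x r) ≤ ∫⁻ y in Metric.ball x r, w y ∂μ} with ht
    choose! r hr0 hrR hrs using fun x (hx : x ∈ t) => hx
    obtain ⟨u, hut, hdisj, hcov⟩ := Vitali.exists_disjoint_subfamily_covering_enlargement_closedBall
      t id r R hrR 5 (by norm_num)
    simp only [id] at hdisj hcov
    have hdisj' : u.PairwiseDisjoint fun a => Metric.ball a (r a) :=
      hdisj.mono fun a => Metric.ball_subset_closedBall
    have huc : u.Countable := hdisj'.countable_of_isOpen (fun _ _ => Metric.isOpen_ball)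
      fun a ha => Metric.nonempty_ball.2 (hr0 a (hut ha))
    -- The fivefold enlargement fits into a dilation by `2 ^ 3`, which costs three doublings: this
    -- is the origin of `C ^ 3`.
    have hsub : t ⊆ ⋃ b ∈ u, Metric.ball b (2 ^ 3 * r b) := by
      intro x hx
      obtain ⟨b, hb, hxb⟩ := hcov x hx
      refine mem_biUnion hb (Metric.closedBall_subset_ball ?_
        (hxb (Metric.mem_closedBall_self (hr0 x hx).le)))
      linarith [hr0 b (hut hb)]
    calc s * μ t ≤ s * ∑' b : u, μ (Metric.ball (b : M) (2 ^ 3 * r b)) := by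
          gcongr
          exact (measure_mono hsub).trans (measure_biUnion_le μ huc _)
      _ ≤ s * ∑' b : u, C ^ 3 * μ (Metric.ball (b : M) (r b)) := by
          gcongr with b
          exact measure_ball_two_pow_le hC _ (hr0 _ (hut b.2)) 3
      _ = C ^ 3 * ∑' b : u, s * μ (Metric.ball (b : M) (r b)) := by
          rw [ENNReal.tsum_mul_left, ENNReal.tsum_mul_left]
          ring
      _ ≤ C ^ 3 * ∑' b : u, ∫⁻ y in Metric.ball (b : M) (r b), w y ∂μ := by
          gcongr with b
          exact hrs _ (hut b.2)
      _ = C ^ 3 * ∫⁻ y in ⋃ b ∈ u, Metric.ball b (r b), w y ∂μ := by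
          rw [lintegral_biUnion huc (fun _ _ => Metric.isOpen_ball.measurableSet) hdisj']
      _ ≤ _ := by
          gcongr
          exact Measure.restrict_le_self
  have hmono : Monotone fun R : ℕ => {x | ∃ r : ℝ, 0 < r ∧ r ≤ R ∧
      s * μ (Metric.ball x r) ≤ ∫⁻ y in Metric.ball x r, w y ∂μ} := by
    rintro R R' hRR' x ⟨r, hr0, hr, h⟩
    exact ⟨r, hr0, hr.trans (by exact_mod_cast hRR'), h⟩
  have hsub : {x | s < maximalFun μ w x} ⊆ ⋃ R : ℕ, {x | ∃ r : ℝ, 0 < r ∧ r ≤ R ∧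
      s * μ (Metric.ball x r) ≤ ∫⁻ y in Metric.ball x r, w y ∂μ} := by
    intro x hx
    have hx : s < maximalFun μ w x := hx
    obtain ⟨r, hr⟩ := lt_iSup_iff.1 hx
    obtain ⟨hr0, hr⟩ := lt_iSup_iff.1 hr
    obtain ⟨R, hR⟩ := exists_nat_ge r
    refine mem_iUnion.2 ⟨R, r, hr0, hR, ?_⟩
    rw [setLAverage_eq] at hr
    exact (ENNReal.le_div_iff_mul_le (Or.inl (Metric.isOpen_ball.measure_pos _
      (Metric.nonempty_ball.2 hr0)).ne') (Or.inl (hfin x r).ne)).1 hr.le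
  calc _ ≤ s * μ (⋃ R : ℕ, {x | ∃ r : ℝ, 0 < r ∧ r ≤ R ∧
      s * μ (Metric.ball x r) ≤ ∫⁻ y in Metric.ball x r, w y ∂μ}) := by gcongr
    _ ≤ _ := by
      rw [hmono.measure_iUnion, ENNReal.mul_iSup]
      exact iSup_le key

/-- Jensen's inequality on `S`, then enlargement to `B` at the price of the measure ratio. It
compares averages over nested balls of comparable measure. -/
lemma enorm_average_sub_le {S B : Set M} (hSB : S ⊆ B) (h0 : μ S ≠ 0) (ht : μ B ≠ ⊤)
    {D : ℝ≥0∞} (hD : μ B ≤ D * μ S) {f : M → ℝ} (hf : IntegrableOn f B μ) (c : ℝ) :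
    ‖(⨍ x in S, f x ∂μ) - c‖ₑ ≤ D * ⨍⁻ x in B, ‖f x - c‖ₑ ∂μ := by
  have hSt : μ S ≠ ⊤ := ne_top_of_le_ne_top ht (measure_mono hSB)
  have hB0 : μ B ≠ 0 := fun h => h0 (measure_mono_null hSB h)
  have h1 : ‖(⨍ x in S, f x ∂μ) - c‖ₑ ≤ ⨍⁻ x in S, ‖f x - c‖ₑ ∂μ := by
    rw [average_eq', laverage_eq', Measure.restrict_apply_univ]
    set ν := (μ S)⁻¹ • μ.restrict S with hν
    have : IsProbabilityMeasure ν := ⟨by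
      rw [hν, Measure.smul_apply, Measure.restrict_apply_univ, smul_eq_mul,
        ENNReal.inv_mul_cancel h0 hSt]⟩
    have hfν : Integrable f ν := (hf.mono_set hSB).smul_measure (ENNReal.inv_ne_top.2 h0)
    have h2 : (∫ x, f x ∂ν) - c = ∫ x, (f x - c) ∂ν := by
      rw [integral_sub hfν (integrable_const c)]
      simp
    rw [h2]
    exact enorm_integral_le_lintegral_enorm _
  refine h1.trans ?_
  rw [setLAverage_eq, setLAverage_eq]
  refine ENNReal.div_le_of_le_mul ?_
  calc ∫⁻ x in S, ‖f x - c‖ₑ ∂μ ≤ ∫⁻ x in B, ‖f x - c‖ₑ ∂μ := lintegral_mono_set hSB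
    _ = (∫⁻ x in B, ‖f x - c‖ₑ ∂μ) / μ B * μ B := (ENNReal.div_mul_cancel hB0 ht).symm
    _ ≤ (∫⁻ x in B, ‖f x - c‖ₑ ∂μ) / μ B * (D * μ S) := by gcongr
    _ = _ := by ring

variable [IsLocallyFiniteMeasure μ]

/-- Lebesgue differentiation for doubling measures is available on closed balls; the open ball of
the same radius has comparable measure, so its average has the same limit. -/
lemma ae_tendsto_average_ball (hC : ∀ (x : M) (r : ℝ), 0 < r →
    μ (Metric.ball x (2 * r)) ≤ C * μ (Metric.ball x r)) (hfin : ∀ (x : M) (r : ℝ),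
    μ (Metric.ball x r) < ⊤) {f : M → ℝ} (hf : ∀ x r, IntegrableOn f (Metric.ball x r) μ) :
    ∀ᵐ x ∂μ, ∀ r : ℝ, 0 < r →
      Tendsto (fun k : ℕ => ⨍ y in Metric.ball x (r / 2 ^ k), f y ∂μ) atTop (𝓝 (f x)) := by
  have : IsUnifLocDoublingMeasure μ := by
    refine ⟨C ^ 2, ?_⟩
    filter_upwards [self_mem_nhdsWithin] with ε hε x
    have hε : 0 < ε := hε
    calc _ ≤ μ (Metric.ball x (2 ^ 2 * ε)) :=
          measure_mono (Metric.closedBall_subset_ball (by linarith))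
      _ ≤ C ^ 2 * μ (Metric.ball x ε) := measure_ball_two_pow_le hC x hε 2
      _ ≤ _ := by
        push_cast
        gcongr
        exact Metric.ball_subset_closedBall
  have hloc : LocallyIntegrable f μ := fun x =>
    ⟨Metric.ball x 1, Metric.ball_mem_nhds x one_pos, hf x 1⟩
  filter_upwards [IsUnifLocDoublingMeasure.ae_tendsto_average_norm_sub μ hloc 1] with x hx r hr
  have hδ : Tendsto (fun k : ℕ => r / 2 ^ k) atTop (𝓝[>] 0) := by
    refine tendsto_nhdsWithin_iff.2 ⟨?_, Eventually.of_forall fun k => by simp only [mem_Ioi]; positivity⟩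
    have := (tendsto_pow_atTop_nhds_zero_of_lt_one (r := (1 / 2 : ℝ)) (by norm_num)
      (by norm_num)).const_mul r
    simpa [div_eq_mul_inv] using this
  have h1 := hx (fun _ : ℕ => x) (fun k => r / 2 ^ k) hδ
    (Eventually.of_forall fun k => Metric.mem_closedBall_self (by positivity))
  rw [tendsto_iff_norm_sub_tendsto_zero]
  refine squeeze_zero (fun _ => norm_nonneg _) (fun k => ?_) (by simpa using h1.const_mul (C : ℝ))
  have hrk : 0 < r / 2 ^ k := by positivity
  have hsub : Metric.closedBall x (r / 2 ^ k) ⊆ Metric.ball x (2 * (r / 2 ^ k)) :=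
    Metric.closedBall_subset_ball (by linarith)
  have h2 := enorm_average_sub_le (μ := μ) (S := Metric.ball x (r / 2 ^ k))
    (B := Metric.closedBall x (r / 2 ^ k)) Metric.ball_subset_closedBall
    (Metric.isOpen_ball.measure_pos _ (Metric.nonempty_ball.2 hrk)).ne'
    (ne_top_of_le_ne_top (hfin _ _).ne (measure_mono hsub)) (D := C)
    ((measure_mono hsub).trans (hC x _ hrk)) ((hf x _).mono_set hsub) (f x)
  have hi : Integrable (fun y => f y - f x) (μ.restrict (Metric.closedBall x (r / 2 ^ k))) :=
    ((hf x _).mono_set hsub).sub (integrableOn_const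
      (ne_top_of_le_ne_top (hfin _ _).ne (measure_mono hsub)))
  have h3 : ENNReal.ofReal (⨍ y in Metric.closedBall x (r / 2 ^ k), ‖f y - f x‖ ∂μ) =
      ⨍⁻ y in Metric.closedBall x (r / 2 ^ k), ‖f y - f x‖ₑ ∂μ := by
    rw [ofReal_setAverage hi.norm (Eventually.of_forall fun _ => norm_nonneg _), setLAverage_eq]
    simp only [ofReal_norm]
  rw [← h3, ← ofReal_norm, ← ENNReal.ofReal_coe_nnreal, ← ENNReal.ofReal_mul C.coe_nonneg] at h2
  exact (ENNReal.ofReal_le_ofReal_iff (mul_nonneg C.2 (by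
    rw [setAverage_eq]
    exact smul_nonneg (by positivity) (integral_nonneg fun _ => abs_nonneg _)))).1 h2

/-- A function whose mean oscillation on the balls centred in `G` is at most `A` times the radius is
Lipschitz on `G`, up to a null set. -/
lemma exists_lipschitz_of_oscillation_le (hC : ∀ (x : M) (r : ℝ), 0 < r →
    μ (Metric.ball x (2 * r)) ≤ C * μ (Metric.ball x r)) (hfin : ∀ (x : M) (r : ℝ),
    μ (Metric.ball x r) < ⊤) {f : M → ℝ} (hf : ∀ x r, IntegrableOn f (Metric.ball x r) μ)
    {G : Set M} {A : ℝ≥0} (hA : ∀ x ∈ G, ∀ r : ℝ, 0 < r →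
      ⨍⁻ y in Metric.ball x r, ‖f y - ⨍ z in Metric.ball x r, f z ∂μ‖ₑ ∂μ ≤ A * ENNReal.ofReal r) :
    ∃ N : Set M, μ N = 0 ∧ LipschitzOnWith ((6 * C + 2 * C ^ 2) * A) f (G \ N) := by
  have hae := ae_tendsto_average_ball hC hfin hf
  refine ⟨{x | ¬ ∀ r : ℝ, 0 < r →
      Tendsto (fun k : ℕ => ⨍ y in Metric.ball x (r / 2 ^ k), f y ∂μ) atTop (𝓝 (f x))}, hae, ?_⟩
  have hstep : ∀ x ∈ G, ∀ r : ℝ, 0 < r → ∀ S ⊆ Metric.ball x r, μ S ≠ 0 → ∀ D : ℝ≥0,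
      μ (Metric.ball x r) ≤ D * μ S →
      dist (⨍ y in S, f y ∂μ) (⨍ y in Metric.ball x r, f y ∂μ) ≤ D * (A * r) := by
    intro x hx r hr S hS h0 D hD
    have h1 := (enorm_average_sub_le hS h0 (hfin x r).ne hD (hf x r)
      (⨍ y in Metric.ball x r, f y ∂μ)).trans (mul_le_mul_right (hA x hx r hr) _)
    rw [← ofReal_norm, ← ENNReal.ofReal_coe_nnreal, ← ENNReal.ofReal_coe_nnreal,
      ← ENNReal.ofReal_mul A.coe_nonneg,
      ← ENNReal.ofReal_mul D.coe_nonneg] at h1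
    rw [dist_eq_norm]
    exact (ENNReal.ofReal_le_ofReal_iff (mul_nonneg D.2 (mul_nonneg A.2 hr.le))).1 h1
  -- Consecutive dyadic averages at `x` differ by at most `C A r / 2^k`; the geometric series sums
  -- to `2 C A r`.
  have hpt : ∀ x ∈ G, (∀ r : ℝ, 0 < r →
      Tendsto (fun k : ℕ => ⨍ y in Metric.ball x (r / 2 ^ k), f y ∂μ) atTop (𝓝 (f x))) →
      ∀ r : ℝ, 0 < r → dist (⨍ y in Metric.ball x r, f y ∂μ) (f x) ≤ 2 * C * A * r := by
    intro x hx hlim r hr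
    have h0 : ∀ k : ℕ, dist (⨍ y in Metric.ball x (r / 2 ^ k), f y ∂μ)
        (⨍ y in Metric.ball x (r / 2 ^ (k + 1)), f y ∂μ) ≤ 2 * C * A * r / 2 / 2 ^ k := by
      intro k
      have hrk : 0 < r / 2 ^ (k + 1) := by positivity
      have e1 : 2 * (r / 2 ^ (k + 1)) = r / 2 ^ k := by
        rw [pow_succ]; field_simp
      have h2 := hstep x hx (r / 2 ^ k) (by positivity) (Metric.ball x (r / 2 ^ (k + 1)))
        (Metric.ball_subset_ball (by linarith))
        (Metric.isOpen_ball.measure_pos _ (Metric.nonempty_ball.2 hrk)).ne' C (by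
          rw [← e1]; exact hC x _ hrk)
      rw [dist_comm]
      refine h2.trans_eq ?_
      ring
    simpa using dist_le_of_le_geometric_two_of_tendsto₀ h0 (hlim r hr)
  refine LipschitzOnWith.of_dist_le_mul fun x hx y hy => ?_
  rcases eq_or_ne x y with rfl | hxy
  · simp
  have hr : 0 < dist x y := dist_pos.2 hxy
  set r := dist x y with hrdef
  have hx' := hpt x hx.1 (not_not.1 hx.2) (2 * r) (by positivity)
  have hy' := hpt y hy.1 (not_not.1 hy.2) r hr
  -- With `r` the distance, `B(y, r)` lies in `B(x, 2r)`, which lies in `B(y, 4r)`, so the measure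
  -- ratio is at most `C ^ 2`.
  have hxy' := hstep x hx.1 (2 * r) (by positivity) (Metric.ball y r)
    (Metric.ball_subset_ball' (by rw [dist_comm, ← hrdef]; linarith))
    (Metric.isOpen_ball.measure_pos _ (Metric.nonempty_ball.2 hr)).ne' (C ^ 2) (by
      push_cast
      refine (measure_mono (Metric.ball_subset_ball' ?_)).trans (measure_ball_two_pow_le hC y hr 2)
      rw [← hrdef]; linarith)
  -- The three gaps are at most `4CAr`, `2C²Ar` and `2CAr`, whose sum is the stated constant.
  have h3 := dist_triangle4 (f x) (⨍ z in Metric.ball x (2 * r), f z ∂μ)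
    (⨍ z in Metric.ball y r, f z ∂μ) (f y)
  rw [dist_comm] at hx' hxy'
  push_cast at hxy' ⊢
  linarith

end Maximal

/-! ### Decreasing rearrangements -/

section Rearrangement

variable {M : Type*} [MeasurableSpace M] {μ : Measure M}

/-- The layer cake formula for functions with values in `[0, ∞]`. -/
lemma lintegral_eq_lintegral_measure_lt [SFinite μ] {v : M → ℝ≥0∞} (hv : AEMeasurable v μ) :
    ∫⁻ x, v x ∂μ = ∫⁻ l in Ioi (0 : ℝ), μ {x | ENNReal.ofReal l < v x} := by
  have hpt : ∀ a : ℝ≥0∞, a = ∫⁻ l in Ioi (0 : ℝ), {l | ENNReal.ofReal l < a}.indicator 1 l := by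
    intro a
    rw [lintegral_indicator_one (measurableSet_lt ENNReal.measurable_ofReal measurable_const),
      Measure.restrict_apply (measurableSet_lt ENNReal.measurable_ofReal measurable_const)]
    induction a with
    | top =>
      have : {l : ℝ | ENNReal.ofReal l < ⊤} ∩ Ioi 0 = Ioi 0 := by
        ext l
        simp
      rw [this, Real.volume_Ioi]
    | coe a =>
      have : {l : ℝ | ENNReal.ofReal l < a} ∩ Ioi 0 = Ioo 0 (a : ℝ) := by
        ext l
        simp only [mem_inter_iff, mem_ofPred_eq, mem_Ioi, mem_Ioo]
        constructor
        · rintro ⟨h1, h2⟩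
          refine ⟨h2, ?_⟩
          rw [← ENNReal.ofReal_coe_nnreal] at h1
          exact (ENNReal.ofReal_lt_ofReal_iff_of_nonneg h2.le).1 h1
        · rintro ⟨h1, h2⟩
          refine ⟨?_, h1⟩
          rw [← ENNReal.ofReal_coe_nnreal]
          exact (ENNReal.ofReal_lt_ofReal_iff_of_nonneg h1.le).2 h2
      rw [this, Real.volume_Ioo, sub_zero, ENNReal.ofReal_coe_nnreal]
  wlog hvm : Measurable v generalizing v
  · rw [lintegral_congr_ae hv.ae_eq_mk, this hv.measurable_mk.aemeasurable hv.measurable_mk]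
    refine lintegral_congr fun l => measure_congr ?_
    filter_upwards [hv.ae_eq_mk] with x hx
    refine propext ?_
    change ENNReal.ofReal l < hv.mk v x ↔ ENNReal.ofReal l < v x
    rw [hx]
  calc ∫⁻ x, v x ∂μ
      = ∫⁻ x, (∫⁻ l in Ioi (0 : ℝ), {l | ENNReal.ofReal l < v x}.indicator 1 l) ∂μ :=
        lintegral_congr fun x => hpt (v x)
    _ = ∫⁻ l in Ioi (0 : ℝ), (∫⁻ x, {l | ENNReal.ofReal l < v x}.indicator 1 l ∂μ) := by
        refine lintegral_lintegral_swap (Measurable.aemeasurable ?_)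
        have : (Function.uncurry fun (x : M) (l : ℝ) =>
            {l | ENNReal.ofReal l < v x}.indicator (1 : ℝ → ℝ≥0∞) l) =
            {z : M × ℝ | ENNReal.ofReal z.2 < v z.1}.indicator 1 := by
          funext z
          rfl
        rw [this]
        exact measurable_one.indicator (measurableSet_lt
          (ENNReal.measurable_ofReal.comp measurable_snd) (hvm.comp measurable_fst))
    _ = _ := by
        refine lintegral_congr fun l => ?_
        rw [← lintegral_indicator_one (measurableSet_lt measurable_const hvm)]
        rfl

/-- The infimum in the rearrangement is attained: superlevel sets increase to this one as the level
decreases, and measures are continuous from below. -/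
lemma measure_rearr_lt_le (u : M → ℝ) (t : ℝ) :
    μ {x | rearr μ u t < ‖u x‖ₑ} ≤ ENNReal.ofReal t := by
  rcases eq_or_ne (rearr μ u t) ⊤ with htop | htop
  · simp [htop]
  obtain ⟨a, ha, haa, hlim⟩ := exists_seq_strictAnti_tendsto' (lt_top_iff_ne_top.2 htop)
  have hset : {x | rearr μ u t < ‖u x‖ₑ} = ⋃ k, {x | a k < ‖u x‖ₑ} := by
    ext x
    simp only [mem_ofPred_eq, mem_iUnion]
    constructor
    · intro hx
      exact (hlim.eventually_lt_const hx).exists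
    · rintro ⟨k, hk⟩
      exact (haa k).1.trans hk
  have hmono : Monotone fun k => {x | a k < ‖u x‖ₑ} := fun i j hij x hx =>
    (ha.antitone hij).trans_lt hx
  rw [hset, hmono.measure_iUnion]
  refine iSup_le fun k => ?_
  obtain ⟨l, hl, hlk⟩ := sInf_lt_iff.1 (haa k).1
  exact (measure_mono fun x hx => hlk.trans hx).trans hl

/-- The rearrangement is the generalized inverse of the distribution function; this equivalence lets
layer cake integrals be computed exactly. -/
lemma lt_rearr_iff (u : M → ℝ) (t : ℝ) (l : ℝ≥0∞) :
    l < rearr μ u t ↔ ENNReal.ofReal t < μ {x | l < ‖u x‖ₑ} := by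
  rw [← not_le, ← not_le, not_iff_not]
  refine ⟨fun h => ?_, fun h => sInf_le h⟩
  exact (measure_mono fun x hx => h.trans_lt hx).trans (measure_rearr_lt_le u t)

lemma rearr_antitone (u : M → ℝ) : Antitone (rearr μ u) := fun _ _ hst =>
  sInf_le_sInf fun _ hl => le_trans hl (ENNReal.ofReal_le_ofReal hst)

/-- Layer cake for `u^*` on `(0, t]`: its superlevel set at `l` is an interval from 0, cut at `t`,
of length the distribution function of `u`. -/
lemma lintegral_rearr_eq (u : M → ℝ) {t : ℝ} (ht : 0 < t) :
    ∫⁻ s in Ioc 0 t, rearr μ u s =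
      ∫⁻ l in Ioi (0 : ℝ), min (ENNReal.ofReal t) (μ {x | ENNReal.ofReal l < ‖u x‖ₑ}) := by
  rw [lintegral_eq_lintegral_measure_lt (rearr_antitone u).measurable.aemeasurable]
  refine lintegral_congr fun l => ?_
  simp only [lt_rearr_iff]
  set d := μ {x | ENNReal.ofReal l < ‖u x‖ₑ}
  rw [Measure.restrict_apply (measurableSet_lt ENNReal.measurable_ofReal measurable_const)]
  rcases lt_or_ge (ENNReal.ofReal t) d with h | h
  · have : {s : ℝ | ENNReal.ofReal s < d} ∩ Ioc 0 t = Ioc 0 t := by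
      refine inter_eq_right.2 fun s hs => ?_
      exact (ENNReal.ofReal_le_ofReal hs.2).trans_lt h
    rw [this, min_eq_left h.le, Real.volume_Ioc, sub_zero]
  · have hd : d ≠ ⊤ := ne_top_of_le_ne_top ENNReal.ofReal_ne_top h
    rw [min_eq_right h]
    have : {s : ℝ | ENNReal.ofReal s < d} ∩ Ioc 0 t = Ioo 0 d.toReal := by
      ext s
      simp only [mem_inter_iff, mem_ofPred_eq, mem_Ioc, mem_Ioo]
      constructor
      · rintro ⟨h1, h2, -⟩
        exact ⟨h2, (ENNReal.ofReal_lt_iff_lt_toReal h2.le hd).1 h1⟩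
      · rintro ⟨h1, h2⟩
        refine ⟨(ENNReal.ofReal_lt_iff_lt_toReal h1.le hd).2 h2, h1, h2.le.trans ?_⟩
        exact ENNReal.toReal_le_of_le_ofReal ht.le h
    rw [this, Real.volume_Ioo, sub_zero, ENNReal.ofReal_toReal hd]

lemma lintegral_rearr_le [SFinite μ] {u : M → ℝ} (hu : AEMeasurable u μ) {t : ℝ} (ht : 0 < t) :
    ∫⁻ s in Ioc 0 t, rearr μ u s ≤ ∫⁻ x, ‖u x‖ₑ ∂μ := by
  rw [lintegral_rearr_eq u ht, lintegral_eq_lintegral_measure_lt hu.enorm]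
  exact lintegral_mono fun l => min_le_right _ _

/-- Within `E` a superlevel set has measure at most both `t` and its full measure, which is the
layer cake integrand of the rearrangement. -/
lemma setLIntegral_le_lintegral_rearr [SFinite μ] {u : M → ℝ} (hu : AEMeasurable u μ) {t : ℝ}
    (ht : 0 < t) {E : Set M} (hE : μ E ≤ ENNReal.ofReal t) :
    ∫⁻ x in E, ‖u x‖ₑ ∂μ ≤ ∫⁻ s in Ioc 0 t, rearr μ u s := by
  rw [lintegral_rearr_eq u ht, lintegral_eq_lintegral_measure_lt hu.enorm.restrict]
  refine lintegral_mono fun l => le_min ?_ (Measure.restrict_le_self _)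
  exact ((measure_mono (subset_univ _)).trans_eq (Measure.restrict_apply_univ E)).trans hE

lemma rearr_le_rearrAvg (u : M → ℝ) {t : ℝ} (ht : 0 < t) : rearr μ u t ≤ rearrAvg μ u t := by
  have ht0 : ENNReal.ofReal t ≠ 0 := by simpa using ht
  rw [rearrAvg, ← ENNReal.div_eq_inv_mul, ENNReal.le_div_iff_mul_le (Or.inl ht0)
    (Or.inl ENNReal.ofReal_ne_top)]
  calc rearr μ u t * ENNReal.ofReal t = ∫⁻ _ in Ioc 0 t, rearr μ u t := by
        rw [setLIntegral_const, Real.volume_Ioc, sub_zero]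
    _ ≤ _ := setLIntegral_mono' measurableSet_Ioc fun s hs => rearr_antitone u hs.2

lemma mul_rearrAvg (u : M → ℝ) {t : ℝ} (ht : 0 < t) :
    ENNReal.ofReal t * rearrAvg μ u t = ∫⁻ s in Ioc 0 t, rearr μ u s := by
  rw [rearrAvg, ← mul_assoc, ENNReal.mul_inv_cancel (by simpa using ht) ENNReal.ofReal_ne_top,
    one_mul]

/-- The part of a function above its rearrangement at `t` has integral at most `t u^{**}(t)`. -/
lemma lintegral_sub_rearr_le [SFinite μ] {u : M → ℝ} (hu : AEMeasurable u μ) {t : ℝ} (ht : 0 < t) :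
    ∫⁻ x, (‖u x‖ₑ - rearr μ u t) ∂μ ≤ ENNReal.ofReal t * rearrAvg μ u t := by
  rw [mul_rearrAvg u ht]
  refine le_trans ?_ (setLIntegral_le_lintegral_rearr hu ht (measure_rearr_lt_le u t))
  have hE : NullMeasurableSet {x | rearr μ u t < ‖u x‖ₑ} μ :=
    nullMeasurableSet_lt aemeasurable_const hu.enorm
  rw [← lintegral_indicator₀ hE]
  refine lintegral_mono fun x => ?_
  by_cases hx : x ∈ {x | rearr μ u t < ‖u x‖ₑ}
  · rw [indicator_of_mem hx]
    exact tsub_le_self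
  · rw [indicator_of_notMem hx, tsub_eq_zero_of_le (not_lt.1 hx)]

lemma rearr_le_of_le_add {u w : M → ℝ} {c : ℝ≥0∞} (h : ∀ᵐ x ∂μ, ‖u x‖ₑ ≤ ‖w x‖ₑ + c) (t : ℝ) :
    rearr μ u t ≤ rearr μ w t + c := by
  refine sInf_le ?_
  refine (measure_mono_ae ?_).trans (measure_rearr_lt_le w t)
  filter_upwards [h] with x hx hxu
  have hxu : rearr μ w t + c < ‖u x‖ₑ := hxu
  change rearr μ w t < ‖w x‖ₑ
  by_contra! h'
  exact absurd (hxu.trans_le hx) (not_lt.2 (by gcongr))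

/-- Adding a constant raises the rearrangement by at most that constant, and the rearrangement of
the integrable part integrates to at most its full integral. This is how a decomposition enters the
lower bound. -/
lemma mul_rearrAvg_le_of_le_add [SFinite μ] {u w : M → ℝ} (hw : AEMeasurable w μ) {c : ℝ≥0∞}
    (h : ∀ᵐ x ∂μ, ‖u x‖ₑ ≤ ‖w x‖ₑ + c) {t : ℝ} (ht : 0 < t) :
    ENNReal.ofReal t * rearrAvg μ u t ≤ ∫⁻ x, ‖w x‖ₑ ∂μ + ENNReal.ofReal t * c := by
  rw [mul_rearrAvg u ht]
  calc ∫⁻ s in Ioc 0 t, rearr μ u s ≤ ∫⁻ s in Ioc 0 t, (rearr μ w s + c) :=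
        lintegral_mono fun s => rearr_le_of_le_add h s
    _ = (∫⁻ s in Ioc 0 t, rearr μ w s) + ENNReal.ofReal t * c := by
        rw [lintegral_add_right _ measurable_const, setLIntegral_const, Real.volume_Ioc, sub_zero,
          mul_comm c]
    _ ≤ _ := by
        gcongr
        exact lintegral_rearr_le hw ht

end Rearrangement

/-! ### Lower bound for an arbitrary decomposition -/

section LowerBound

variable {n : ℕ} {M : Type*} [MetricSpace M] [ChartedSpace (EuclideanSpace ℝ (Fin n)) M]
  [IsManifold (𝓡 n) ∞ M]
  [RiemannianBundle (fun x : M => TangentSpace (𝓡 n) x)]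
  [IsContMDiffRiemannianBundle (𝓡 n) ∞ (EuclideanSpace ℝ (Fin n))
    (fun x : M => TangentSpace (𝓡 n) x)]
  [MeasurableSpace M] [BorelSpace M] [SecondCountableTopology M]

local notation "𝔼" => EuclideanSpace ℝ (Fin n)

lemma enorm_abs_rpow (a : ℝ) {q : ℝ} (hq : 0 ≤ q) : ‖|a| ^ q‖ₑ = ‖a‖ₑ ^ q := by
  rw [Real.enorm_of_nonneg (by positivity), ← ENNReal.ofReal_rpow_of_nonneg (abs_nonneg a) hq,
    ← Real.enorm_eq_ofReal_abs]

lemma lintegral_enorm_rpow_eq {μ : Measure M} {q : ℝ} (hq : 0 < q) (g : M → ℝ) :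
    ∫⁻ x, ‖g x‖ₑ ^ q ∂μ = eLpNorm g (ENNReal.ofReal q) μ ^ q := by
  rw [eLpNorm_eq_lintegral_rpow_enorm_toReal (by simpa using hq) ENNReal.ofReal_ne_top,
    ENNReal.toReal_ofReal hq.le, ← ENNReal.rpow_mul, one_div_mul_cancel hq.ne', ENNReal.rpow_one]

lemma ofReal_rpow_mul_rearrAvgPow {μ : Measure M} {q : ℝ} (hq : 0 < q) (g : M → ℝ) {t : ℝ}
    (ht : 0 < t) : ENNReal.ofReal (t ^ (1 / q)) * rearrAvgPow μ q g t =
      (ENNReal.ofReal t * rearrAvg μ (fun x => |g x| ^ q) t) ^ (1 / q) := by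
  rw [rearrAvgPow, ENNReal.mul_rpow_of_nonneg _ _ (by positivity),
    ENNReal.ofReal_rpow_of_nonneg ht.le (by positivity)]

/-- Every decomposition controls the rearrangement of the gradient. -/
lemma rearrAvgPow_le_of_decomposition {q : ℝ} (hq : 1 ≤ q) {f h g : M → ℝ}
    (hh : MemEDot n (ENNReal.ofReal q) h) (hg : MemEDot n ⊤ g)
    (hfg : f =ᵐ[riemVol n M] fun x => h x + g x) {t : ℝ} (ht : 0 < t) :
    ENNReal.ofReal (t ^ (1 / q)) * rearrAvgPow (riemVol n M) q (gradLen n f) t ≤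
      (((2 : ℝ≥0) ^ (q - 1)) ^ (1 / q) : ℝ≥0) *
        (eLpNorm (gradLen n h) (ENNReal.ofReal q) (riemVol n M) +
          ENNReal.ofReal (t ^ (1 / q)) * eLpNorm (gradLen n g) ⊤ (riemVol n M)) := by
  have hq0 : 0 < q := by linarith
  have hq1 : 0 ≤ 1 / q := by positivity
  set μ := riemVol n M with hμ
  set b := eLpNorm (gradLen n g) ⊤ μ with hb
  have hbae : ∀ᵐ x ∂μ, ‖gradLen n g x‖ₑ ≤ b := by
    rw [hb, eLpNorm_exponent_top]
    exact enorm_ae_le_eLpNormEssSup _ _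
  have hfw : IsWeakGrad f _ := (hh.1.isWeakGrad.add hg.1.isWeakGrad).congr hfg
    (Eventually.of_forall fun _ => rfl)
  -- The constant of the convexity inequality `(a + b)^q ≤ 2^(q-1) (a^q + b^q)`.
  set D : ℝ≥0 := (2 : ℝ≥0) ^ (q - 1) with hD
  have hw : AEMeasurable (fun x => (D : ℝ) * |gradLen n h x| ^ q) μ :=
    ((hh.2.1.aemeasurable.abs).pow_const q).const_mul _
  have hwe : ∀ x, ‖(D : ℝ) * |gradLen n h x| ^ q‖ₑ = D * ‖gradLen n h x‖ₑ ^ q := fun x => by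
    rw [enorm_mul, enorm_abs_rpow _ hq0.le, Real.enorm_of_nonneg D.coe_nonneg,
      ENNReal.ofReal_coe_nnreal]
  have hle : ∀ᵐ x ∂μ, ‖|gradLen n f x| ^ q‖ₑ ≤ ‖(D : ℝ) * |gradLen n h x| ^ q‖ₑ + D * b ^ q := by
    filter_upwards [hfw.gradLen_ae_eq, hbae] with x hx hxb
    rw [hwe, enorm_abs_rpow _ hq0.le, hx, ← mul_add, enorm_norm]
    have h1 : ‖(weakGrad h x + weakGrad g x : TangentSpace (𝓡 n) x)‖ₑ ≤
        ‖gradLen n h x‖ₑ + b := by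
      refine (enorm_add_le _ _).trans (add_le_add ?_ (le_trans ?_ hxb)) <;>
      rw [gradLen, enorm_norm]
    have hDe : (D : ℝ≥0∞) = 2 ^ (q - 1) := by
      rw [hD, ENNReal.coe_rpow_of_nonneg _ (by linarith)]
      rfl
    rw [hDe]
    exact (ENNReal.rpow_le_rpow h1 hq0.le).trans (ENNReal.rpow_add_le_mul_rpow_add_rpow _ _ hq)
  have key := mul_rearrAvg_le_of_le_add hw hle ht
  simp only [hwe] at key
  rw [lintegral_const_mul' _ _ ENNReal.coe_ne_top, lintegral_enorm_rpow_eq hq0] at key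
  rw [ofReal_rpow_mul_rearrAvgPow hq0 _ ht]
  calc _ ≤ (D * (eLpNorm (gradLen n h) (ENNReal.ofReal q) μ ^ q + ENNReal.ofReal t * b ^ q)) ^
        (1 / q) := ENNReal.rpow_le_rpow (key.trans_eq (by ring)) hq1
    _ ≤ (D : ℝ≥0∞) ^ (1 / q) * ((eLpNorm (gradLen n h) (ENNReal.ofReal q) μ ^ q) ^ (1 / q) +
        (ENNReal.ofReal t * b ^ q) ^ (1 / q)) := by
        rw [ENNReal.mul_rpow_of_nonneg _ _ hq1]
        gcongr
        -- Subadditivity of the power `1 / q ≤ 1` separates the two terms at no further cost.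
        exact ENNReal.rpow_add_le_add_rpow _ _ hq1 ((div_le_one hq0).2 hq)
    _ = _ := by
        rw [ENNReal.mul_rpow_of_nonneg _ _ hq1, ← ENNReal.rpow_mul, ← ENNReal.rpow_mul,
          mul_one_div_cancel hq0.ne', ENNReal.rpow_one, ENNReal.rpow_one,
          ENNReal.ofReal_rpow_of_nonneg ht.le hq1, ENNReal.coe_rpow_of_nonneg _ hq1]

end LowerBound

/-! ### Upper bound by Lipschitz approximation off a small set -/

section UpperBound

section Measure

variable {M : Type*} [MetricSpace M] [MeasurableSpace M] [BorelSpace M]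
  [SecondCountableTopology M] {μ : Measure M} [μ.IsOpenPosMeasure] [SFinite μ] {C : ℝ≥0}

/-- The set where the maximal function of `u` exceeds a multiple of `u^{**}(t)` has measure at most
`t`. -/
lemma measure_maximalFun_gt_rearrAvg_le (hC : ∀ (x : M) (r : ℝ), 0 < r →
    μ (Metric.ball x (2 * r)) ≤ C * μ (Metric.ball x r)) (hfin : ∀ (x : M) (r : ℝ),
    μ (Metric.ball x r) < ⊤) (hC1 : 1 ≤ C) {u : M → ℝ} (hu : AEMeasurable u μ) {t : ℝ}
    (ht : 0 < t) (hT : rearrAvg μ u t ≠ ⊤) :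
    μ {x | (C ^ 3 + 1) * rearrAvg μ u t < maximalFun μ (fun x => ‖u x‖ₑ) x} ≤
      ENNReal.ofReal t := by
  set T := rearrAvg μ u t with hTdef
  set l := rearr μ u t with hl
  have hlT : l ≤ T := rearr_le_rearrAvg u ht
  -- Only the excess over `u^*(t)` enters the weak type estimate: its integral is at most `tT`,
  -- while `u` itself need not be integrable. The remainder raises the maximal function by at most
  -- `u^*(t) ≤ T`.
  set w : M → ℝ≥0∞ := fun x => ‖u x‖ₑ - l with hw
  have hmax : ∀ x, maximalFun μ (fun x => ‖u x‖ₑ) x ≤ maximalFun μ w x + T := by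
    intro x
    refine iSup₂_le fun r hr => ?_
    have hB0 : μ (Metric.ball x r) ≠ 0 :=
      (Metric.isOpen_ball.measure_pos _ (Metric.nonempty_ball.2 hr)).ne'
    calc _ ≤ ⨍⁻ y in Metric.ball x r, (w y + l) ∂μ := by
          rw [setLAverage_eq, setLAverage_eq]
          gcongr with y
          exact le_tsub_add
      _ = ⨍⁻ y in Metric.ball x r, w y ∂μ + l := by
          rw [setLAverage_eq, setLAverage_eq, lintegral_add_right _ measurable_const,
            setLIntegral_const, ENNReal.add_div, ENNReal.mul_div_cancel_right hB0 (hfin x r).ne]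
      _ ≤ _ := add_le_add (laverage_le_maximalFun μ w x hr) hlT
  have hwT : ∫⁻ x, w x ∂μ ≤ ENNReal.ofReal t * T := lintegral_sub_rearr_le hu ht
  have hsub : {x | (C ^ 3 + 1) * T < maximalFun μ (fun x => ‖u x‖ₑ) x} ⊆
      {x | C ^ 3 * T < maximalFun μ w x} := by
    intro x hx
    have hx : (C ^ 3 + 1) * T < maximalFun μ (fun x => ‖u x‖ₑ) x := hx
    have h1 := hx.trans_le (hmax x)
    rw [add_mul, one_mul] at h1
    exact (ENNReal.add_lt_add_iff_right hT).1 h1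
  refine (measure_mono hsub).trans ?_
  -- At level 0 the weak type inequality says nothing; but then the excess has integral 0 and its
  -- maximal function vanishes identically.
  rcases eq_or_ne T 0 with h0 | h0
  · have hw0 : ∫⁻ x, w x ∂μ = 0 := by simpa [h0] using hwT
    have hm0 : ∀ x, maximalFun μ w x = 0 := by
      intro x
      refine le_antisymm (iSup₂_le fun r hr => ?_) zero_le
      rw [setLAverage_eq, le_antisymm ((setLIntegral_le_lintegral _ _).trans_eq hw0) zero_le,
        ENNReal.zero_div]
    simp [hm0]
  · have hweak := (mul_measure_maximalFun_le hC hfin w (C ^ 3 * T)).trans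
      (mul_le_mul_right hwT ((C : ℝ≥0∞) ^ 3))
    have hCT0 : (C : ℝ≥0∞) ^ 3 * T ≠ 0 := mul_ne_zero (pow_ne_zero _ (by
      simpa using (zero_lt_one.trans_le hC1).ne')) h0
    have hCTt : (C : ℝ≥0∞) ^ 3 * T ≠ ⊤ := ENNReal.mul_ne_top (ENNReal.pow_ne_top ENNReal.coe_ne_top) hT
    refine (ENNReal.mul_le_mul_iff_right hCT0 hCTt).1 (hweak.trans_eq (by ring))

/-- The excess over `u^*(t)` contributes at most `tT`, the part below it at most `u^*(t) μ(E) ≤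
2tT`. -/
lemma setLIntegral_le_three_mul {u : M → ℝ} (hu : AEMeasurable u μ) {t : ℝ} (ht : 0 < t)
    {E : Set M} (hE : μ E ≤ 2 * ENNReal.ofReal t) :
    ∫⁻ x in E, ‖u x‖ₑ ∂μ ≤ 3 * (ENNReal.ofReal t * rearrAvg μ u t) := by
  calc ∫⁻ x in E, ‖u x‖ₑ ∂μ ≤ ∫⁻ x in E, ((‖u x‖ₑ - rearr μ u t) + rearr μ u t) ∂μ :=
        lintegral_mono fun x => le_tsub_add
    _ = (∫⁻ x in E, (‖u x‖ₑ - rearr μ u t) ∂μ) + rearr μ u t * μ E := by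
        rw [lintegral_add_right _ measurable_const, setLIntegral_const]
    _ ≤ ENNReal.ofReal t * rearrAvg μ u t + rearrAvg μ u t * (2 * ENNReal.ofReal t) :=
        add_le_add ((setLIntegral_le_lintegral _ _).trans (lintegral_sub_rearr_le hu ht))
          (mul_le_mul' (rearr_le_rearrAvg u ht) hE)
    _ = _ := by ring

lemma exists_measure_gt_le {q : ℝ} (hq : 0 < q) {h : M → ℝ} (hh : MemLp h (ENNReal.ofReal q) μ)
    {t : ℝ} (ht : 0 < t) : ∃ s : ℝ, 0 ≤ s ∧ μ {x | s < |h x|} ≤ ENNReal.ofReal t := by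
  have hI := lintegral_rpow_enorm_lt_top_of_eLpNorm_lt_top (by simpa using hq)
    ENNReal.ofReal_ne_top hh.2
  rw [ENNReal.toReal_ofReal hq.le] at hI
  set I := ∫⁻ x, ‖h x‖ₑ ^ q ∂μ with hIdef
  -- Chebyshev's inequality at this level gives measure at most `t`; the summand 1 keeps the level
  -- positive when the integral is 0.
  set c := I.toReal / t + 1 with hc
  have hc0 : 0 < c := by positivity
  refine ⟨c ^ (1 / q), by positivity, ?_⟩
  have h1 := mul_meas_ge_le_lintegral₀ (hh.1.aemeasurable.enorm.pow_const q) (ENNReal.ofReal c)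
  have h2 : {x | c ^ (1 / q) < |h x|} ⊆ {x | ENNReal.ofReal c ≤ ‖h x‖ₑ ^ q} := by
    intro x hx
    have hx : c ^ (1 / q) < |h x| := hx
    change ENNReal.ofReal c ≤ ‖h x‖ₑ ^ q
    rw [Real.enorm_eq_ofReal_abs, ENNReal.ofReal_rpow_of_nonneg (abs_nonneg _) hq.le]
    refine ENNReal.ofReal_le_ofReal ?_
    calc c = (c ^ (1 / q)) ^ q := by
          rw [← Real.rpow_mul hc0.le, one_div_mul_cancel hq.ne', Real.rpow_one]
      _ ≤ _ := Real.rpow_le_rpow (by positivity) hx.le hq.le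
  refine (measure_mono h2).trans ?_
  have hcI : I ≤ ENNReal.ofReal c * ENNReal.ofReal t := by
    rw [← ENNReal.ofReal_mul hc0.le, ← ENNReal.ofReal_toReal hI.ne]
    refine ENNReal.ofReal_le_ofReal ?_
    rw [hc, add_mul, div_mul_cancel₀ _ ht.ne']
    linarith
  exact (ENNReal.mul_le_mul_iff_right (by simpa using hc0) ENNReal.ofReal_ne_top).1 (h1.trans hcI)

end Measure

variable {n : ℕ} {M : Type*} [MetricSpace M] [ChartedSpace (EuclideanSpace ℝ (Fin n)) M]
  [IsManifold (𝓡 n) ∞ M]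
  [RiemannianBundle (fun x : M => TangentSpace (𝓡 n) x)]
  [IsContMDiffRiemannianBundle (𝓡 n) ∞ (EuclideanSpace ℝ (Fin n))
    (fun x : M => TangentSpace (𝓡 n) x)]
  [MeasurableSpace M] [BorelSpace M] [SecondCountableTopology M] [IsRiemannianManifold (𝓡 n) M]

local notation "𝔼" => EuclideanSpace ℝ (Fin n)

lemma lipschitzWith_clamp (N : ℝ) : LipschitzWith 1 fun s : ℝ => max (-N) (min N s) :=
  (LipschitzWith.id.const_min N).const_max (-N)

lemma abs_clamp_le {N : ℝ} (hN : 0 ≤ N) (s : ℝ) : |max (-N) (min N s)| ≤ N :=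
  abs_le.2 ⟨le_max_left _ _, max_le (by linarith) (min_le_left _ _)⟩

lemma clamp_eq_self {N s : ℝ} (hs : |s| ≤ N) : max (-N) (min N s) = s := by
  obtain ⟨h1, h2⟩ := abs_le.1 hs
  rw [min_eq_right h2, max_eq_right h1]

/-- On a doubling manifold with a Poincaré inequality, a function of `W^1_q + W^1_∞` coincides off a
small set with a bounded Lipschitz function of Lipschitz constant controlled by the rearrangement of
its gradient. -/
lemma exists_lipschitz_eq_off_small_set [CompleteSpace M] {q : ℝ} (hq : 1 ≤ q) {C P : ℝ≥0}
    (hC : ∀ (x : M) (r : ℝ), 0 < r →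
      riemVol n M (Metric.ball x (2 * r)) ≤ C * riemVol n M (Metric.ball x r)) (hC1 : 1 ≤ C)
    (hP : ∀ f : M → ℝ, ContMDiff (𝓡 n) 𝓘(ℝ, ℝ) ∞ f → HasCompactSupport f →
    ∀ (x : M) (r : ℝ), 0 < r →
      (⨍⁻ y in Metric.ball x r,
          ‖f y - ⨍ z in Metric.ball x r, f z ∂(riemVol n M)‖ₑ ^ q ∂(riemVol n M)) ^ (1 / q) ≤
        P * ENNReal.ofReal r *
          (⨍⁻ y in Metric.ball x r,
            ‖(grad f y : TangentSpace (𝓡 n) y)‖ₑ ^ q ∂(riemVol n M)) ^ (1 / q))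
    {f h₀ g₀ : M → ℝ} (hh₀ : MemW n q h₀) (hg₀ : MemWInfty g₀)
    (hf : f =ᵐ[riemVol n M] fun x => h₀ x + g₀ x) {t : ℝ} (ht : 0 < t)
    (hT : rearrAvg (riemVol n M) (fun x => |gradLen n f x| ^ q) t ≠ ⊤) :
    ∃ (N : ℝ) (L : ℝ≥0) (g : M → ℝ) (B : Set M), (∀ x, |g x| ≤ N) ∧ LipschitzWith L g ∧
      (L : ℝ≥0∞) ≤ (6 * C + 2 * C ^ 2) * (P * ((C ^ 3 + 1) *
        rearrAvg (riemVol n M) (fun x => |gradLen n f x| ^ q) t) ^ (1 / q)) ∧ MeasurableSet B ∧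
      riemVol n M B ≤ 2 * ENNReal.ofReal t ∧ ∀ x, x ∉ B → g x = f x := by
  have hD : Doubling n M := ⟨C, hC⟩
  have hprop := hD.properSpace
  have hfin := hD.measure_ball_lt_top
  have hq0 : 0 < q := by linarith
  have hq1 : 1 ≤ ENNReal.ofReal q := by simpa using ENNReal.ofReal_le_ofReal hq
  obtain ⟨⟨N₀, hN₀⟩, L₀, hL₀⟩ := hg₀
  set μ := riemVol n M with hμ
  have hg₀w := isWeakGrad_grad_of_lipschitz (n := n) hL₀
  have hfw₀ := (hh₀.2.1.isWeakGrad.add hg₀w).congr hf (Eventually.of_forall fun _ => rfl)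
  have hfw : HasWeakGrad n f := ⟨_, hfw₀⟩
  have hfX := hfw.isWeakGrad
  have hfm : ∀ (x : M) (r : ℝ), IsFiniteMeasure (μ.restrict (Metric.ball x r)) := fun x r => ⟨by
    rw [Measure.restrict_apply_univ]; exact hfin x r⟩
  have hbdd : ∀ (x : M) (r : ℝ) (c : ℝ), MemLp (fun _ : M => c) (ENNReal.ofReal q)
      (μ.restrict (Metric.ball x r)) := fun x r c => memLp_const c
  have hfL : ∀ x r, MemLp f (ENNReal.ofReal q) (μ.restrict (Metric.ball x r)) := by
    intro x r
    refine ((hh₀.1.restrict _).norm.add (hbdd x r N₀)).mono'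
      hfX.aemeasurable.aestronglyMeasurable.restrict (ae_restrict_of_ae ?_)
    filter_upwards [hf] with y hy
    rw [hy]
    exact (norm_add_le _ _).trans (add_le_add le_rfl (hN₀ y))
  have hfXL : ∀ x r, MemLp (fun p => ‖(weakGrad f p : TangentSpace (𝓡 n) p)‖) (ENNReal.ofReal q)
      (μ.restrict (Metric.ball x r)) := by
    intro x r
    refine ((hh₀.memLp_gradLen.restrict _).add (hbdd x r L₀)).mono'
      hfX.aemeasurable_norm.aestronglyMeasurable.restrict (ae_restrict_of_ae ?_)
    filter_upwards [hfw₀.ae_eq_weakGrad] with y hy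
    rw [norm_norm, hy]
    exact (norm_add_le _ _).trans (add_le_add le_rfl (norm_grad_le hL₀ y))
  set T := rearrAvg μ (fun x => |gradLen n f x| ^ q) t with hTdef
  have hum : AEMeasurable (fun x => |gradLen n f x| ^ q) μ :=
    hfw.aemeasurable_gradLen.abs.pow_const q
  -- On the complement, the average of `|∇f|^q` over every ball about the point is at most `(C ^ 3 +
  -- 1) T`, which turns the Poincaré inequality into an oscillation bound linear in the radius.
  set Ω := {x | (C ^ 3 + 1) * T < maximalFun μ (fun x => ‖|gradLen n f x| ^ q‖ₑ) x} with hΩ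
  have hΩt : μ Ω ≤ ENNReal.ofReal t := measure_maximalFun_gt_rearrAvg_le hC hfin hC1 hum ht hT
  set τ : ℝ≥0∞ := ((C ^ 3 + 1) * T) ^ (1 / q) with hτ
  have hτt : τ ≠ ⊤ := ENNReal.rpow_ne_top_of_nonneg (by positivity)
    (ENNReal.mul_ne_top (by norm_cast; exact ENNReal.coe_ne_top) hT)
  obtain ⟨Z, hZ, hlip⟩ := exists_lipschitz_of_oscillation_le (μ := μ) (G := Ωᶜ)
    (A := P * τ.toNNReal) hC hfin (f := f) (fun x r => (hfL x r).integrable hq1) (by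
      intro x hx r hr
      refine (laverage_sub_average_le hq hP hfX hfL hfXL x hr).trans ?_
      rw [ENNReal.coe_mul, ENNReal.coe_toNNReal hτt, mul_assoc, mul_assoc,
        mul_comm (ENNReal.ofReal r)]
      gcongr
      refine ENNReal.rpow_le_rpow ?_ (by positivity)
      refine le_trans (le_of_eq ?_) ((laverage_le_maximalFun μ _ x hr).trans (not_lt.1 hx))
      simp only [enorm_abs_rpow _ hq0.le, gradLen, enorm_norm]
      rfl)
  obtain ⟨s, hs0, hs⟩ := exists_measure_gt_le hq0 hh₀.1 ht
  -- `f` is an `L_q` function plus a bounded one, so above the bound of the latter Chebyshev's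
  -- inequality applies to the former.
  have hN : ∃ N : ℝ, 0 ≤ N ∧ μ {x | N < |f x|} ≤ ENNReal.ofReal t := by
    refine ⟨|N₀| + s, by positivity, (measure_mono_ae ?_).trans hs⟩
    filter_upwards [hf] with x hx hxN
    have hxN : |N₀| + s < |f x| := hxN
    change s < |h₀ x|
    rw [hx] at hxN
    linarith [abs_add_le (h₀ x) (g₀ x), hN₀ x, le_abs_self N₀]
  obtain ⟨N, hN0, hN⟩ := hN
  -- The truncation of `f` is extended from the good set and truncated once more to be globally
  -- bounded. Off the exceptional set `|f| ≤ N`, so both truncations act trivially and `f` is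
  -- recovered.
  obtain ⟨g₁, hg₁, hg₁f⟩ := ((lipschitzWith_clamp N).comp_lipschitzOnWith hlip).extend_real
  refine ⟨N, (6 * C + 2 * C ^ 2) * (P * τ.toNNReal), fun x => max (-N) (min N (g₁ x)),
    toMeasurable μ ((Ω ∪ {x | N < |f x|}) ∪ Z), fun x => abs_clamp_le hN0 _, ?_, ?_,
    measurableSet_toMeasurable _ _, ?_, fun x hx => ?_⟩
  · have := (lipschitzWith_clamp N).comp hg₁
    rwa [one_mul, one_mul] at this
  · push_cast
    rw [ENNReal.coe_toNNReal hτt]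
  · rw [measure_toMeasurable]
    refine (measure_union_le _ _).trans ?_
    rw [hZ, add_zero, two_mul]
    exact (measure_union_le _ _).trans (add_le_add hΩt hN)
  · have hx' : x ∉ (Ω ∪ {x | N < |f x|}) ∪ Z := fun h' => hx (subset_toMeasurable _ _ h')
    simp only [mem_union, not_or] at hx'
    have hxN : |f x| ≤ N := not_lt.1 hx'.1.2
    have h1 := hg₁f ⟨hx'.1.1, hx'.2⟩
    simp only [Function.comp_apply] at h1
    change max (-N) (min N (g₁ x)) = f x
    rw [← h1, clamp_eq_self hxN, clamp_eq_self hxN]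

/-- The upper bound for the `K`-functional. -/
lemma KPrime_le_of_doubling [CompleteSpace M] {q : ℝ} (hq : 1 ≤ q) {C P : ℝ≥0}
    (hC : ∀ (x : M) (r : ℝ), 0 < r →
      riemVol n M (Metric.ball x (2 * r)) ≤ C * riemVol n M (Metric.ball x r)) (hC1 : 1 ≤ C)
    (hP : ∀ f : M → ℝ, ContMDiff (𝓡 n) 𝓘(ℝ, ℝ) ∞ f → HasCompactSupport f →
    ∀ (x : M) (r : ℝ), 0 < r →
      (⨍⁻ y in Metric.ball x r,
          ‖f y - ⨍ z in Metric.ball x r, f z ∂(riemVol n M)‖ₑ ^ q ∂(riemVol n M)) ^ (1 / q) ≤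
        P * ENNReal.ofReal r *
          (⨍⁻ y in Metric.ball x r,
            ‖(grad f y : TangentSpace (𝓡 n) y)‖ₑ ^ q ∂(riemVol n M)) ^ (1 / q))
    {f : M → ℝ} (hf : MemWSum n q f) {t : ℝ} (ht : 0 < t) :
    KPrime n q f (t ^ (1 / q)) ≤
      ((3 ^ (1 / q) + (6 * C + 2 * C ^ 2) * P * (C ^ 3 + 1) ^ (1 / q) * (2 ^ (1 / q) + 1) : ℝ≥0) : ℝ≥0∞) *
        (ENNReal.ofReal (t ^ (1 / q)) * rearrAvgPow (riemVol n M) q (gradLen n f) t) := by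
  have hq0 : 0 < q := by linarith
  have hq1 : 1 ≤ ENNReal.ofReal q := by simpa using ENNReal.ofReal_le_ofReal hq
  have hqi : 0 ≤ 1 / q := by positivity
  have hprop := (show Doubling n M from ⟨C, hC⟩).properSpace
  obtain ⟨h₀, g₀, hh₀, hg₀, hfhg⟩ := hf
  set μ := riemVol n M with hμ
  set T := rearrAvg μ (fun x => |gradLen n f x| ^ q) t with hTdef
  have htq : ENNReal.ofReal (t ^ (1 / q)) ≠ 0 := by
    simpa using Real.rpow_pos_of_pos ht _
  -- With `T` infinite the right side is infinite, as its constant and the power of `t` are nonzero.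
  rcases eq_or_ne T ⊤ with hT | hT
  · have h1 : rearrAvgPow μ q (gradLen n f) t = ⊤ := by
      rw [rearrAvgPow, ← hTdef, hT, ENNReal.top_rpow_of_pos (by positivity)]
    rw [h1, ENNReal.mul_top htq, ENNReal.mul_top]
    · exact le_top
    · exact ENNReal.coe_ne_zero.2 (by positivity)
  obtain ⟨N, L, g, B, hgN, hgL, hL, hBm, hB, hgf⟩ :=
    exists_lipschitz_eq_off_small_set hq hC hC1 hP hh₀ hg₀ hfhg ht hT
  obtain ⟨⟨N₀, hN₀⟩, L₀, hL₀⟩ := hg₀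
  have hBt : μ B ≠ ⊤ := ne_top_of_le_ne_top (ENNReal.mul_ne_top (by simp) ENNReal.ofReal_ne_top) hB
  have hfw : HasWeakGrad n f := ⟨_, (hh₀.2.1.isWeakGrad.add
    (isWeakGrad_grad_of_lipschitz (n := n) hL₀)).congr hfhg (Eventually.of_forall fun _ => rfl)⟩
  have hhw := hfw.isWeakGrad.sub (isWeakGrad_grad_of_lipschitz (n := n) hgL)
  set Y : ∀ p : M, TangentSpace (𝓡 n) p := fun p => weakGrad f p - grad g p with hY
  -- Off `B` the difference `f - g` is zero, so its gradient vanishes almost everywhere there by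
  -- locality, whatever the shape of `B`.
  have hYle : ∀ᵐ p ∂μ, ‖‖Y p‖‖ ≤ B.indicator (gradLen n f) p + B.indicator (fun _ => (L : ℝ)) p := by
    filter_upwards [hhw.ae_eq_zero_of_eq_zero] with p hp
    by_cases hpB : p ∈ B
    · rw [indicator_of_mem hpB, indicator_of_mem hpB, norm_norm]
      exact (norm_sub_le _ _).trans (add_le_add le_rfl (norm_grad_le hgL p))
    · rw [indicator_of_notMem hpB, indicator_of_notMem hpB, hp (by rw [hgf p hpB, sub_self])]
      simp
  have hum : AEMeasurable (fun x => |gradLen n f x| ^ q) μ :=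
    hfw.aemeasurable_gradLen.abs.pow_const q
  have hgm : AEStronglyMeasurable (gradLen n f) μ := hfw.aemeasurable_gradLen.aestronglyMeasurable
  have hYnorm : eLpNorm (fun p => ‖Y p‖) (ENNReal.ofReal q) μ ≤
      (3 * (ENNReal.ofReal t * T)) ^ (1 / q) + L * (2 * ENNReal.ofReal t) ^ (1 / q) := by
    refine (eLpNorm_mono_ae_real hYle).trans ((eLpNorm_add_le (hgm.indicator hBm)
      (aestronglyMeasurable_const.indicator hBm) hq1).trans (add_le_add ?_ ?_))
    · rw [eLpNorm_indicator_eq_eLpNorm_restrict hBm, eLpNorm_eq_lintegral_rpow_enorm_toReal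
        (by simpa using hq0) ENNReal.ofReal_ne_top, ENNReal.toReal_ofReal hq0.le]
      refine ENNReal.rpow_le_rpow ?_ hqi
      have := setLIntegral_le_three_mul hum ht hB
      simpa only [enorm_abs_rpow _ hq0.le] using this
    · rw [eLpNorm_indicator_const hBm (by simpa using hq0) ENNReal.ofReal_ne_top,
        ENNReal.toReal_ofReal hq0.le, Real.enorm_of_nonneg L.coe_nonneg, ENNReal.ofReal_coe_nnreal]
      gcongr
  have hT' : ENNReal.ofReal t * T ≠ ⊤ := ENNReal.mul_ne_top ENNReal.ofReal_ne_top hT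
  have hYt : eLpNorm (fun p => ‖Y p‖) (ENNReal.ofReal q) μ < ⊤ := by
    refine hYnorm.trans_lt (ENNReal.add_lt_top.2 ⟨?_, ENNReal.mul_lt_top ENNReal.coe_lt_top ?_⟩)
    · exact ENNReal.rpow_lt_top_of_nonneg hqi (ENNReal.mul_ne_top (by simp) hT')
    · exact ENNReal.rpow_lt_top_of_nonneg hqi (ENNReal.mul_ne_top (by simp) ENNReal.ofReal_ne_top)
  -- On `B` the difference is `h₀` plus a bounded function, off `B` it is zero; since `μ(B)` is
  -- finite it lies in `L_q`, even if `f` and `g` do not.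
  have hhL : MemLp (fun p => f p - g p) (ENNReal.ofReal q) μ := by
    have h1 : MemLp (B.indicator fun _ => N₀ + N) (ENNReal.ofReal q) μ :=
      memLp_indicator_const _ hBm _ (Or.inr hBt)
    refine (hh₀.1.norm.add h1).mono' hhw.aemeasurable.aestronglyMeasurable ?_
    filter_upwards [hfhg] with p hp
    by_cases hpB : p ∈ B
    · rw [Pi.add_apply, indicator_of_mem hpB, hp, add_sub_assoc]
      refine (norm_add_le _ _).trans (add_le_add le_rfl ((norm_sub_le _ _).trans ?_))
      exact add_le_add (hN₀ p) (hgN p)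
    · rw [Pi.add_apply, indicator_of_notMem hpB, hgf p hpB, sub_self, norm_zero, add_zero]
      exact norm_nonneg _
  have hhW : MemW n q (fun p => f p - g p) :=
    memW_of_memLp hq hhw hhL ⟨hhw.aemeasurable_norm.aestronglyMeasurable, hYt⟩
  have hK : KPrime n q f (t ^ (1 / q)) ≤ eLpNorm (gradLen n fun p => f p - g p) (ENNReal.ofReal q) μ +
      ENNReal.ofReal (t ^ (1 / q)) * eLpNorm (gradLen n g) ⊤ μ :=
    sInf_le ⟨_, g, hhW, ⟨⟨N, hgN⟩, L, hgL⟩, Eventually.of_forall fun p => by simp, rfl⟩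
  rw [eLpNorm_congr_ae hhw.gradLen_ae_eq] at hK
  refine hK.trans ((add_le_add hYnorm (mul_le_mul_right (eLpNorm_gradLen_le_of_lipschitz hgL)
    _)).trans ?_)
  rw [rearrAvgPow, ← hTdef]
  rw [ENNReal.mul_rpow_of_nonneg _ _ hqi] at hL
  rw [ENNReal.mul_rpow_of_nonneg _ _ hqi, ENNReal.mul_rpow_of_nonneg _ _ hqi,
    ENNReal.mul_rpow_of_nonneg _ _ hqi, ENNReal.ofReal_rpow_of_nonneg ht.le hqi]
  set a := ENNReal.ofReal (t ^ (1 / q))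
  set τ := T ^ (1 / q)
  calc 3 ^ (1 / q) * (a * τ) + L * (2 ^ (1 / q) * a) + a * L
      = 3 ^ (1 / q) * (a * τ) + L * ((2 ^ (1 / q) + 1) * a) := by ring
    _ ≤ 3 ^ (1 / q) * (a * τ) + ((6 * C + 2 * C ^ 2) * (P * ((C ^ 3 + 1) ^ (1 / q) * τ))) *
        ((2 ^ (1 / q) + 1) * a) := by gcongr
    _ = _ := by
      push_cast
      rw [ENNReal.coe_rpow_of_nonneg _ hqi, ENNReal.coe_rpow_of_nonneg _ hqi,
        ENNReal.coe_rpow_of_nonneg _ hqi]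
      push_cast
      ring

end UpperBound

end

end RiemSobolev

theorem theorem4p2 (n : ℕ) (M : Type*) [MetricSpace M] [SecondCountableTopology M]
    [ChartedSpace (EuclideanSpace ℝ (Fin n)) M] [IsManifold (𝓡 n) ∞ M]
    [RiemannianBundle (fun x : M => TangentSpace (𝓡 n) x)]
    [IsContMDiffRiemannianBundle (𝓡 n) ∞ (EuclideanSpace ℝ (Fin n))
      (fun x : M => TangentSpace (𝓡 n) x)]
    [IsRiemannianManifold (𝓡 n) M] [CompleteSpace M] [MeasurableSpace M] [BorelSpace M]
    (q : ℝ) (hq : 1 ≤ q)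
    (hD : RiemSobolev.Doubling n M) (hP : RiemSobolev.Poincare n M q) :
    (∃ C₁ C₂ : ℝ≥0, 0 < C₁ ∧ 0 < C₂ ∧
      ∀ f : M → ℝ, RiemSobolev.MemWSum n q f →
        RiemSobolev.rearrInfty (RiemSobolev.riemVol n M) f = 0 →
        RiemSobolev.rearrInfty (RiemSobolev.riemVol n M) (RiemSobolev.gradLen n f) = 0 →
        ∀ t : ℝ, 0 < t →
          C₁ * (ENNReal.ofReal (t ^ (1 / q)) * RiemSobolev.rearrAvgPow
              (RiemSobolev.riemVol n M) q (RiemSobolev.gradLen n f) t) ≤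
            RiemSobolev.KPrime n q f (t ^ (1 / q)) ∧
          RiemSobolev.KPrime n q f (t ^ (1 / q)) ≤
            C₂ * (ENNReal.ofReal (t ^ (1 / q)) * RiemSobolev.rearrAvgPow
              (RiemSobolev.riemVol n M) q (RiemSobolev.gradLen n f) t)) ∧
    (∃ C₁ C₂ : ℝ≥0, 0 < C₁ ∧ 0 < C₂ ∧
      ∀ f : M → ℝ, RiemSobolev.MemWSum n q f →
        RiemSobolev.rearrInfty (RiemSobolev.riemVol n M) f = 0 →
        RiemSobolev.rearrInfty (RiemSobolev.riemVol n M) (RiemSobolev.gradLen n f) = 0 →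
        ∀ t : ℝ, 0 < t →
          C₁ * RiemSobolev.KHom n q f (t ^ (1 / q)) ≤
            RiemSobolev.KPrime n q f (t ^ (1 / q)) ∧
          RiemSobolev.KPrime n q f (t ^ (1 / q)) ≤
            C₂ * RiemSobolev.KHom n q f (t ^ (1 / q))) := by
  obtain ⟨C₀, hC₀⟩ := hD
  obtain ⟨P, hP⟩ := hP
  -- A doubling constant of at least 1 is arranged, since the maximal function estimate divides by a
  -- power of it.
  have hC : ∀ (x : M) (r : ℝ), 0 < r → RiemSobolev.riemVol n M (Metric.ball x (2 * r)) ≤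
      (max C₀ 1 : ℝ≥0) * RiemSobolev.riemVol n M (Metric.ball x r) := fun x r hr =>
    (hC₀ x r hr).trans (by gcongr; exact le_max_left _ _)
  set C : ℝ≥0 := max C₀ 1
  set D : ℝ≥0 := ((2 : ℝ≥0) ^ (q - 1)) ^ (1 / q) with hD
  have hD0 : 0 < D := by positivity
  set A : ℝ≥0 :=
    3 ^ (1 / q) + (6 * C + 2 * C ^ 2) * P * (C ^ 3 + 1) ^ (1 / q) * (2 ^ (1 / q) + 1) with hA
  have hA0 : 0 < A := by positivity
  have hle : ∀ (f : M → ℝ) (t : ℝ), RiemSobolev.KHom n q f t ≤ RiemSobolev.KPrime n q f t := by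
    refine fun f t => sInf_le_sInf ?_
    rintro r ⟨h, g, hh, hg, hfg, rfl⟩
    exact ⟨h, g, hh.memEDot, hg.memEDot, hfg, rfl⟩
  have hinv : ((D⁻¹ : ℝ≥0) : ℝ≥0∞) * D = 1 := by
    rw [← ENNReal.coe_mul, inv_mul_cancel₀ hD0.ne', ENNReal.coe_one]
  -- The lower bound is taken for the larger class of homogeneous decompositions: it then yields
  -- both the lower bound for `K'` and, combined with the upper bound, the comparison of the
  -- functionals.
  have hlow : ∀ (f : M → ℝ) (t : ℝ), 0 < t → ENNReal.ofReal (t ^ (1 / q)) *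
      RiemSobolev.rearrAvgPow (RiemSobolev.riemVol n M) q (RiemSobolev.gradLen n f) t ≤
        D * RiemSobolev.KHom n q f (t ^ (1 / q)) := by
    intro f t ht
    set a := ENNReal.ofReal (t ^ (1 / q)) *
      RiemSobolev.rearrAvgPow (RiemSobolev.riemVol n M) q (RiemSobolev.gradLen n f) t
    have h1 : ((D⁻¹ : ℝ≥0) : ℝ≥0∞) * a ≤ RiemSobolev.KHom n q f (t ^ (1 / q)) := by
      refine le_sInf ?_
      rintro r ⟨h, g, hh, hg, hfg, rfl⟩
      refine (mul_le_mul_right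
        (RiemSobolev.rearrAvgPow_le_of_decomposition hq hh hg hfg ht) _).trans_eq ?_
      rw [← mul_assoc, hinv, one_mul]
    calc a = D * (((D⁻¹ : ℝ≥0) : ℝ≥0∞) * a) := by rw [← mul_assoc, mul_comm (D : ℝ≥0∞), hinv, one_mul]
      _ ≤ _ := mul_le_mul_right h1 _
  have hup : ∀ f : M → ℝ, RiemSobolev.MemWSum n q f → ∀ t : ℝ, 0 < t →
      RiemSobolev.KPrime n q f (t ^ (1 / q)) ≤ A * (ENNReal.ofReal (t ^ (1 / q)) *
        RiemSobolev.rearrAvgPow (RiemSobolev.riemVol n M) q (RiemSobolev.gradLen n f) t) :=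
    fun f hf t ht => RiemSobolev.KPrime_le_of_doubling hq hC (le_max_right _ _) hP hf ht
  refine ⟨⟨D⁻¹, A, inv_pos.2 hD0, hA0, fun f hf _ _ t ht => ⟨?_, hup f hf t ht⟩⟩,
    ⟨1, A * D, one_pos, mul_pos hA0 hD0, fun f hf _ _ t ht => ⟨?_, ?_⟩⟩⟩
  · calc _ ≤ ((D⁻¹ : ℝ≥0) : ℝ≥0∞) * (D * RiemSobolev.KHom n q f (t ^ (1 / q))) :=
          mul_le_mul_right (hlow f t ht) _
      _ = RiemSobolev.KHom n q f (t ^ (1 / q)) := by rw [← mul_assoc, hinv, one_mul]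
      _ ≤ _ := hle f _
  · rw [ENNReal.coe_one, one_mul]
    exact hle f _
  · refine (hup f hf t ht).trans ?_
    rw [ENNReal.coe_mul, mul_assoc]
    exact mul_le_mul_right (hlow f t ht) _
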